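/- Throughout, $|q|<1$, $(a;q)_n=\prod_{k=0}^{n-1}(1-aq^k)$ for $n\ge 0$, $(a;q)_\infty=\prod_{k\ge 0}(1-aq^k)$, $J_m=(q^m;q^m)_\infty$, and $J_{a,m}=(q^a;q^m)_\infty(q^{m-a};q^m)_\infty(q^m;q^m)_\infty$. Then \begin{align*} \sum_{i,j\geq 0}\frac{q^{i^2+2j^2-2ij}}{(q^4;q^4)_i(q^4;q^4)_j}&=\frac{J_4^3J_{56}J_{6,28}}{J_2^2 J_8 J_{8,56}J_{24,56}}+2q\frac{J_8J_{56}J_{8,56}}{J_4^2J_{4,56}},\\ \sum_{i,j\geq 0}\frac{q^{i^2+2j^2-2ij+2i-2j}}{(q^4;q^4)_i(q^4;q^4)_j}&= 2\frac{J_8J_{56}J_{24,56}}{J_4^2J_{12,56}}+q\frac{J_4^3J_{28}J_{10,56}J_{18,56}}{J_2^2J_8J_{56}J_{16,56}J_{24,56}},\\ \sum_{i,j\geq 0}\frac{q^{i^2+2j^2-2ij+2i}}{(q^4;q^4)_i (q^4;q^4)_j}&=\frac{J_4^3J_{28}J_{2,56}J_{26,56}}{J_2^2J_8J_{56}J_{8,56}J_{16,56}}+2q^3\frac{J_8J_{56}J_{16,56}}{J_4^2J_{20,56}}.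 \end{align*} Moreover, let $A=\begin{pmatrix}1/2&-1/2\\-1/2&1\end{pmatrix}$, let $(B,C)$ be one of $$\left(\begin{pmatrix}0\\0\end{pmatrix},-\frac{5}{84}\right),\quad \left(\begin{pmatrix}1/2\\-1/2\end{pmatrix},\frac{1}{21}\right),\quad \left(\begin{pmatrix}1/2\\0\end{pmatrix},\frac{1}{84}\right),$$ and let $$f_{A,B,C}(q)=\sum_{n=(n_1,n_2)^{\mathrm T}\in(\mathbb{Z}_{\ge 0})^2}\frac{q^{\frac12 n^{\mathrm T}An+n^{\mathrm T}B+C}}{(q;q)_{n_1}(q;q)_{n_2}},$$ where $q=e^{2\pi i\tau}$ and $q^x=e^{2\pi i x\tau}$ for $\operatorname{Im}\tau>0$ and $x\in\mathbb{Q}$. This series converges absolutely, and $\tau\mapsto f_{A,B,C}(q^{84})$ is a modular function on $\Gamma_1(7056)$: it is meromorphic on the upper half-plane, invariant under $\Gamma_1(7056)$, and meromorphic at every cusp. -/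

import Mathlib

namespace Nahm

/-- The finite `q`-Pochhammer symbol `(a;q)_n = ∏_{k=0}^{n-1} (1 - a q^k)`. -/
noncomputable def qPoch (a q : ℂ) (n : ℕ) : ℂ :=
  ∏ k ∈ Finset.range n, (1 - a * q ^ k)

/-- The infinite `q`-Pochhammer symbol `(a;q)_∞ = ∏_{k=0}^∞ (1 - a q^k)`, for `|q| < 1`. -/
noncomputable def qPochInf (a q : ℂ) : ℂ :=
  ∏' k : ℕ, (1 - a * q ^ k)

/-- The product defining `(a;q)_∞` converges absolutely for `|q| < 1`. -/
theorem multipliable_qPochInf (a q : ℂ) (hq : ‖q‖ < 1) :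
    Multipliable fun k : ℕ => 1 - a * q ^ k := by
  have h : Summable fun k : ℕ => ‖-(a * q ^ k)‖ := by
    simpa [norm_mul, norm_pow] using
      (summable_geometric_of_lt_one (norm_nonneg q) hq).mul_left ‖a‖
  simpa [sub_eq_add_neg] using multipliable_one_add_of_summable h

/-- `J_m = (q^m; q^m)_∞`, for `m ≥ 1`. -/
noncomputable def J (m : ℕ) (q : ℂ) : ℂ :=
  qPochInf (q ^ m) (q ^ m)

/-- `J_{a,m} = (q^a, q^{m-a}, q^m; q^m)_∞`, for `0 < a < m`. -/
noncomputable def JJ (a m : ℕ) (q : ℂ) : ℂ :=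
  qPochInf (q ^ a) (q ^ m) * qPochInf (q ^ (m - a)) (q ^ m) * qPochInf (q ^ m) (q ^ m)

/-- The term of index `n` of the rank `r` Nahm sum attached to `(A, B, C)`, at `q = e^{2πiτ}`:
`q^{nᵀAn/2 + nᵀB + C} / ((q;q)_{n_1} ⋯ (q;q)_{n_r})`, where `q^x` means `e^{2πixτ}`. -/
noncomputable def nahmTerm {r : ℕ} (A : Matrix (Fin r) (Fin r) ℝ) (B : Fin r → ℝ) (C : ℝ)
    (τ : ℂ) (n : Fin r → ℕ) : ℂ :=
  Complex.exp (2 * Real.pi * Complex.I * τ *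
      (((1 / 2 : ℝ) * (∑ i, ∑ j, (n i : ℝ) * A i j * (n j : ℝ)) + (∑ i, (n i : ℝ) * B i) + C : ℝ)
        : ℂ)) /
    ∏ i, qPoch (Complex.exp (2 * Real.pi * Complex.I * τ))
      (Complex.exp (2 * Real.pi * Complex.I * τ)) (n i)

/-- The Nahm sum `f_{A,B,C}(q)` as a function of `τ`, with `q = e^{2πiτ}`. In these terms,
`f_{A,B,C}(q^k)` is `nahmSum A B C (k * τ)`. -/
noncomputable def nahmSum {r : ℕ} (A : Matrix (Fin r) (Fin r) ℝ) (B : Fin r → ℝ) (C : ℝ)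
    (τ : ℂ) : ℂ :=
  ∑' n : Fin r → ℕ, nahmTerm A B C τ n

/-- `f` is a modular function (of weight `0`, with trivial multiplier) on the subgroup `Γ` of
`SL(2, ℤ)`: it is meromorphic on the upper half-plane, invariant under `Γ`, and meromorphic at
every cusp.

Meromorphic functions are taken in normal form (continuous away from their poles, with the
value `0` at the poles), so that they are determined as functions. Meromorphy at the cusp `γ ∞`
says that for some `h ≥ 1` the function `f (γ τ)` is, for large `Im τ`, a meromorphic function
of `e^{2πiτ/h}` near `0`. -/
structure IsModularFunction (Γ : Subgroup (Matrix.SpecialLinearGroup (Fin 2) ℤ))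
    (f : UpperHalfPlane → ℂ) : Prop where
  meromorphic : MeromorphicNFOn (fun z : ℂ => f (UpperHalfPlane.ofComplex z)) {z : ℂ | 0 < z.im}
  invariant : ∀ γ ∈ Γ, ∀ τ : UpperHalfPlane, f (γ • τ) = f τ
  meromorphic_at_cusps : ∀ γ : Matrix.SpecialLinearGroup (Fin 2) ℤ,
    ∃ h : ℕ, 0 < h ∧ ∃ g : ℂ → ℂ, MeromorphicAt g 0 ∧
      ∀ᶠ τ : UpperHalfPlane in UpperHalfPlane.atImInfty,
        f (γ • τ) = g (Complex.exp (2 * Real.pi * Complex.I * (τ : ℂ) / (h : ℂ)))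

/-- The matrix part of the modular triples considered here. -/
noncomputable def zagierMatrix : Matrix (Fin 2) (Fin 2) ℝ :=
  !![1 / 2, -1 / 2; -1 / 2, 1]

end Nahm

open Filter Topology

namespace Nahm

/-! ### Infinite `q`-Pochhammer symbols -/

/-! Identities. For fixed `i`, Euler's identity sums over `j` and leaves the factor `(-q^{β+2-2i};
q^4)_∞`, where `β` is the coefficient of `j` in the exponent. Splitting `i` by parity and turning
the negative powers of `q` around gives, with `x = q^2`, single sums with weights `x^{n²}(-x;x²)_n`
or `x^{n²+n}(-x²;x²)_n` against `1/(x²;x²)_{2n}` or `1/(x²;x²)_{2n±1}`, sometimes with an extra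
`x^{2n}`. These are sums of Rogers and Slater type, and Bailey's method evaluates them. The
reciprocal factorials are differences of two bilateral sums over `j` (`bailey_pair_one` and its
companions). Interchanging the sums and using the conjugate Bailey pair `hasSum_conjugateBailey`
produces two theta series in `x^{21j²+…}`. The quintuple product identity `hasSum_quintupleProduct`
turns their difference into a product. The rest is bookkeeping with products to the base `x^28`.

Modularity. By the same evaluation, `f_{A,B,C}(q^84)` is a sum of two infinite products times powers
of `e^{πiτ}`. Each is a constant times a quotient of theta functions `charTheta a b` at `1176τ`.
These are normalised so that `SL(2, ℤ)` permutes them through its action on `(a, b)`, with an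
automorphy factor independent of `(a, b)` (`charTheta_smul`). The surplus power of the eta function
is written as a product of division values of order two and three (`thetaD_charTheta`), so numerator
and denominator become homogeneous of the same degree and the automorphy factor cancels.

On `Γ₁(7056)` the characteristics move only by integers, and the resulting roots of unity cancel
(`levelTheta_smul`). At a cusp, a Hermite decomposition of `diag(1176, 1)γ` reduces the quotient to
thetas at `(ατ+β)/δ`, which are power series in some `e^{2πiτ/h}`. The denominators have product
expansions without zeros, so the functions are holomorphic on the upper half-plane. -/

theorem one_sub_pow_ne_zero {q : ℂ} (hq : ‖q‖ < 1) (n : ℕ) : 1 - q ^ (n + 1) ≠ 0 := by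
  intro h
  have h1 : ‖q ^ (n + 1)‖ < 1 := by
    rw [norm_pow]
    exact pow_lt_one₀ (norm_nonneg _) hq (Nat.succ_ne_zero n)
  rw [← sub_eq_zero.mp h] at h1
  simp at h1

theorem qPoch_succ (a q : ℂ) (n : ℕ) :
    qPoch a q (n + 1) = qPoch a q n * (1 - a * q ^ n) := by
  simp [qPoch, Finset.prod_range_succ]

theorem qPoch_self_ne_zero {q : ℂ} (hq : ‖q‖ < 1) (n : ℕ) : qPoch q q n ≠ 0 := by
  rw [qPoch, Finset.prod_ne_zero_iff]
  intro k _
  rw [← pow_succ']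
  exact one_sub_pow_ne_zero hq k

theorem tendsto_qPoch (a : ℂ) {q : ℂ} (hq : ‖q‖ < 1) :
    Tendsto (qPoch a q) atTop (𝓝 (qPochInf a q)) :=
  (multipliable_qPochInf a q hq).hasProd.tendsto_prod_nat

theorem qPochInf_eq_qPoch_mul (a : ℂ) {q : ℂ} (hq : ‖q‖ < 1) (n : ℕ) :
    qPochInf a q = qPoch a q n * qPochInf (a * q ^ n) q := by
  refine tendsto_nhds_unique ((tendsto_add_atTop_iff_nat n).mpr (tendsto_qPoch a hq)) ?_
  refine ((tendsto_qPoch (a * q ^ n) hq).const_mul (qPoch a q n)).congr fun m => ?_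
  rw [qPoch, qPoch, qPoch, add_comm m n, Finset.prod_range_add]
  simp [pow_add, mul_assoc]

theorem qPochInf_step (a : ℂ) {q : ℂ} (hq : ‖q‖ < 1) :
    qPochInf a q = (1 - a) * qPochInf (a * q) q := by
  simpa [qPoch] using qPochInf_eq_qPoch_mul a hq 1

theorem qPochInf_ne_zero {a q : ℂ} (hq : ‖q‖ < 1) (h : ∀ k : ℕ, 1 - a * q ^ k ≠ 0) :
    qPochInf a q ≠ 0 := by
  have := tprod_one_add_ne_zero_of_summable (f := fun k : ℕ => -(a * q ^ k))
    (fun k => by simpa [sub_eq_add_neg] using h k)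
    (by simpa [norm_mul, norm_pow] using
      (summable_geometric_of_lt_one (norm_nonneg q) hq).mul_left ‖a‖)
  simpa [qPochInf, sub_eq_add_neg] using this

theorem qPochInf_ne_zero_of_norm_lt {a q : ℂ} (hq : ‖q‖ < 1) (ha : ‖a‖ < 1) :
    qPochInf a q ≠ 0 := by
  refine qPochInf_ne_zero hq fun k h => ?_
  have h1 : ‖a * q ^ k‖ < 1 := by
    rw [norm_mul, norm_pow]
    exact mul_lt_one_of_nonneg_of_lt_one_left (norm_nonneg _) ha
      (pow_le_one₀ (norm_nonneg _) hq.le)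
  rw [← sub_eq_zero.mp h] at h1
  simp at h1

theorem qPochInf_mul_neg (a : ℂ) {q : ℂ} (hq : ‖q‖ < 1) :
    qPochInf a q * qPochInf (-a) q = qPochInf (a ^ 2) (q ^ 2) := by
  have hq2 : ‖q ^ 2‖ < 1 := by
    rw [norm_pow]; exact pow_lt_one₀ (norm_nonneg _) hq two_ne_zero
  refine tendsto_nhds_unique ((tendsto_qPoch a hq).mul (tendsto_qPoch (-a) hq)) ?_
  refine (tendsto_qPoch (a ^ 2) hq2).congr fun m => ?_
  rw [qPoch, qPoch, qPoch, ← Finset.prod_mul_distrib]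
  refine Finset.prod_congr rfl fun k _ => ?_
  ring

/-- Splitting `(a;q)_∞` according to the residue of the index modulo `k`. -/
theorem qPochInf_eq_prod (a : ℂ) {q : ℂ} (hq : ‖q‖ < 1) {k : ℕ} (hk : 0 < k) :
    qPochInf a q = ∏ j ∈ Finset.range k, qPochInf (a * q ^ j) (q ^ k) := by
  have hqk : ‖q ^ k‖ < 1 := by
    rw [norm_pow]; exact pow_lt_one₀ (norm_nonneg _) hq hk.ne'
  refine tendsto_nhds_unique ((tendsto_qPoch a hq).comp
    (tendsto_id.const_mul_atTop' hk)) ?_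
  refine (tendsto_finsetProd _ fun j _ => tendsto_qPoch (a * q ^ j) hqk).congr fun m => ?_
  simp only [Function.comp, qPoch, id]
  rw [Finset.prod_comm]
  induction m with
  | zero => simp
  | succ m ih =>
    rw [Finset.prod_range_succ, ih, Nat.mul_succ, Finset.prod_range_add]
    congr 1
    refine Finset.prod_congr rfl fun j _ => ?_
    ring

/-! ### Reciprocals of `(q;q)_k` for integral `k` -/

/-- `1 / (q;q)_k` for `k ≥ 0`, and `0` for `k < 0`. -/
noncomputable def recipPoch (q : ℂ) (k : ℤ) : ℂ :=
  if 0 ≤ k then (qPoch q q k.toNat)⁻¹ else 0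

theorem recipPoch_natCast (q : ℂ) (n : ℕ) : recipPoch q n = (qPoch q q n)⁻¹ := by
  simp [recipPoch]

theorem recipPoch_of_neg (q : ℂ) {k : ℤ} (hk : k < 0) : recipPoch q k = 0 := by
  simp [recipPoch, not_le.mpr hk]

theorem recipPoch_zero (q : ℂ) : recipPoch q 0 = 1 := by
  simp [recipPoch, qPoch]

/-- With the value `0` at negative indices this recurrence holds for every integer, `1 - q^0`
vanishing at the boundary. Hence the telescoping arguments need no boundary cases. -/
theorem recipPoch_sub_one {q : ℂ} (hq : ‖q‖ < 1) (k : ℤ) :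
    recipPoch q (k - 1) = (1 - q ^ k) * recipPoch q k := by
  rcases lt_trichotomy k 0 with hk | rfl | hk
  · rw [recipPoch_of_neg q hk, recipPoch_of_neg q (by omega), mul_zero]
  · simp [recipPoch_of_neg]
  · obtain ⟨n, rfl⟩ : ∃ n : ℕ, k = n + 1 := ⟨(k - 1).toNat, by omega⟩
    have h2 : ((n : ℤ) + 1) = ((n + 1 : ℕ) : ℤ) := by push_cast; ring
    rw [add_sub_cancel_right, recipPoch_natCast, h2, recipPoch_natCast, qPoch_succ, ← pow_succ',
      zpow_natCast]
    have := one_sub_pow_ne_zero hq n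
    have := qPoch_self_ne_zero hq n
    field_simp

theorem tendsto_recipPoch {q : ℂ} (hq : ‖q‖ < 1) :
    Tendsto (fun n : ℕ => recipPoch q n) atTop (𝓝 (qPochInf q q)⁻¹) := by
  simp only [recipPoch_natCast]
  exact (tendsto_qPoch q hq).inv₀ (qPochInf_ne_zero_of_norm_lt hq hq)

theorem exists_norm_recipPoch_le {q : ℂ} (hq : ‖q‖ < 1) :
    ∃ C : ℝ, 0 ≤ C ∧ ∀ k : ℤ, ‖recipPoch q k‖ ≤ C := by
  obtain ⟨C, hC⟩ := (Metric.isBounded_range_of_tendsto _ (tendsto_recipPoch hq)).exists_norm_le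
  have hC0 : 0 ≤ C := (norm_nonneg _).trans (hC _ ⟨0, rfl⟩)
  refine ⟨C, hC0, fun k => ?_⟩
  rcases lt_or_ge k 0 with hk | hk
  · simpa [recipPoch_of_neg q hk]
  · lift k to ℕ using hk
    exact hC _ ⟨k, rfl⟩

theorem exists_norm_qPoch_le (a : ℂ) {q : ℂ} (hq : ‖q‖ < 1) :
    ∃ C : ℝ, 0 ≤ C ∧ ∀ n : ℕ, ‖qPoch a q n‖ ≤ C := by
  obtain ⟨C, hC⟩ := (Metric.isBounded_range_of_tendsto _ (tendsto_qPoch a hq)).exists_norm_le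
  exact ⟨C, (norm_nonneg _).trans (hC _ ⟨0, rfl⟩), fun n => hC _ ⟨n, rfl⟩⟩

/-! ### Summability of theta-like series -/

/-- Comparison with the majorant of the two-variable Jacobi theta series, with `-log‖q‖/π` as lower
bound for `Im τ` and `|log‖z‖|/(2π)` as upper bound for `|Im z|`. -/
theorem summable_norm_zpow_sq_mul {q z : ℂ} (hq0 : q ≠ 0) (hq : ‖q‖ < 1) (hz : z ≠ 0) :
    Summable fun n : ℤ => ‖q ^ (n ^ 2) * z ^ n‖ := by
  have hq' : 0 < ‖q‖ := norm_pos_iff.mpr hq0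
  have hz' : 0 < ‖z‖ := norm_pos_iff.mpr hz
  have hT : 0 < -Real.log ‖q‖ / Real.pi :=
    div_pos (neg_pos.mpr (Real.log_neg hq' hq)) Real.pi_pos
  refine Summable.of_nonneg_of_le (fun _ => norm_nonneg _) (fun n => ?_)
    (summable_pow_mul_jacobiTheta₂_term_bound (|Real.log ‖z‖| / (2 * Real.pi)) hT 0)
  rw [norm_mul, norm_zpow, norm_zpow, pow_zero, one_mul]
  have e1 : ‖q‖ ^ (n ^ 2) * ‖z‖ ^ n
      = Real.exp ((n : ℝ) ^ 2 * Real.log ‖q‖ + n * Real.log ‖z‖) := by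
    rw [Real.exp_add, ← Real.rpow_intCast, ← Real.rpow_intCast, Real.rpow_def_of_pos hq',
      Real.rpow_def_of_pos hz']
    push_cast
    ring_nf
  rw [e1]
  apply Real.exp_le_exp.mpr
  have h2 : (n : ℝ) * Real.log ‖z‖ ≤ |(n : ℝ)| * |Real.log ‖z‖| := by
    rw [← abs_mul]; exact le_abs_self _
  have hpi := Real.pi_ne_zero
  have e3 : -Real.pi * (-Real.log ‖q‖ / Real.pi * (n : ℝ) ^ 2
      - 2 * (|Real.log ‖z‖| / (2 * Real.pi)) * |(n : ℝ)|)
      = (n : ℝ) ^ 2 * Real.log ‖q‖ + |(n : ℝ)| * |Real.log ‖z‖| := by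
    field_simp
    ring
  push_cast
  linarith

theorem summable_norm_zpow_quadratic {q z : ℂ} (hq0 : q ≠ 0) (hq : ‖q‖ < 1) (hz : z ≠ 0)
    {a : ℤ} (ha : 0 < a) (b c : ℤ) :
    Summable fun n : ℤ => ‖q ^ (a * n ^ 2 + b * n + c) * z ^ n‖ := by
  have hqa : ‖q ^ a‖ < 1 := by
    lift a to ℕ using ha.le
    rw [zpow_natCast, norm_pow]
    exact pow_lt_one₀ (norm_nonneg _) hq (by omega)
  refine ((summable_norm_zpow_sq_mul (zpow_ne_zero a hq0) hqa
    (mul_ne_zero (zpow_ne_zero b hq0) hz)).mul_left ‖q ^ c‖).congr fun n => ?_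
  rw [← norm_mul]
  congr 1
  rw [mul_zpow, ← zpow_mul, ← zpow_mul, zpow_add₀ hq0, zpow_add₀ hq0]
  ring

theorem summable_norm_zpow_quadratic' {q : ℂ} (hq0 : q ≠ 0) (hq : ‖q‖ < 1)
    {a : ℤ} (ha : 0 < a) (b c : ℤ) :
    Summable fun n : ℤ => ‖q ^ (a * n ^ 2 + b * n + c)‖ := by
  simpa using summable_norm_zpow_quadratic hq0 hq one_ne_zero ha b c

theorem summable_norm_nat_quadratic {q z : ℂ} (hq0 : q ≠ 0) (hq : ‖q‖ < 1) (hz : z ≠ 0)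
    {a : ℤ} (ha : 0 < a) (b c : ℤ) :
    Summable fun n : ℕ => ‖q ^ (a * (n : ℤ) ^ 2 + b * n + c) * z ^ n‖ := by
  simpa [Function.comp_def] using
    (summable_norm_zpow_quadratic hq0 hq hz ha b c).comp_injective Nat.cast_injective

theorem hasSum_telescope {t G : ℕ → ℂ} (ht : Summable t) (h : ∀ n, t n = G (n + 1) - G n)
    (h0 : G 0 = 0) (hG : Tendsto G atTop (𝓝 0)) : HasSum t 0 := by
  have h1 := ht.hasSum.tendsto_sum_nat
  have h2 : Tendsto (fun n => ∑ i ∈ Finset.range n, t i) atTop (𝓝 0) := by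
    refine hG.congr fun n => ?_
    rw [Finset.sum_congr rfl fun i _ => h i, Finset.sum_range_sub, h0, sub_zero]
  rw [← tendsto_nhds_unique h1 h2]
  exact ht.hasSum

/-- Interchange of a sum over `ℕ` with a sum over `ℤ` for a kernel bounded by a constant. -/
theorem hasSum_interchange {w : ℕ → ℂ} {A : ℤ → ℂ} {B : ℤ → ℕ → ℂ} {V : ℤ → ℂ} {S : ℕ → ℂ} {C : ℝ}
    (hw : Summable fun n => ‖w n‖) (hA : Summable fun j => ‖A j‖) (hB : ∀ j n, ‖B j n‖ ≤ C)
    (hV : ∀ j, HasSum (fun n => w n * B j n) (V j))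
    (hS : ∀ n, HasSum (fun j => A j * B j n) (S n)) {s : ℂ}
    (hs : HasSum (fun j => A j * V j) s) : HasSum (fun n => w n * S n) s := by
  have hsum : Summable fun p : ℕ × ℤ => w p.1 * (A p.2 * B p.2 p.1) := by
    refine Summable.of_norm_bounded ((hw.mul_of_nonneg hA (fun _ => norm_nonneg _)
      (fun _ => norm_nonneg _)).mul_right C) fun p => ?_
    rw [norm_mul, norm_mul, ← mul_assoc]
    exact mul_le_mul_of_nonneg_left (hB _ _) (by positivity)
  have h1 := hsum.hasSum.prod_fiberwise fun n => (hS n).mul_left (w n)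
  have h2 := ((Equiv.prodComm ℤ ℕ).hasSum_iff.mpr hsum.hasSum).prod_fiberwise
    (g := fun j => A j * V j) fun j => by
      refine ((hV j).mul_left (A j)).congr_fun fun n => ?_
      change w n * (A j * B j n) = A j * (w n * B j n)
      ring
  rw [h2.unique hs] at h1
  exact h1

/-! ### Euler's identity, the Jacobi triple product and the quintuple product -/

/-- Euler's identity `∑ p^{n²} z^n / (p²;p²)_n = (-zp;p²)_∞`. -/
theorem hasSum_euler {p z : ℂ} (hp0 : p ≠ 0) (hp : ‖p‖ < 1) (hz : z ≠ 0) :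
    HasSum (fun n : ℕ => p ^ ((n : ℤ) ^ 2) * z ^ n * recipPoch (p ^ 2) n)
      (qPochInf (-(z * p)) (p ^ 2)) := by
  have hp2 : ‖p ^ 2‖ < 1 := by
    rw [norm_pow]; exact pow_lt_one₀ (norm_nonneg _) hp two_ne_zero
  obtain ⟨C, hC0, hC⟩ := exists_norm_recipPoch_le hp2
  set f : ℂ → ℕ → ℂ := fun z n => p ^ ((n : ℤ) ^ 2) * z ^ n * recipPoch (p ^ 2) n with hf
  have hbound : ∀ z : ℂ, z ≠ 0 → Summable fun n : ℕ =>
      ‖p ^ (1 * (n : ℤ) ^ 2 + 0 * n + 0) * z ^ n‖ * C := fun z hz =>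
    (summable_norm_nat_quadratic hp0 hp hz one_pos 0 0).mul_right C
  have hle : ∀ (z : ℂ) (n : ℕ), ‖f z n‖ ≤ ‖p ^ (1 * (n : ℤ) ^ 2 + 0 * n + 0) * z ^ n‖ * C :=
    fun z n => by
      simp only [hf, norm_mul]
      refine mul_le_mul (le_of_eq ?_) (hC _) (norm_nonneg _) (by positivity)
      simp
  have hsum : ∀ z : ℂ, z ≠ 0 → Summable (f z) := fun z hz =>
    Summable.of_norm_bounded (hbound z hz) (hle z)
  -- Functional equation `S(z) = (1 + zp) S(zp²)`. Iterating it builds the product, while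
  -- `S(zp^{2n})` tends to its term of index `0`, which is `1`.
  have hstep : ∀ z : ℂ, z ≠ 0 → ∑' n, f z n = (1 + z * p) * ∑' n, f (z * p ^ 2) n :=
      fun z hz => by
    have hz2 : z * p ^ 2 ≠ 0 := mul_ne_zero hz (pow_ne_zero 2 hp0)
    have h1 : ∀ n, f z (n + 1) - f (z * p ^ 2) (n + 1) = z * p * f (z * p ^ 2) n := fun n => by
      have h := recipPoch_sub_one hp2 (n + 1 : ℤ)
      rw [add_sub_cancel_right] at h
      simp only [hf]
      push_cast
      rw [h, show ((n : ℤ) + 1) ^ 2 = n ^ 2 + n + n + 1 by ring]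
      simp only [zpow_add₀ hp0, zpow_natCast, zpow_one, zpow_add₀ (pow_ne_zero 2 hp0)]
      ring
    have h2 : f z 0 - f (z * p ^ 2) 0 = 0 := by simp [hf]
    have h3 := ((hsum z hz).sub (hsum _ hz2)).tsum_eq_zero_add
    rw [(hsum z hz).tsum_sub (hsum _ hz2), h2, tsum_congr h1, tsum_mul_left] at h3
    linear_combination h3
  have hiter : ∀ n : ℕ, ∑' k, f z k
      = qPoch (-(z * p)) (p ^ 2) n * ∑' k, f (z * (p ^ 2) ^ n) k := fun n => by
    induction n with
    | zero => simp [qPoch]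
    | succ n ih =>
      rw [ih, hstep _ (mul_ne_zero hz (pow_ne_zero _ (pow_ne_zero 2 hp0))), qPoch_succ, mul_assoc z ((p ^ 2) ^ n) (p ^ 2),
        ← pow_succ]
      ring
  have hlim : Tendsto (fun n : ℕ => ∑' k, f (z * (p ^ 2) ^ n) k) atTop
      (𝓝 (∑' k : ℕ, if k = 0 then 1 else 0)) := by
    refine tendsto_tsum_of_dominated_convergence (hbound z hz) (fun k => ?_)
      (Eventually.of_forall fun n k => ?_)
    · rcases Nat.eq_zero_or_pos k with rfl | hk
      · simp [hf, recipPoch_zero]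
      · rw [if_neg hk.ne']
        have := ((((tendsto_pow_atTop_nhds_zero_of_norm_lt_one hp2).const_mul z).pow k).const_mul
          (p ^ ((k : ℤ) ^ 2))).mul_const (recipPoch (p ^ 2) k)
        simpa [hk.ne'] using this
    · refine (hle _ k).trans ?_
      rw [norm_mul, norm_mul]
      refine mul_le_mul_of_nonneg_right (mul_le_mul_of_nonneg_left ?_ (norm_nonneg _)) hC0
      rw [norm_pow, norm_pow, norm_mul, norm_pow]
      refine pow_le_pow_left₀ (by positivity) ?_ _
      exact mul_le_of_le_one_right (norm_nonneg _) (pow_le_one₀ (norm_nonneg _) hp2.le)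
  rw [tsum_ite_eq] at hlim
  have h := ((tendsto_qPoch (-(z * p)) hp2).mul hlim).congr fun n => (hiter n).symm
  rw [mul_one] at h
  rw [← tendsto_nhds_unique tendsto_const_nhds h]
  exact (hsum z hz).hasSum

/-- `∑ b, q^{b²+bj} / ((q;q)_b (q;q)_{b+j}) = 1 / (q;q)_∞`. -/
theorem hasSum_durfee {q : ℂ} (hq0 : q ≠ 0) (hq : ‖q‖ < 1) (j : ℤ) :
    HasSum (fun b : ℕ => q ^ ((b : ℤ) ^ 2 + b * j) * recipPoch q b * recipPoch q (b + j))
      (qPochInf q q)⁻¹ := by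
  obtain ⟨C, hC0, hC⟩ := exists_norm_recipPoch_le hq
  set f : ℤ → ℕ → ℂ := fun j b =>
    q ^ ((b : ℤ) ^ 2 + b * j) * recipPoch q b * recipPoch q (b + j) with hf
  have hsum : ∀ j, Summable (f j) := fun j => by
    refine Summable.of_norm_bounded ((summable_norm_nat_quadratic hq0 hq one_ne_zero one_pos j
      0).mul_right (C * C)) fun b => ?_
    simp only [hf, norm_mul]
    rw [mul_assoc]
    refine mul_le_mul (le_of_eq ?_) (mul_le_mul (hC _) (hC _) (norm_nonneg _) hC0) (by positivity)
      (by positivity)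
    simp
    ring_nf
  -- The sum is independent of `j` because the difference telescopes. Its value is then found by
  -- letting `j → ∞`, where only `b = 0` survives.
  have hstep : ∀ j, ∑' b, f (j + 1) b = ∑' b, f j b := fun j => by
    have ht : HasSum (fun b => f (j + 1) b - f j b) 0 := by
      refine hasSum_telescope (G := fun b => q ^ ((b : ℤ) ^ 2 + b * j) * recipPoch q (b - 1)
        * recipPoch q (b + j)) ((hsum _).sub (hsum _)) (fun b => ?_) (by simp [recipPoch_of_neg]) ?_
      · have h1 := recipPoch_sub_one hq (b : ℤ)
        have h2 := recipPoch_sub_one hq (b + j + 1 : ℤ)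
        rw [add_sub_cancel_right] at h2
        simp only [hf]
        push_cast
        rw [show (b : ℤ) + 1 - 1 = b by ring, show (b : ℤ) + 1 + j = b + j + 1 by ring,
          show (b : ℤ) + (j + 1) = b + j + 1 by ring, h1, h2,
          show (b : ℤ) ^ 2 + b * (j + 1) = (b ^ 2 + b * j) + b by ring,
          show ((b : ℤ) + 1) ^ 2 + (b + 1) * j = (b ^ 2 + b * j) + b + (b + j + 1) by ring]
        simp only [zpow_add₀ hq0]
        ring
      · refine squeeze_zero_norm (a := fun b : ℕ => ‖q ^ (1 * (b : ℤ) ^ 2 + j * b + 0) * 1 ^ b‖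
          * (C * C)) (fun b => ?_) ?_
        · simp only [norm_mul]
          rw [mul_assoc]
          refine mul_le_mul (le_of_eq ?_) (mul_le_mul (hC _) (hC _) (norm_nonneg _) hC0)
            (by positivity) (by positivity)
          simp
          ring_nf
        · simpa using ((summable_norm_nat_quadratic hq0 hq one_ne_zero one_pos j
            0).tendsto_atTop_zero).mul_const (C * C)
    have := (ht.unique ((hsum (j + 1)).hasSum.sub (hsum j).hasSum))
    exact (sub_eq_zero.mp this.symm)
  have hlim : Tendsto (fun n : ℕ => ∑' b, f (n : ℤ) b) atTop
      (𝓝 (∑' b : ℕ, if b = 0 then (qPochInf q q)⁻¹ else 0)) := by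
    refine tendsto_tsum_of_dominated_convergence (bound := fun b : ℕ =>
      ‖q ^ (1 * (b : ℤ) ^ 2 + 0 * b + 0) * 1 ^ b‖ * (C * C))
      ((summable_norm_nat_quadratic hq0 hq one_ne_zero one_pos 0 0).mul_right _) (fun b => ?_)
      (Eventually.of_forall fun n b => ?_)
    · rcases Nat.eq_zero_or_pos b with rfl | hb
      · simpa [hf, recipPoch_zero] using tendsto_recipPoch hq
      · rw [if_neg hb.ne']
        refine squeeze_zero_norm (a := fun n : ℕ => ‖q‖ ^ n * (C * C)) (fun n => ?_) ?_
        · simp only [hf, norm_mul]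
          rw [mul_assoc]
          refine mul_le_mul ?_ (mul_le_mul (hC _) (hC _) (norm_nonneg _) hC0)
            (by positivity) (by positivity)
          rw [show (b : ℤ) ^ 2 + b * n = ((b ^ 2 + b * n : ℕ) : ℤ) by push_cast; ring,
            zpow_natCast, norm_pow]
          exact pow_le_pow_of_le_one (norm_nonneg _) hq.le (by nlinarith)
        · simpa using (tendsto_pow_atTop_nhds_zero_of_lt_one (norm_nonneg q) hq).mul_const (C * C)
    · simp only [hf, norm_mul]
      rw [mul_assoc]
      refine mul_le_mul ?_ (mul_le_mul (hC _) (hC _) (norm_nonneg _) hC0)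
        (by positivity) (by positivity)
      rw [show (b : ℤ) ^ 2 + b * n = ((b ^ 2 + b * n : ℕ) : ℤ) by push_cast; ring,
        show 1 * (b : ℤ) ^ 2 + 0 * b + 0 = ((b ^ 2 : ℕ) : ℤ) by push_cast; ring,
        zpow_natCast, zpow_natCast, norm_pow, norm_pow, one_pow, norm_one, mul_one]
      exact pow_le_pow_of_le_one (norm_nonneg _) hq.le (by nlinarith)
  have hconst : ∀ j : ℤ, ∑' b, f j b = ∑' b, f 0 b := fun j => by
    induction j using Int.induction_on with
    | zero => rfl
    | succ n ih => rw [hstep, ih]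
    | pred n ih => rw [← ih, ← hstep]; simp
  rw [tsum_ite_eq] at hlim
  have := tendsto_nhds_unique hlim (tendsto_const_nhds.congr fun n : ℕ => (hconst n).symm)
  rw [this, ← hconst j]
  exact (hsum j).hasSum

/-- The shear `(j, b) ↦ (j + b, b)`. -/
def shearNat : ℤ × ℕ ≃ ℤ × ℕ where
  toFun p := (p.1 + p.2, p.2)
  invFun p := (p.1 - p.2, p.2)
  left_inv p := by simp
  right_inv p := by simp

/-- The Jacobi triple product identity. -/
theorem hasSum_jacobiTripleProduct {p z : ℂ} (hp0 : p ≠ 0) (hp : ‖p‖ < 1) (hz : z ≠ 0) :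
    HasSum (fun n : ℤ => p ^ (n ^ 2) * z ^ n)
      (qPochInf (p ^ 2) (p ^ 2) * qPochInf (-(z * p)) (p ^ 2) * qPochInf (-(p / z)) (p ^ 2)) := by
  have hp2 : ‖p ^ 2‖ < 1 := by
    rw [norm_pow]; exact pow_lt_one₀ (norm_nonneg _) hp two_ne_zero
  obtain ⟨C, hC0, hC⟩ := exists_norm_recipPoch_le hp2
  set f : ℤ → ℂ := fun a => p ^ (a ^ 2) * z ^ a * recipPoch (p ^ 2) a with hf
  set g : ℕ → ℂ := fun b => p ^ ((b : ℤ) ^ 2) * z⁻¹ ^ b * recipPoch (p ^ 2) b with hg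
  have hfs : HasSum f (qPochInf (-(z * p)) (p ^ 2)) := by
    refine (Function.Injective.hasSum_iff Nat.cast_injective fun a ha => ?_).mp
      (by simpa [Function.comp_def, hf] using hasSum_euler hp0 hp hz)
    have : a < 0 := by
      by_contra h
      exact ha ⟨a.toNat, by omega⟩
    simp [hf, recipPoch_of_neg _ this]
  have hgs : HasSum g (qPochInf (-(p / z)) (p ^ 2)) := by
    have := hasSum_euler hp0 hp (inv_ne_zero hz)
    rwa [inv_mul_eq_div] at this
  have hfn : Summable fun a => ‖f a‖ := by
    refine Summable.of_nonneg_of_le (fun _ => norm_nonneg _) (fun a => ?_)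
      ((summable_norm_zpow_sq_mul hp0 hp hz).mul_right C)
    rw [norm_mul]
    exact mul_le_mul_of_nonneg_left (hC _) (norm_nonneg _)
  have hgn : Summable fun b => ‖g b‖ := by
    refine Summable.of_nonneg_of_le (fun _ => norm_nonneg _) (fun a => ?_)
      ((summable_norm_nat_quadratic hp0 hp (inv_ne_zero hz) one_pos 0 0).mul_right C)
    rw [norm_mul]
    simpa using mul_le_mul_of_nonneg_left (hC a) (norm_nonneg (p ^ ((a : ℤ) ^ 2) * z⁻¹ ^ a))
  have hprod := hfs.mul hgs (summable_mul_of_summable_norm (f := f) (g := g) hfn hgn)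
  -- In the product of the Euler sums for `z` and `1/z`, the pairs `(j+b, b)` contribute to `z^j`.
  -- Since `(j+b)² + b² = j² + 2(b²+bj)`, the coefficient is `p^{j²}` times the sum of
  -- `hasSum_durfee` to the base `p²`.
  have h := (shearNat.hasSum_iff.mpr hprod).prod_fiberwise
    (g := fun j : ℤ => p ^ (j ^ 2) * z ^ j * (qPochInf (p ^ 2) (p ^ 2))⁻¹) fun j => by
      refine ((hasSum_durfee (pow_ne_zero 2 hp0) hp2 j).mul_left
        (p ^ (j ^ 2) * z ^ j)).congr_fun fun b => ?_
      change p ^ ((j + b) ^ 2) * z ^ (j + b) * recipPoch (p ^ 2) (j + b)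
        * (p ^ ((b : ℤ) ^ 2) * z⁻¹ ^ b * recipPoch (p ^ 2) b) = _
      have hpp : (p ^ 2) ^ ((b : ℤ) ^ 2 + b * j) = p ^ (2 * ((b : ℤ) ^ 2 + b * j)) := by
        rw [zpow_mul]; norm_cast
      rw [hpp, add_comm (b : ℤ) j, zpow_add₀ hz, zpow_natCast, inv_pow,
        show 2 * ((b : ℤ) ^ 2 + b * j) = (j + b) ^ 2 + b ^ 2 - j ^ 2 by ring, zpow_sub₀ hp0,
        zpow_add₀ hp0]
      have := zpow_ne_zero (j ^ 2) hp0
      field_simp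
  have h2 := h.mul_left (qPochInf (p ^ 2) (p ^ 2))
  have hP := qPochInf_ne_zero_of_norm_lt hp2 hp2
  rw [← mul_assoc] at h2
  refine h2.congr_fun fun j => ?_
  field_simp

/-- The triple product for `p^6` and `z = -p²`: its three factors are the residue classes modulo 3
of `(p⁴;p⁴)_∞`. -/
theorem hasSum_pentagonal {p : ℂ} (hp0 : p ≠ 0) (hp : ‖p‖ < 1) :
    HasSum (fun n : ℤ => (-1) ^ n * p ^ (6 * n ^ 2 + 2 * n)) (qPochInf (p ^ 4) (p ^ 4)) := by
  have h6 : ‖p ^ 6‖ < 1 := by rw [norm_pow]; exact pow_lt_one₀ (norm_nonneg _) hp (by norm_num)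
  have h4 : ‖p ^ 4‖ < 1 := by rw [norm_pow]; exact pow_lt_one₀ (norm_nonneg _) hp (by norm_num)
  have h := hasSum_jacobiTripleProduct (z := -p ^ 2) (pow_ne_zero 6 hp0) h6
    (neg_ne_zero.mpr (pow_ne_zero 2 hp0))
  rw [qPochInf_eq_prod (p ^ 4) h4 (k := 3) (by norm_num), Finset.prod_range_succ,
    Finset.prod_range_succ, Finset.prod_range_one]
  have e : -(p ^ 6 / -p ^ 2) = p ^ 4 := by field_simp
  rw [e] at h
  convert h using 1
  · funext n
    rw [neg_eq_neg_one_mul (p ^ 2), mul_zpow, zpow_add₀ hp0, zpow_mul, zpow_mul]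
    norm_cast
    ring
  · ring_nf

theorem hasSum_int_mod_three {g : ℤ → ℂ} {a : ℂ} (hg : HasSum g a) :
    HasSum (fun k : ℤ => g (3 * k) + g (3 * k + 1) + g (3 * k + 2)) a := by
  have h := ((Int.divModEquiv 3).symm.hasSum_iff.mpr hg).prod_fiberwise fun k => hasSum_fintype _
  refine h.congr_fun fun k => ?_
  rw [Fin.sum_univ_three]
  simp [Int.divModEquiv, mul_comm]

/-- The shear `(N, n) ↦ (N - 2 n, n)`. -/
def shearTwo : ℤ × ℤ ≃ ℤ × ℤ where
  toFun p := (p.1 - 2 * p.2, p.2)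
  invFun p := (p.1 + 2 * p.2, p.2)
  left_inv p := by simp
  right_inv p := by simp

theorem neg_one_zpow_two_mul (n : ℤ) : (-1 : ℂ) ^ (2 * n) = 1 := by
  rw [zpow_mul]; norm_num

/-- The terms of the product of the two theta series in the quintuple product identity. -/
noncomputable def quintupleTerm (p z : ℂ) (m n : ℤ) : ℂ :=
  (-1) ^ (m + n) * p ^ (m ^ 2 - m + 2 * n ^ 2) * z ^ (m + 2 * n)

/-- For `m + 2n = 3k` the exponent `m² - m + 2n²` splits as the pentagonal exponent at `n - k` plus
`3k² - k`. The case `3k + 1` below is the same with `k - n`. -/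
theorem hasSum_quintupleTerm_zero {p z : ℂ} (hp0 : p ≠ 0) (hp : ‖p‖ < 1) (k : ℤ) :
    HasSum (fun n => quintupleTerm p z (3 * k - 2 * n) n)
      (qPochInf (p ^ 4) (p ^ 4) * (p ^ (3 * k ^ 2 - k) * z ^ (3 * k))) := by
  have h := (Equiv.subRight k).hasSum_iff.mpr (hasSum_pentagonal hp0 hp)
  refine (h.mul_right (p ^ (3 * k ^ 2 - k) * z ^ (3 * k))).congr_fun fun n => ?_
  change _ = (-1) ^ (n - k) * p ^ (6 * (n - k) ^ 2 + 2 * (n - k)) * _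
  rw [quintupleTerm, show 3 * k - 2 * n + n = 2 * (2 * k - n) + (n - k) by ring,
    zpow_add₀ (by norm_num : (-1 : ℂ) ≠ 0), neg_one_zpow_two_mul,
    show (3 * k - 2 * n) ^ 2 - (3 * k - 2 * n) + 2 * n ^ 2
      = (6 * (n - k) ^ 2 + 2 * (n - k)) + (3 * k ^ 2 - k) by ring, zpow_add₀ hp0,
    show 3 * k - 2 * n + 2 * n = 3 * k by ring]
  ring

theorem hasSum_quintupleTerm_one {p z : ℂ} (hp0 : p ≠ 0) (hp : ‖p‖ < 1) (k : ℤ) :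
    HasSum (fun n => quintupleTerm p z (3 * k + 1 - 2 * n) n)
      (qPochInf (p ^ 4) (p ^ 4) * -(p ^ (3 * k ^ 2 + k) * z ^ (3 * k + 1))) := by
  have h := (Equiv.subLeft k).hasSum_iff.mpr (hasSum_pentagonal hp0 hp)
  refine (h.mul_right (-(p ^ (3 * k ^ 2 + k) * z ^ (3 * k + 1)))).congr_fun fun n => ?_
  change _ = (-1) ^ (k - n) * p ^ (6 * (k - n) ^ 2 + 2 * (k - n)) * _
  rw [quintupleTerm, show 3 * k + 1 - 2 * n + n = 2 * k + (k - n) + 1 by ring,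
    zpow_add₀ (by norm_num : (-1 : ℂ) ≠ 0), zpow_add₀ (by norm_num : (-1 : ℂ) ≠ 0),
    neg_one_zpow_two_mul, show (3 * k + 1 - 2 * n) ^ 2 - (3 * k + 1 - 2 * n) + 2 * n ^ 2
      = (6 * (k - n) ^ 2 + 2 * (k - n)) + (3 * k ^ 2 + k) by ring, zpow_add₀ hp0,
    show 3 * k + 1 - 2 * n + 2 * n = 3 * k + 1 by ring]
  ring

/-- The involution `n ↦ 2k + 1 - n` preserves the exponents and changes the sign, so the sum equals
its own negative. -/
theorem tsum_quintupleTerm_two {p z : ℂ} (k : ℤ) :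
    ∑' n, quintupleTerm p z (3 * k + 2 - 2 * n) n = 0 := by
  have h1 := (Equiv.subLeft (2 * k + 1)).tsum_eq fun n => quintupleTerm p z (3 * k + 2 - 2 * n) n
  have h2 : ∀ n, quintupleTerm p z (3 * k + 2 - 2 * (Equiv.subLeft (2 * k + 1) n))
      (Equiv.subLeft (2 * k + 1) n) = -quintupleTerm p z (3 * k + 2 - 2 * n) n := fun n => by
    have hneg : (-1 : ℂ) ≠ 0 := by norm_num
    simp only [Equiv.subLeft_apply, quintupleTerm]
    rw [show 3 * k + 2 - 2 * (2 * k + 1 - n) + (2 * k + 1 - n) = 2 * n + (k - n) + 1 by ring,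
      show 3 * k + 2 - 2 * n + n = 2 * (k + 1) + (k - n) by ring, zpow_add₀ hneg, zpow_add₀ hneg,
      zpow_add₀ hneg, neg_one_zpow_two_mul, neg_one_zpow_two_mul,
      show 3 * k + 2 - 2 * (2 * k + 1 - n) + 2 * (2 * k + 1 - n) = 3 * k + 2 by ring,
      show 3 * k + 2 - 2 * n + 2 * n = 3 * k + 2 by ring]
    ring_nf
  rw [tsum_congr h2, tsum_neg] at h1
  linear_combination (-1 / 2 : ℂ) * h1

/-- The quintuple product identity. -/
theorem hasSum_quintupleProduct {p z : ℂ} (hp0 : p ≠ 0) (hp : ‖p‖ < 1) (hz : z ≠ 0) :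
    HasSum (fun k : ℤ => p ^ (3 * k ^ 2 - k) * z ^ (3 * k) - p ^ (3 * k ^ 2 + k) * z ^ (3 * k + 1))
      (qPochInf (p ^ 2) (p ^ 2) * qPochInf z (p ^ 2) * qPochInf (p ^ 2 / z) (p ^ 2)
        * qPochInf (p ^ 2 * z ^ 2) (p ^ 4) * qPochInf (p ^ 2 / z ^ 2) (p ^ 4)) := by
  have h2 : ‖p ^ 2‖ < 1 := by rw [norm_pow]; exact pow_lt_one₀ (norm_nonneg _) hp (by norm_num)
  have h4 : ‖p ^ 4‖ < 1 := by rw [norm_pow]; exact pow_lt_one₀ (norm_nonneg _) hp (by norm_num)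
  have hzp : -(z / p) ≠ 0 := neg_ne_zero.mpr (div_ne_zero hz hp0)
  have hz2 : -z ^ 2 ≠ 0 := neg_ne_zero.mpr (pow_ne_zero 2 hz)
  have hf := hasSum_jacobiTripleProduct hp0 hp hzp
  have hg := hasSum_jacobiTripleProduct (pow_ne_zero 2 hp0) h2 hz2
  have hprod := hf.mul hg (summable_mul_of_summable_norm
    (f := fun n : ℤ => p ^ n ^ 2 * (-(z / p)) ^ n)
    (g := fun n : ℤ => (p ^ 2) ^ n ^ 2 * (-z ^ 2) ^ n)
    (summable_norm_zpow_sq_mul hp0 hp hzp)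
    (summable_norm_zpow_sq_mul (pow_ne_zero 2 hp0) h2 hz2))
  have hF := hprod.congr_fun (g := fun x : ℤ × ℤ => quintupleTerm p z x.1 x.2) fun x => by
    obtain ⟨m, n⟩ := x
    have e1 : (p ^ 2) ^ n ^ 2 = p ^ (2 * n ^ 2) := by rw [zpow_mul]; norm_cast
    have e2 : (z ^ 2) ^ n = z ^ (2 * n) := by rw [zpow_mul]; norm_cast
    simp only [quintupleTerm]
    rw [neg_eq_neg_one_mul (z / p), neg_eq_neg_one_mul (z ^ 2), mul_zpow, mul_zpow, div_zpow, e1,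
      e2, zpow_add₀ hz, zpow_add₀ hp0, zpow_sub₀ hp0, zpow_add₀ (by norm_num : (-1 : ℂ) ≠ 0)]
    ring
  have hsh := shearTwo.hasSum_iff.mpr hF
  -- The product of the two theta series is grouped by `N = m + 2n` and then by `N` modulo 3. The
  -- common factor `(p⁴;p⁴)_∞` is divided out afterwards.
  have h3 := hasSum_int_mod_three (hsh.prod_fiberwise fun N => (hsh.summable.prod_factor N).hasSum)
  have hP := qPochInf_ne_zero_of_norm_lt h4 h4
  have h5 := h3.mul_left (qPochInf (p ^ 4) (p ^ 4))⁻¹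
  have h6 := h5.congr_fun (g := fun k : ℤ => p ^ (3 * k ^ 2 - k) * z ^ (3 * k)
    - p ^ (3 * k ^ 2 + k) * z ^ (3 * k + 1)) fun k => by
    have e0 := (hasSum_quintupleTerm_zero (z := z) hp0 hp k).tsum_eq
    have e1 := (hasSum_quintupleTerm_one (z := z) hp0 hp k).tsum_eq
    have e2 := tsum_quintupleTerm_two (p := p) (z := z) k
    simp only [shearTwo, Function.comp_apply, Equiv.coe_fn_mk]
    rw [e0, e1, e2]
    field_simp
    ring
  rw [show -(-(z / p) * p) = z by field_simp, show -(p / -(z / p)) = p ^ 2 / z by field_simp,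
    show -(-z ^ 2 * p ^ 2) = p ^ 2 * z ^ 2 by ring,
    show -(p ^ 2 / -z ^ 2) = p ^ 2 / z ^ 2 by field_simp, show (p ^ 2) ^ 2 = p ^ 4 by ring] at h6
  have key : ∀ P A B C D E : ℂ, P ≠ 0 → P⁻¹ * (A * B * C * (P * D * E)) = A * B * C * D * E := by
    intros
    field_simp
  rwa [key _ _ _ _ _ _ hP] at h6

/-! ### A conjugate Bailey pair -/

/-- The weights `x^{n² + en} (-x^{1+e}; x²)_n`. -/
noncomputable def baileyWeight (x : ℂ) (e n : ℕ) : ℂ :=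
  x ^ (n ^ 2 + e * n) * qPoch (-x ^ (1 + e)) (x ^ 2) n

theorem norm_sq_lt_one {x : ℂ} (hx : ‖x‖ < 1) : ‖x ^ 2‖ < 1 := by
  rw [norm_pow]; exact pow_lt_one₀ (norm_nonneg _) hx two_ne_zero

theorem summable_norm_baileyWeight {x : ℂ} (hx0 : x ≠ 0) (hx : ‖x‖ < 1) (e : ℕ) :
    Summable fun n => ‖baileyWeight x e n‖ := by
  obtain ⟨D, hD0, hD⟩ := exists_norm_qPoch_le (-x ^ (1 + e)) (norm_sq_lt_one hx)
  refine Summable.of_nonneg_of_le (fun _ => norm_nonneg _) (fun n => ?_)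
    ((summable_norm_nat_quadratic hx0 hx one_ne_zero one_pos e 0).mul_right D)
  rw [baileyWeight, norm_mul]
  refine mul_le_mul (le_of_eq ?_) (hD _) (norm_nonneg _) (by positivity)
  rw [one_pow, mul_one, show 1 * (n : ℤ) ^ 2 + e * n + 0 = ((n ^ 2 + e * n : ℕ) : ℤ) by
    push_cast; ring, zpow_natCast]

theorem baileyWeight_succ (x : ℂ) (e n : ℕ) :
    baileyWeight x e (n + 1)
      = baileyWeight x e n * (x ^ (2 * (n : ℤ) + 1 + e) * (1 + x ^ (2 * (n : ℤ) + 1 + e))) := by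
  have h : x ^ (2 * (n : ℤ) + 1 + e) = x ^ (2 * n + 1 + e) := by
    rw [← zpow_natCast]; push_cast; ring_nf
  rw [h, baileyWeight, baileyWeight, qPoch_succ]
  ring

theorem norm_mul_mul_le {a b c : ℂ} {C : ℝ} (hC : 0 ≤ C) (hb : ‖b‖ ≤ C) (hc : ‖c‖ ≤ C) :
    ‖a * (b * c)‖ ≤ ‖a‖ * (C * C) := by
  rw [norm_mul, norm_mul]
  exact mul_le_mul_of_nonneg_left (mul_le_mul hb hc (norm_nonneg _) hC) (norm_nonneg _)

/-- Passing from `r` to `r + 1` multiplies the sum by `x^{2r+1+e}`, which gives the power of `x`.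
The constant comes from the limit `r → ∞`. -/
theorem hasSum_conjugateBailey_nat {x : ℂ} (hx0 : x ≠ 0) (hx : ‖x‖ < 1) (e r : ℕ) :
    HasSum (fun n : ℕ => baileyWeight x e n
        * (recipPoch (x ^ 2) (n - r) * recipPoch (x ^ 2) (n + r + e)))
      (x ^ (r ^ 2 + e * r) * (qPochInf (-x ^ (1 + e)) (x ^ 2) * (qPochInf (x ^ 2) (x ^ 2))⁻¹)) := by
  have hx2 := norm_sq_lt_one hx
  have hx20 : x ^ 2 ≠ 0 := pow_ne_zero 2 hx0
  obtain ⟨C, hC0, hC⟩ := exists_norm_recipPoch_le hx2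
  have hw := summable_norm_baileyWeight hx0 hx e
  set F : ℕ → ℕ → ℂ := fun r n => baileyWeight x e n
    * (recipPoch (x ^ 2) (n - r) * recipPoch (x ^ 2) (n + r + e)) with hF
  have hsum : ∀ r, Summable (F r) := fun r =>
    Summable.of_norm_bounded (hw.mul_right (C * C)) fun n => norm_mul_mul_le hC0 (hC _) (hC _)
  have hsq : ∀ k : ℤ, (x ^ 2) ^ k = x ^ (2 * k) := fun k => by rw [zpow_mul]; norm_cast
  have hstep : ∀ r, ∑' n, F (r + 1) n = x ^ (2 * r + 1 + e) * ∑' n, F r n := fun r => by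
    have ht : HasSum (fun n => F (r + 1) n - x ^ (2 * r + 1 + e) * F r n) 0 := by
      -- `G` is the telescoping certificate. It vanishes at `n = 0` because the index `-r - 1` is
      -- negative.
      refine hasSum_telescope (G := fun n : ℕ => (x ^ (2 * r + 1 + e) - 1) * (baileyWeight x e n
        * (recipPoch (x ^ 2) (n - r - 1) * recipPoch (x ^ 2) (n + r + e))))
        ((hsum _).sub ((hsum _).mul_left _)) (fun n => ?_) ?_ ?_
      · have h1 := recipPoch_sub_one hx2 (n - r : ℤ)
        have h2 := recipPoch_sub_one hx2 (n + r + e + 1 : ℤ)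
        rw [add_sub_cancel_right] at h2
        simp only [hF]
        push_cast
        rw [baileyWeight_succ, show (n : ℤ) + 1 - r - 1 = n - r by ring,
          show (n : ℤ) + 1 + r + e = n + r + e + 1 by ring,
          show (n : ℤ) - (r + 1) = n - r - 1 by ring,
          show (n : ℤ) + (r + 1) + e = n + r + e + 1 by ring, h1, h2, hsq, hsq,
          show x ^ (2 * r + 1 + e) = x ^ (2 * (r : ℤ) + 1 + e) by
            rw [← zpow_natCast]; push_cast; ring_nf]
        generalize baileyWeight x e n = w
        generalize recipPoch (x ^ 2) (n - r : ℤ) = R1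
        generalize recipPoch (x ^ 2) (n + r + e + 1 : ℤ) = R2
        rw [show 2 * ((n : ℤ) - r) = 2 * n - 2 * r by ring,
          show 2 * ((n : ℤ) + r + e + 1) = 2 * n + 2 * r + (e + e) + 1 + 1 by ring,
          zpow_sub₀ hx0]
        simp only [zpow_add₀ hx0, zpow_one]
        have := zpow_ne_zero (2 * (r : ℤ)) hx0
        generalize x ^ (2 * (r : ℤ)) = A at *
        generalize x ^ (2 * (n : ℤ)) = N
        generalize x ^ (e : ℤ) = E
        field_simp
        ring
      · have : -(r : ℤ) - 1 < 0 := by omega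
        simp [recipPoch_of_neg _ this]
      · rw [show (0 : ℂ) = (x ^ (2 * r + 1 + e) - 1) * 0 by ring]
        refine Tendsto.const_mul _ (squeeze_zero_norm (fun n =>
          norm_mul_mul_le hC0 (hC _) (hC _)) ?_)
        simpa using hw.tendsto_atTop_zero.mul_const (C * C)
    have := ht.unique ((hsum (r + 1)).hasSum.sub ((hsum r).hasSum.mul_left _))
    exact (sub_eq_zero.mp this.symm)
  have hiter : ∀ r : ℕ, ∑' n, F r n = x ^ (r ^ 2 + e * r) * ∑' n, F 0 n := fun r => by
    induction r with
    | zero => simp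
    | succ r ih => rw [hstep, ih]; ring
  -- With `n = m + r` and `x^{r²+er}` divided out, the sum for `r = 0` acquires a form depending on
  -- `r`, in which `r → ∞` leaves only `m = 0`.
  have hzero : ∀ r : ℕ, ∑' m : ℕ, x ^ (m ^ 2 + 2 * m * r + e * m) * qPoch (-x ^ (1 + e)) (x ^ 2)
      (m + r) * (recipPoch (x ^ 2) m * recipPoch (x ^ 2) (m + 2 * r + e)) = ∑' n, F 0 n := fun r => by
    have h1 := (hsum r).sum_add_tsum_nat_add r
    rw [Finset.sum_eq_zero, zero_add, hiter r] at h1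
    · have hne : x ^ (r ^ 2 + e * r) ≠ 0 := pow_ne_zero _ hx0
      refine mul_left_cancel₀ hne ?_
      rw [← h1, ← tsum_mul_left]
      refine tsum_congr fun m => ?_
      simp only [hF, baileyWeight]
      push_cast
      rw [show (m : ℤ) + r - r = m by ring, show (m : ℤ) + r + r + e = m + 2 * r + e by ring]
      ring
    · intro i hi
      have : (i : ℤ) - r < 0 := by
        have := Finset.mem_range.mp hi
        omega
      simp [hF, recipPoch_of_neg _ this]
  have hlim : Tendsto (fun r : ℕ => ∑' m : ℕ, x ^ (m ^ 2 + 2 * m * r + e * m)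
      * qPoch (-x ^ (1 + e)) (x ^ 2) (m + r)
      * (recipPoch (x ^ 2) m * recipPoch (x ^ 2) (m + 2 * r + e))) atTop
      (𝓝 (∑' m : ℕ, if m = 0 then
        qPochInf (-x ^ (1 + e)) (x ^ 2) * (qPochInf (x ^ 2) (x ^ 2))⁻¹ else 0)) := by
    obtain ⟨D, hD0, hD⟩ := exists_norm_qPoch_le (-x ^ (1 + e)) hx2
    have hb : ∀ m r : ℕ, ‖x ^ (m ^ 2 + 2 * m * r + e * m)
      * qPoch (-x ^ (1 + e)) (x ^ 2) (m + r)
      * (recipPoch (x ^ 2) m * recipPoch (x ^ 2) (m + 2 * r + e))‖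
        ≤ ‖x‖ ^ (m ^ 2 + 2 * m * r + e * m) * D * (C * C) := fun m r => by
      refine (norm_mul_mul_le hC0 (hC _) (hC _)).trans ?_
      rw [norm_mul, norm_pow]
      gcongr
      exact hD _
    refine tendsto_tsum_of_dominated_convergence (bound := fun m : ℕ =>
      ‖x ^ (1 * (m : ℤ) ^ 2 + 0 * m + 0) * 1 ^ m‖ * D * (C * C))
      (((summable_norm_nat_quadratic hx0 hx one_ne_zero one_pos 0 0).mul_right _).mul_right _)
      (fun m => ?_) (Eventually.of_forall fun r m => ?_)
    · rcases Nat.eq_zero_or_pos m with rfl | hm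
      · have h1 : Tendsto (fun r : ℕ => recipPoch (x ^ 2) ((2 * r + e : ℕ) : ℤ)) atTop
            (𝓝 (qPochInf (x ^ 2) (x ^ 2))⁻¹) :=
          (tendsto_recipPoch hx2).comp (tendsto_atTop_mono (fun r => by simp; omega) tendsto_id)
        simpa [recipPoch_zero] using (tendsto_qPoch (-x ^ (1 + e)) hx2).mul h1
      · rw [if_neg hm.ne']
        refine squeeze_zero_norm (a := fun r : ℕ => ‖x‖ ^ r * D * (C * C))
          (fun r => (hb m r).trans ?_) ?_
        · gcongr ?_ * D * (C * C)
          exact pow_le_pow_of_le_one (norm_nonneg _) hx.le (by nlinarith)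
        · simpa using ((tendsto_pow_atTop_nhds_zero_of_lt_one (norm_nonneg x) hx).mul_const
            D).mul_const (C * C)
    · refine (hb m r).trans ?_
      gcongr ?_ * D * (C * C)
      rw [show 1 * (m : ℤ) ^ 2 + 0 * m + 0 = ((m ^ 2 : ℕ) : ℤ) by push_cast; ring,
        zpow_natCast, norm_mul, norm_pow, one_pow, norm_one, mul_one]
      exact pow_le_pow_of_le_one (norm_nonneg _) hx.le (by nlinarith)
  rw [tsum_ite_eq] at hlim
  have h0 := tendsto_nhds_unique (tendsto_const_nhds.congr fun r : ℕ => (hzero r).symm) hlim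
  rw [← h0, ← hiter r]
  exact (hsum r).hasSum

/-- The reflection `r ↦ -r - e` exchanges the two reciprocal factorials and fixes `r² + er`. The
bound `e ≤ 1` makes it send every negative `r` to a natural number. -/
theorem hasSum_conjugateBailey {x : ℂ} (hx0 : x ≠ 0) (hx : ‖x‖ < 1) (e : ℕ) (he : e ≤ 1) (r : ℤ) :
    HasSum (fun n : ℕ => baileyWeight x e n
        * (recipPoch (x ^ 2) (n - r) * recipPoch (x ^ 2) (n + r + e)))
      (x ^ (r ^ 2 + e * r) * (qPochInf (-x ^ (1 + e)) (x ^ 2) * (qPochInf (x ^ 2) (x ^ 2))⁻¹)) := by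
  rcases le_or_gt 0 r with hr | hr
  · lift r to ℕ using hr
    have := hasSum_conjugateBailey_nat hx0 hx e r
    rwa [← zpow_natCast x (r ^ 2 + e * r), show ((r ^ 2 + e * r : ℕ) : ℤ) = (r : ℤ) ^ 2 + e * r by
      push_cast; ring] at this
  · obtain ⟨s, hs⟩ : ∃ s : ℕ, r = -s - e := ⟨(-r - e).toNat, by omega⟩
    have := hasSum_conjugateBailey_nat hx0 hx e s
    rw [← zpow_natCast x (s ^ 2 + e * s),
      show ((s ^ 2 + e * s : ℕ) : ℤ) = (r : ℤ) ^ 2 + e * r by rw [hs]; push_cast; ring] at this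
    refine this.congr_fun fun n => ?_
    rw [hs, show (n : ℤ) - (-s - e) = n + s + e by ring, show (n : ℤ) + (-s - e) + e = n - s by ring]
    ring

/-! ### Bailey pairs -/

/-- `∑ j, q^{6j²+aj} / ((q;q)_{u-3j} (q;q)_{v+3j})`. -/
noncomputable def bilateral (q : ℂ) (a u v : ℤ) : ℂ :=
  ∑' j : ℤ, q ^ (6 * j ^ 2 + a * j) * (recipPoch q (u - 3 * j) * recipPoch q (v + 3 * j))

theorem summable_bilateral {q : ℂ} (hq0 : q ≠ 0) (hq : ‖q‖ < 1) (a u v : ℤ) : Summable fun j : ℤ =>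
    q ^ (6 * j ^ 2 + a * j) * (recipPoch q (u - 3 * j) * recipPoch q (v + 3 * j)) := by
  obtain ⟨C, hC0, hC⟩ := exists_norm_recipPoch_le hq
  refine Summable.of_norm_bounded ((summable_norm_zpow_quadratic' hq0 hq (by norm_num : (0 : ℤ) < 6)
    a 0).mul_right (C * C)) fun j => ?_
  rw [add_zero]
  exact norm_mul_mul_le hC0 (hC _) (hC _)

/-- The substitution `j ↦ -j`. Together with the shift `j ↦ j + 1` it supplies all coincidences
between bilateral sums that make terms cancel in the recurrences below. -/
theorem bilateral_reflect {q : ℂ} (a u v : ℤ) : bilateral q a u v = bilateral q (-a) v u := by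
  rw [bilateral, ← (Equiv.neg ℤ).tsum_eq]
  refine tsum_congr fun j => ?_
  simp only [Equiv.neg_apply]
  ring_nf

theorem bilateral_shift {q : ℂ} (hq0 : q ≠ 0) (a u v : ℤ) :
    bilateral q a u v = q ^ (6 + a) * bilateral q (a + 12) (u - 3) (v + 3) := by
  rw [bilateral, bilateral, ← (Equiv.addRight (1 : ℤ)).tsum_eq, ← tsum_mul_left]
  refine tsum_congr fun j => ?_
  simp only [Equiv.coe_addRight]
  rw [← mul_assoc (q ^ (6 + a)), ← zpow_add₀ hq0, show 6 * (j + 1) ^ 2 + a * (j + 1)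
    = 6 + a + (6 * j ^ 2 + (a + 12) * j) by ring, show u - 3 * (j + 1) = u - 3 - 3 * j by ring,
    show v + 3 * (j + 1) = v + 3 + 3 * j by ring]

/-- A `q`-Pascal rule. With `U = u - 3j` and `V = v + 3j`, write `1 - q^{U+V} = (1 - q^U) + q^U (1 -
q^V)`; each bracket lowers an index, and `q^U = q^u q^{-3j}` lowers `a` by 3. -/
theorem bilateral_pascal_left {q : ℂ} (hq0 : q ≠ 0) (hq : ‖q‖ < 1)
    {a u v s a' u' v' : ℤ} (hs : u + v = s) (ha : a - 3 = a')
    (hu : u - 1 = u') (hv : v - 1 = v') : (1 - q ^ s) * bilateral q a u v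
      = bilateral q a u' v + q ^ u * bilateral q a' u v' := by
  subst hs ha hu hv
  simp only [bilateral]
  rw [← tsum_mul_left, ← tsum_mul_left, ← Summable.tsum_add (summable_bilateral hq0 hq _ _ _)
    ((summable_bilateral hq0 hq _ _ _).mul_left _)]
  refine tsum_congr fun j => ?_
  have h1 := recipPoch_sub_one hq (u - 3 * j)
  have h2 := recipPoch_sub_one hq (v + 3 * j)
  rw [show u - 1 - 3 * j = u - 3 * j - 1 by ring, show v - 1 + 3 * j = v + 3 * j - 1 by ring, h1, h2,
    show 6 * j ^ 2 + (a - 3) * j = 6 * j ^ 2 + a * j - 3 * j by ring]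
  simp only [zpow_add₀ hq0, zpow_sub₀ hq0]
  have := zpow_ne_zero (3 * j) hq0
  field_simp
  ring

theorem bilateral_pascal_right {q : ℂ} (hq0 : q ≠ 0) (hq : ‖q‖ < 1)
    {a u v s a' u' v' : ℤ} (hs : u + v = s) (ha : a + 3 = a')
    (hu : u - 1 = u') (hv : v - 1 = v') : (1 - q ^ s) * bilateral q a u v
      = bilateral q a u v' + q ^ v * bilateral q a' u' v := by
  rw [bilateral_reflect, bilateral_pascal_left hq0 hq (a' := -a') ((add_comm v u).trans hs)
    (by omega) hv hu, bilateral_reflect (-a), bilateral_reflect (-a'), neg_neg, neg_neg]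

theorem bilateral_reflect_shift {q : ℂ} (hq0 : q ≠ 0)
    {a u v a' u' v' k : ℤ} (hk : 6 - a = k) (ha : 12 - a = a')
    (hu : v - 3 = u') (hv : u + 3 = v') :
    bilateral q a u v = q ^ k * bilateral q a' u' v' := by
  subst hk ha hu hv
  rw [bilateral_reflect, bilateral_shift hq0]
  ring_nf

theorem one_sub_zpow_ne_zero {q : ℂ} (hq : ‖q‖ < 1) {k : ℤ} (hk : 0 < k) : 1 - q ^ k ≠ 0 := by
  obtain ⟨n, rfl⟩ : ∃ n : ℕ, k = n + 1 := ⟨(k - 1).toNat, by omega⟩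
  exact_mod_cast one_sub_pow_ne_zero hq n

/-- A Bailey pair for `1 / (q;q)_{2n}`, and its analogue for `1 / (q;q)_{2n+1}`. -/
theorem bailey_pair_one {q : ℂ} (hq0 : q ≠ 0) (hq : ‖q‖ < 1) (n : ℕ) :
    bilateral q 1 n n - q * bilateral q 5 (n - 1) (n + 1) = recipPoch q (2 * n) ∧
    bilateral q 1 n (n + 1) - q * bilateral q 5 (n - 1) (n + 2) = recipPoch q (2 * n + 1) := by
  -- The two parities are proved alternately. After multiplication by `1 - q^{2n+1}`, or `1 -
  -- q^{2n+2}` for the next even case, the `q`-Pascal correction terms of the two bilateral sums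
  -- cancel by reflection.
  have odd : ∀ n : ℕ,
      bilateral q 1 n n - q * bilateral q 5 (n - 1) (n + 1) = recipPoch q (2 * n) →
      bilateral q 1 n (n + 1) - q * bilateral q 5 (n - 1) (n + 2) = recipPoch q (2 * n + 1) := by
    intro n h
    have hR := recipPoch_sub_one hq (2 * n + 1 : ℤ)
    rw [add_sub_cancel_right] at hR
    refine mul_left_cancel₀ (one_sub_zpow_ne_zero hq (by omega : 0 < (2 * n + 1 : ℤ))) ?_
    rw [← hR, ← h]
    have h1 : (1 - q ^ (2 * n + 1 : ℤ)) * bilateral q 1 n (n + 1)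
      = bilateral q 1 n n + q ^ (n + 1 : ℤ) * bilateral q 4 (n - 1) (n + 1) :=
      bilateral_pascal_right hq0 hq (by ring) (by ring) (by ring) (by ring)
    have h2 : (1 - q ^ (2 * n + 1 : ℤ)) * bilateral q 5 (n - 1) (n + 2)
      = bilateral q 5 (n - 1) (n + 1) + q ^ (n + 1 + 1 : ℤ) * bilateral q 8 (n - 2) (n + 1 + 1) := by
      rw [add_assoc (n : ℤ) 1 1]
      exact bilateral_pascal_right hq0 hq (by ring) (by ring) (by ring) (by ring)
    have h3 : bilateral q 4 (n - 1) (n + 1) = q ^ (2 : ℤ) * bilateral q 8 (n - 2) (n + 1 + 1) :=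
      bilateral_reflect_shift hq0 (by ring) (by ring) (by ring) (by ring)
    rw [h3, zpow_add_one₀ hq0 n] at h1
    rw [zpow_add_one₀ hq0 (n + 1 : ℤ), zpow_add_one₀ hq0 n] at h2
    norm_cast at h1 h2 ⊢
    linear_combination h1 - q * h2
  induction n with
  | zero =>
    have h0 : bilateral q 1 (0 : ℕ) (0 : ℕ) - q * bilateral q 5 ((0 : ℕ) - 1) ((0 : ℕ) + 1)
        = recipPoch q (2 * (0 : ℕ)) := by
      simp only [bilateral]
      rw [tsum_eq_single (0 : ℤ), tsum_eq_single (0 : ℤ)]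
      · simp [recipPoch_of_neg, recipPoch_zero]
      · intro j hj
        rcases lt_or_gt_of_ne hj with h | h
        · rw [recipPoch_of_neg q (by push_cast; omega : ((0 : ℕ) + 1 + 3 * j : ℤ) < 0)]; simp
        · rw [recipPoch_of_neg q (by push_cast; omega : ((0 : ℕ) - 1 - 3 * j : ℤ) < 0)]; simp
      · intro j hj
        rcases lt_or_gt_of_ne hj with h | h
        · rw [recipPoch_of_neg q (by push_cast; omega : ((0 : ℕ) + 3 * j : ℤ) < 0)]; simp
        · rw [recipPoch_of_neg q (by push_cast; omega : ((0 : ℕ) - 3 * j : ℤ) < 0)]; simp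
    exact ⟨h0, odd 0 h0⟩
  | succ n ih =>
    have h : bilateral q 1 (n + 1 : ℕ) (n + 1 : ℕ)
        - q * bilateral q 5 ((n + 1 : ℕ) - 1) ((n + 1 : ℕ) + 1) = recipPoch q (2 * (n + 1 : ℕ)) := by
      have hR := recipPoch_sub_one hq (2 * n + 2 : ℤ)
      rw [show 2 * (n : ℤ) + 2 - 1 = 2 * n + 1 by ring] at hR
      have hcast : ((n + 1 : ℕ) : ℤ) = n + 1 := by push_cast; ring
      rw [hcast, show 2 * ((n : ℤ) + 1) = 2 * n + 2 by ring, add_sub_cancel_right]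
      refine mul_left_cancel₀ (one_sub_zpow_ne_zero hq (by omega : 0 < (2 * n + 2 : ℤ))) ?_
      rw [← hR, ← ih.2]
      have h1 : (1 - q ^ (2 * n + 2 : ℤ)) * bilateral q 1 (n + 1) (n + 1)
        = bilateral q 1 n (n + 1) + q ^ (n + 1 : ℤ) * bilateral q (-2) (n + 1) n :=
        bilateral_pascal_left hq0 hq (by ring) (by ring) (by ring) (by ring)
      have h2 : (1 - q ^ (2 * n + 2 : ℤ)) * bilateral q 5 n (n + 1 + 1)
        = bilateral q 5 (n - 1) (n + 1 + 1) + q ^ (n : ℤ) * bilateral q 2 n (n + 1) :=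
        bilateral_pascal_left hq0 hq (by ring) (by ring) (by ring) (by ring)
      have h3 := bilateral_reflect (q := q) (-2) (n + 1) n
      rw [neg_neg] at h3
      rw [h3, zpow_add_one₀ hq0 n] at h1
      rw [show (n : ℤ) + 2 = n + 1 + 1 by ring]
      linear_combination h1 - q * h2
    exact ⟨h, odd _ h⟩

theorem bilateral_eq_zero {q : ℂ} {a u v : ℤ} (h : ∀ j : ℤ, u - 3 * j < 0 ∨ v + 3 * j < 0) :
    bilateral q a u v = 0 := by
  rw [bilateral, ← tsum_zero (β := ℤ)]
  refine tsum_congr fun j => ?_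
  rcases h j with h | h <;> simp [recipPoch_of_neg q h]

/-- No induction here: the leading `q`-Pascal terms cancel and the corrections form a power of `q`
times an instance of `bailey_pair_one` of opposite parity. The odd case works in the same way. -/
theorem bailey_pair_two_even {q : ℂ} (hq0 : q ≠ 0) (hq : ‖q‖ < 1) (n : ℕ) :
    bilateral q 2 n n - bilateral q 2 (n - 1) (n + 1) = q ^ n * recipPoch q (2 * n) := by
  cases n with
  | zero =>
    rw [bilateral_eq_zero (u := (0 : ℕ) - 1) fun j => by push_cast; omega, bilateral,
      tsum_eq_single (0 : ℤ)]
    · simp [recipPoch_zero]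
    · intro j hj
      rcases lt_or_gt_of_ne hj with h | h
      · rw [recipPoch_of_neg q (by push_cast; omega : ((0 : ℕ) + 3 * j : ℤ) < 0)]; simp
      · rw [recipPoch_of_neg q (by push_cast; omega : ((0 : ℕ) - 3 * j : ℤ) < 0)]; simp
  | succ n =>
    have hR := recipPoch_sub_one hq (2 * n + 2 : ℤ)
    rw [show 2 * (n : ℤ) + 2 - 1 = 2 * n + 1 by ring, ← (bailey_pair_one hq0 hq n).2] at hR
    have hcast : ((n + 1 : ℕ) : ℤ) = n + 1 := by push_cast; ring
    rw [hcast, show 2 * ((n : ℤ) + 1) = 2 * n + 2 by ring, add_sub_cancel_right]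
    refine mul_left_cancel₀ (one_sub_zpow_ne_zero hq (by omega : 0 < (2 * n + 2 : ℤ))) ?_
    have h1 : (1 - q ^ (2 * n + 2 : ℤ)) * bilateral q 2 (n + 1) (n + 1)
      = bilateral q 2 n (n + 1) + q ^ (n + 1 : ℤ) * bilateral q (-1) (n + 1) n :=
      bilateral_pascal_left hq0 hq (by ring) (by ring) (by ring) (by ring)
    have h2 : (1 - q ^ (2 * n + 2 : ℤ)) * bilateral q 2 n (n + 1 + 1)
      = bilateral q 2 n (n + 1) + q ^ (n + 1 + 1 : ℤ) * bilateral q 5 (n - 1) (n + 2) := by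
      rw [add_assoc (n : ℤ) 1 1]
      exact bilateral_pascal_right hq0 hq (by ring) (by ring) (by ring) (by ring)
    have h3 := bilateral_reflect (q := q) (-1) (n + 1) n
    rw [neg_neg] at h3
    rw [h3] at h1
    rw [zpow_add_one₀ hq0 (n + 1 : ℤ)] at h2
    rw [← zpow_natCast, hcast]
    linear_combination h1 - h2 + q ^ (n + 1 : ℤ) * hR

theorem bailey_pair_two_odd {q : ℂ} (hq0 : q ≠ 0) (hq : ‖q‖ < 1) (n : ℕ) :
    bilateral q 4 n (n + 1) - bilateral q 4 (n - 1) (n + 2) = q ^ n * recipPoch q (2 * n + 1) := by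
  have hR := recipPoch_sub_one hq (2 * n + 1 : ℤ)
  rw [add_sub_cancel_right, ← (bailey_pair_one hq0 hq n).1] at hR
  refine mul_left_cancel₀ (one_sub_zpow_ne_zero hq (by omega : 0 < (2 * n + 1 : ℤ))) ?_
  have h1 : (1 - q ^ (2 * n + 1 : ℤ)) * bilateral q 4 n (n + 1)
    = bilateral q 4 (n - 1) (n + 1) + q ^ (n : ℤ) * bilateral q 1 n n :=
    bilateral_pascal_left hq0 hq (by ring) (by ring) (by ring) (by ring)
  have h2 : (1 - q ^ (2 * n + 1 : ℤ)) * bilateral q 4 (n - 1) (n + 2)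
    = bilateral q 4 (n - 1) (n + 1) + q ^ (n + 2 : ℤ) * bilateral q 7 (n - 2) (n + 2) :=
    bilateral_pascal_right hq0 hq (by ring) (by ring) (by ring) (by ring)
  have h3 : bilateral q 7 (n - 2) (n + 2) = q ^ (-1 : ℤ) * bilateral q 5 (n - 1) (n + 1) :=
    bilateral_reflect_shift hq0 (by ring) (by ring) (by ring) (by ring)
  rw [h3, ← mul_assoc, ← zpow_add₀ hq0, show (n : ℤ) + 2 + -1 = n + 1 by ring,
    zpow_add_one₀ hq0 n, zpow_natCast] at h2
  rw [zpow_natCast] at h1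
  linear_combination h1 - h2 + q ^ n * hR

/-- The leading `q`-Pascal terms form `bailey_pair_one` and the corrections form
`bailey_pair_two_odd`. They combine to `(1 - q^{2n+2})` times the right-hand side. -/
theorem bailey_pair_three_even {q : ℂ} (hq0 : q ≠ 0) (hq : ‖q‖ < 1) (n : ℕ) :
    bilateral q 1 n (n + 2) - q * bilateral q 5 (n - 1) (n + 3) = recipPoch q (2 * n + 1) := by
  refine mul_left_cancel₀ (one_sub_zpow_ne_zero hq (by omega : 0 < (2 * n + 2 : ℤ))) ?_
  have h0 := (bailey_pair_one hq0 hq n).2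
  have h5 := bailey_pair_two_odd hq0 hq n
  have h1 : (1 - q ^ (2 * n + 2 : ℤ)) * bilateral q 1 n (n + 2)
    = bilateral q 1 n (n + 1) + q ^ (n + 2 : ℤ) * bilateral q 4 (n - 1) (n + 2) :=
    bilateral_pascal_right hq0 hq (by ring) (by ring) (by ring) (by ring)
  have h2 : (1 - q ^ (2 * n + 2 : ℤ)) * bilateral q 5 (n - 1) (n + 3)
    = bilateral q 5 (n - 1) (n + 2) + q ^ (n + 3 : ℤ) * bilateral q 8 (n - 2) (n + 3) :=
    bilateral_pascal_right hq0 hq (by ring) (by ring) (by ring) (by ring)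
  have h3 : bilateral q 8 (n - 2) (n + 3) = q ^ (-2 : ℤ) * bilateral q 4 n (n + 1) :=
    bilateral_reflect_shift hq0 (by ring) (by ring) (by ring) (by ring)
  rw [h3, ← mul_assoc, ← zpow_add₀ hq0, show (n : ℤ) + 3 + -2 = n + 1 by ring] at h2
  have e1 : q ^ (n + 2 : ℤ) = q ^ (n + 1 : ℤ) * q := by rw [← zpow_add_one₀ hq0]; ring_nf
  have e2 : q ^ (2 * n + 2 : ℤ) = q ^ (n + 1 : ℤ) * q * q ^ n := by
    rw [← zpow_natCast, ← zpow_add_one₀ hq0, ← zpow_add₀ hq0]; ring_nf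
  rw [e1] at h1
  rw [e2] at h1 h2 ⊢
  linear_combination h1 - q * h2 + h0 - q ^ (n + 1 : ℤ) * q * h5

theorem bailey_pair_three_odd {q : ℂ} (hq0 : q ≠ 0) (hq : ‖q‖ < 1) (n : ℕ) :
    bilateral q (-1) n (n + 1) - q * bilateral q 5 n (n + 1) = recipPoch q (2 * n) := by
  refine mul_left_cancel₀ (one_sub_zpow_ne_zero hq (by omega : 0 < (2 * n + 1 : ℤ))) ?_
  have h0 := (bailey_pair_one hq0 hq n).1
  have h5 := bailey_pair_two_even hq0 hq n
  have h1 : (1 - q ^ (2 * n + 1 : ℤ)) * bilateral q (-1) n (n + 1)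
    = bilateral q (-1) n n + q ^ (n + 1 : ℤ) * bilateral q 2 (n - 1) (n + 1) :=
    bilateral_pascal_right hq0 hq (by ring) (by ring) (by ring) (by ring)
  have h2 : (1 - q ^ (2 * n + 1 : ℤ)) * bilateral q 5 n (n + 1)
    = bilateral q 5 (n - 1) (n + 1) + q ^ (n : ℤ) * bilateral q 2 n n :=
    bilateral_pascal_left hq0 hq (by ring) (by ring) (by ring) (by ring)
  have h3 := bilateral_reflect (q := q) (-1) n n
  rw [neg_neg] at h3
  rw [h3] at h1
  have e1 : q ^ (n + 1 : ℤ) = q ^ n * q := by rw [zpow_add_one₀ hq0, zpow_natCast]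
  have e2 : q ^ (2 * n + 1 : ℤ) = q ^ n * q * q ^ n := by
    rw [← zpow_natCast, ← zpow_add_one₀ hq0, ← zpow_add₀ hq0]; ring_nf
  rw [e1] at h1
  rw [zpow_natCast] at h2
  rw [e2] at h1 h2 ⊢
  linear_combination h1 - q * h2 + h0 - q ^ n * q * h5

/-! ### Identities of Rogers and Slater modulo 14 and 28 -/

/-- `∑ j, x^{21j²+bj+c}`. -/
noncomputable def thetaSum (x : ℂ) (b c : ℤ) : ℂ := ∑' j : ℤ, x ^ (21 * j ^ 2 + b * j + c)

/-- The product side of the quintuple product identity with `p = x^7`, `z = x^m`. -/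
noncomputable def quintupleProd (x : ℂ) (m : ℕ) : ℂ :=
  qPochInf (x ^ 14) (x ^ 14) * qPochInf (x ^ m) (x ^ 14) * qPochInf (x ^ (14 - m)) (x ^ 14)
    * qPochInf (x ^ (14 + 2 * m)) (x ^ 28) * qPochInf (x ^ (14 - 2 * m)) (x ^ 28)

/-- `(-x^{1+e}; x²)_∞ / (x²; x²)_∞`. -/
noncomputable def baileyConst (x : ℂ) (e : ℕ) : ℂ :=
  qPochInf (-x ^ (1 + e)) (x ^ 2) * (qPochInf (x ^ 2) (x ^ 2))⁻¹

theorem thetaSum_reflect (x : ℂ) (b c : ℤ) : thetaSum x b c = thetaSum x (-b) c := by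
  rw [thetaSum, ← (Equiv.neg ℤ).tsum_eq]
  refine tsum_congr fun j => ?_
  simp only [Equiv.neg_apply]
  ring_nf

theorem thetaSum_shift (x : ℂ) (b c : ℤ) : thetaSum x b c = thetaSum x (b + 42) (21 + b + c) := by
  rw [thetaSum, ← (Equiv.addRight (1 : ℤ)).tsum_eq]
  refine tsum_congr fun j => ?_
  simp only [Equiv.coe_addRight]
  ring_nf

theorem thetaSum_add {x : ℂ} (hx0 : x ≠ 0)
    (b c d : ℤ) : thetaSum x b (c + d) = x ^ c * thetaSum x b d := by
  rw [thetaSum, thetaSum, ← tsum_mul_left]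
  refine tsum_congr fun j => ?_
  rw [← zpow_add₀ hx0]
  ring_nf

/-- The exponents `7(3k² ∓ k) + 3mk` give the linear coefficients `3m ∓ 7`. The bound `m ≤ 7` makes
`14 - m` and `14 - 2m` genuine differences. -/
theorem thetaSum_sub_thetaSum {x : ℂ} (hx0 : x ≠ 0) (hx : ‖x‖ < 1) (m : ℕ) (hm : m ≤ 7) :
    thetaSum x (3 * m - 7) 0 - thetaSum x (3 * m + 7) m = quintupleProd x m := by
  have hx7 : ‖x ^ 7‖ < 1 := by rw [norm_pow]; exact pow_lt_one₀ (norm_nonneg _) hx (by norm_num)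
  have h := hasSum_quintupleProduct (pow_ne_zero 7 hx0) hx7 (pow_ne_zero m hx0)
  have hs : ∀ b c : ℤ, Summable fun j : ℤ => x ^ (21 * j ^ 2 + b * j + c) := fun b c =>
    (summable_norm_zpow_quadratic' hx0 hx (by norm_num) b c).of_norm
  rw [thetaSum, thetaSum, ← (hs _ _).tsum_sub (hs _ _)]
  have e1 : (x ^ 7) ^ 2 / x ^ m = x ^ (14 - m) := by
    rw [div_eq_iff (pow_ne_zero m hx0), ← pow_mul, ← pow_add]; congr 1; omega
  have e2 : (x ^ 7) ^ 2 / (x ^ m) ^ 2 = x ^ (14 - 2 * m) := by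
    rw [div_eq_iff (pow_ne_zero 2 (pow_ne_zero m hx0)), ← pow_mul, ← pow_mul, ← pow_add]
    congr 1; omega
  rw [e1, e2, ← pow_mul, ← pow_mul, ← pow_mul, ← pow_add, mul_comm m 2] at h
  rw [quintupleProd, ← h.tsum_eq]
  refine tsum_congr fun j => ?_
  rw [← zpow_natCast, ← zpow_natCast, ← zpow_mul, ← zpow_mul, ← zpow_mul, ← zpow_mul,
    ← zpow_add₀ hx0, ← zpow_add₀ hx0]
  push_cast
  ring_nf

/-- After interchanging sums, the conjugate Bailey pair is applied at `r = 3j + s`. Then `9j²` from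
`r²` and `12j²` from the bilateral weight add up to `21j²`. -/
theorem hasSum_baileyTransform {x : ℂ} (hx0 : x ≠ 0) (hx : ‖x‖ < 1) (e : ℕ) (he : e ≤ 1) (a s : ℤ) :
    HasSum (fun n : ℕ => baileyWeight x e n * bilateral (x ^ 2) a (n - s) (n + s + e))
      (baileyConst x e * thetaSum x (2 * a + 6 * s + 3 * e) (s ^ 2 + e * s)) := by
  have hx2 := norm_sq_lt_one hx
  have hx20 : x ^ 2 ≠ 0 := pow_ne_zero 2 hx0
  obtain ⟨C, hC0, hC⟩ := exists_norm_recipPoch_le hx2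
  refine hasSum_interchange (C := C * C) (A := fun j : ℤ => (x ^ 2) ^ (6 * j ^ 2 + a * j))
    (B := fun j n => recipPoch (x ^ 2) (n - s - 3 * j) * recipPoch (x ^ 2) (n + s + e + 3 * j))
    (V := fun j => x ^ ((3 * j + s) ^ 2 + e * (3 * j + s)) * baileyConst x e)
    (summable_norm_baileyWeight hx0 hx e) ?_ (fun j n => ?_) (fun j => ?_) (fun n => ?_) ?_
  · simpa using summable_norm_zpow_quadratic' hx20 hx2 (by norm_num : (0 : ℤ) < 6) a 0
  · rw [norm_mul]
    exact mul_le_mul (hC _) (hC _) (norm_nonneg _) hC0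
  · refine (hasSum_conjugateBailey hx0 hx e he (3 * j + s)).congr_fun fun n => ?_
    ring_nf
  · exact (summable_bilateral hx20 hx2 _ _ _).hasSum
  · refine ((summable_norm_zpow_quadratic' hx0 hx (by norm_num) (2 * a + 6 * s + 3 * e)
      (s ^ 2 + e * s)).of_norm.hasSum.mul_left (baileyConst x e)).congr_fun fun j => ?_
    have hpp : (x ^ 2) ^ (6 * j ^ 2 + a * j) = x ^ (2 * (6 * j ^ 2 + a * j)) := by
      rw [zpow_mul]; norm_cast
    rw [hpp, ← mul_assoc, ← zpow_add₀ hx0, mul_comm]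
    ring_nf

/-- The common mechanism of the six evaluations. The factors `k` and `d` carry the monomials by
which the two theta series differ from those of the quintuple product. -/
theorem hasSum_slater {x : ℂ} (hx0 : x ≠ 0) (hx : ‖x‖ < 1)
    {e : ℕ} (he : e ≤ 1) {m : ℕ} (hm : m ≤ 7) {a s b t : ℤ} {k d : ℂ}
    {S : ℕ → ℂ} (hS : ∀ n : ℕ, bilateral (x ^ 2) a (n - s) (n + s + e)
      - k * bilateral (x ^ 2) b (n - t) (n + t + e) = S n)
    (h1 : thetaSum x (2 * a + 6 * s + 3 * e) (s ^ 2 + e * s) = d * thetaSum x (3 * m - 7) 0)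
    (h2 : k * thetaSum x (2 * b + 6 * t + 3 * e) (t ^ 2 + e * t) = d * thetaSum x (3 * m + 7) m) :
    HasSum (fun n : ℕ => baileyWeight x e n * S n)
      (baileyConst x e * (d * quintupleProd x m)) := by
  have h := (hasSum_baileyTransform hx0 hx e he a s).sub
    ((hasSum_baileyTransform hx0 hx e he b t).mul_left k)
  rw [← thetaSum_sub_thetaSum hx0 hx m hm, mul_sub d, ← h1, ← h2]
  rw [show ∀ A B C : ℂ, A * B - k * (A * C) = A * (B - k * C) from fun A B C => by ring] at h
  refine h.congr_fun fun n => ?_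
  rw [← hS n]
  ring

/-- In each of the six cases `m` is found by matching `2a + 6s + 3e` with `3m - 7` and `2b + 6t +
3e` with `3m + 7`, up to reflection and shift of the theta series. -/
theorem hasSum_slater_even_one {x : ℂ} (hx0 : x ≠ 0) (hx : ‖x‖ < 1) :
    HasSum (fun n : ℕ => baileyWeight x 0 n * recipPoch (x ^ 2) (2 * n))
      (baileyConst x 0 * quintupleProd x 3) := by
  rw [← one_mul (quintupleProd x 3)]
  refine hasSum_slater hx0 hx zero_le_one (by norm_num) (a := 1) (s := 0) (b := 5) (t := 1)
    (k := x ^ 2) (fun n => ?_) (by norm_num) ?_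
  · simpa using (bailey_pair_one (pow_ne_zero 2 hx0) (norm_sq_lt_one hx) n).1
  · have := thetaSum_add hx0 16 2 1
    norm_num at this ⊢
    exact_mod_cast this.symm

theorem hasSum_slater_even_two {x : ℂ} (hx0 : x ≠ 0) (hx : ‖x‖ < 1) :
    HasSum (fun n : ℕ => baileyWeight x 0 n * ((x ^ 2) ^ n * recipPoch (x ^ 2) (2 * n)))
      (baileyConst x 0 * quintupleProd x 1) := by
  rw [← one_mul (quintupleProd x 1)]
  refine hasSum_slater hx0 hx zero_le_one (by norm_num) (a := 2) (s := 0) (b := 2) (t := 1)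
    (k := 1) (fun n => ?_) ?_ (by norm_num)
  · simpa using bailey_pair_two_even (pow_ne_zero 2 hx0) (norm_sq_lt_one hx) n
  · have := thetaSum_reflect x 4 0
    norm_num at this ⊢
    exact this

theorem hasSum_slater_even_three {x : ℂ} (hx0 : x ≠ 0) (hx : ‖x‖ < 1) :
    HasSum (fun n : ℕ => baileyWeight x 0 (n + 1) * recipPoch (x ^ 2) (2 * n + 1))
      (baileyConst x 0 * (x * quintupleProd x 5)) := by
  -- The Bailey pair is available for the index `2n - 1`. The term `n = 0` vanishes, so the sum can
  -- be reindexed by `n + 1`.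
  have h : HasSum (fun n : ℕ => baileyWeight x 0 n * recipPoch (x ^ 2) (2 * n - 1))
      (baileyConst x 0 * (x * quintupleProd x 5)) := by
    refine hasSum_slater hx0 hx zero_le_one (by norm_num) (a := 1) (s := 1) (b := 5) (t := 2)
      (k := x ^ 2) (fun n => ?_) ?_ ?_
    · cases n with
      | zero =>
        rw [bilateral_eq_zero fun j => by push_cast; omega,
          bilateral_eq_zero fun j => by push_cast; omega, recipPoch_of_neg _ (by norm_num)]
        ring
      | succ n =>
        have := bailey_pair_three_even (pow_ne_zero 2 hx0) (norm_sq_lt_one hx) n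
        push_cast
        ring_nf at this ⊢
        exact this
    · have := thetaSum_add hx0 8 1 0
      norm_num at this ⊢
      exact this
    · have h1 := thetaSum_add hx0 22 2 4
      have h2 := thetaSum_add hx0 22 1 5
      norm_num at h1 h2 ⊢
      rw [← h2, h1]
  have h0 : baileyWeight x 0 0 * recipPoch (x ^ 2) (2 * (0 : ℕ) - 1) = 0 := by
    rw [recipPoch_of_neg _ (by norm_num), mul_zero]
  have h' := (hasSum_nat_add_iff' 1).mpr h
  rw [Finset.sum_range_one, h0, sub_zero] at h'
  refine h'.congr_fun fun n => ?_
  push_cast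
  ring_nf

theorem hasSum_slater_odd_one {x : ℂ} (hx0 : x ≠ 0) (hx : ‖x‖ < 1) :
    HasSum (fun n : ℕ => baileyWeight x 1 n * recipPoch (x ^ 2) (2 * n + 1))
      (baileyConst x 1 * quintupleProd x 4) := by
  rw [← one_mul (quintupleProd x 4)]
  refine hasSum_slater hx0 hx le_rfl (by norm_num) (a := 1) (s := 0) (b := 5) (t := 1)
    (k := x ^ 2) (fun n => ?_) (by norm_num) ?_
  · have := (bailey_pair_one (pow_ne_zero 2 hx0) (norm_sq_lt_one hx) n).2
    simpa [add_assoc, one_add_one_eq_two] using this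
  · have := thetaSum_add hx0 19 2 2
    norm_num at this ⊢
    exact_mod_cast this.symm

theorem hasSum_slater_odd_two {x : ℂ} (hx0 : x ≠ 0) (hx : ‖x‖ < 1) :
    HasSum (fun n : ℕ => baileyWeight x 1 n * ((x ^ 2) ^ n * recipPoch (x ^ 2) (2 * n + 1)))
      (baileyConst x 1 * quintupleProd x 6) := by
  rw [← one_mul (quintupleProd x 6)]
  refine hasSum_slater hx0 hx le_rfl (by norm_num) (a := 4) (s := 0) (b := 4) (t := 1)
    (k := 1) (fun n => ?_) (by norm_num) ?_
  · have := bailey_pair_two_odd (pow_ne_zero 2 hx0) (norm_sq_lt_one hx) n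
    simpa [add_assoc, one_add_one_eq_two] using this
  -- The coefficient `17` becomes `-17 + 42 = 25 = 3·6 + 7`, and the constant term `2` becomes `21 -
  -- 17 + 2 = 6 = m`.
  · have h1 := thetaSum_reflect x 17 2
    have h2 := thetaSum_shift x (-17) 2
    norm_num at h1 h2 ⊢
    rw [h1, h2]

theorem hasSum_slater_odd_three {x : ℂ} (hx0 : x ≠ 0) (hx : ‖x‖ < 1) :
    HasSum (fun n : ℕ => baileyWeight x 1 n * recipPoch (x ^ 2) (2 * n))
      (baileyConst x 1 * quintupleProd x 2) := by
  rw [← one_mul (quintupleProd x 2)]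
  refine hasSum_slater hx0 hx le_rfl (by norm_num) (a := -1) (s := 0) (b := 5) (t := 0)
    (k := x ^ 2) (fun n => ?_) ?_ ?_
  · simpa using bailey_pair_three_odd (pow_ne_zero 2 hx0) (norm_sq_lt_one hx) n
  · have := thetaSum_reflect x 1 0
    norm_num at this ⊢
    exact this
  · have := thetaSum_add hx0 13 2 0
    norm_num at this ⊢
    exact_mod_cast this.symm

/-! ### The double sums -/

/-- Each factor is turned around by `1 + q^{-r} = q^{-r}(1 + q^r)`. The extracted exponents `c -
4i`, for `1 ≤ i ≤ k`, add up to `ck - 2k² - 2k`. -/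
theorem qPoch_neg_zpow {q : ℂ} (hq0 : q ≠ 0) (c : ℤ) (k : ℕ) :
    qPoch (-q ^ (c - 4 * k)) (q ^ 4) k
      = q ^ (c * k - 2 * k ^ 2 - 2 * k) * qPoch (-q ^ (4 - c)) (q ^ 4) k := by
  induction k with
  | zero => simp [qPoch]
  | succ k ih =>
    have h1 : qPoch (-q ^ (c - 4 * (k + 1 : ℕ))) (q ^ 4) (k + 1)
        = qPoch (-q ^ (c - 4 * k)) (q ^ 4) k * (1 + q ^ (c - 4 * k - 4)) := by
      rw [qPoch, Finset.prod_range_succ', qPoch]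
      congr 1
      · refine Finset.prod_congr rfl fun i _ => ?_
        rw [neg_mul, neg_mul, ← zpow_natCast, ← zpow_natCast, ← zpow_natCast, ← zpow_mul,
          ← zpow_mul, ← zpow_add₀ hq0, ← zpow_add₀ hq0]
        push_cast
        ring_nf
      · push_cast
        ring_nf
    have h2 : q ^ (c - 4 * (k : ℤ) - 4) * q ^ (4 - c) * (q ^ 4) ^ k = 1 := by
      rw [← pow_mul, ← zpow_natCast, ← zpow_add₀ hq0, ← zpow_add₀ hq0]
      push_cast
      ring_nf
      simp
    rw [h1, ih, qPoch_succ, show c * ((k + 1 : ℕ) : ℤ) - 2 * ((k + 1 : ℕ) : ℤ) ^ 2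
      - 2 * ((k + 1 : ℕ) : ℤ) = (c * k - 2 * k ^ 2 - 2 * k) + (c - 4 * k - 4) by push_cast; ring,
      zpow_add₀ hq0]
    linear_combination -(q ^ (c * k - 2 * k ^ 2 - 2 * k : ℤ)) * qPoch (-q ^ (4 - c)) (q ^ 4) k * h2

theorem qPochInf_neg_zpow {q : ℂ} (hq0 : q ≠ 0) (hq : ‖q‖ < 1) (c : ℤ) (k : ℕ) :
    qPochInf (-q ^ (c - 4 * k)) (q ^ 4) = q ^ (c * k - 2 * k ^ 2 - 2 * k)
      * qPoch (-q ^ (4 - c)) (q ^ 4) k * qPochInf (-q ^ c) (q ^ 4) := by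
  have hq4 : ‖q ^ 4‖ < 1 := by rw [norm_pow]; exact pow_lt_one₀ (norm_nonneg _) hq (by norm_num)
  rw [qPochInf_eq_qPoch_mul _ hq4 k, qPoch_neg_zpow hq0]
  congr 2
  rw [neg_mul, ← pow_mul, ← zpow_natCast, ← zpow_add₀ hq0]
  push_cast
  ring_nf

/-- The summand of the double sums. -/
noncomputable def doubleTerm (q : ℂ) (α β : ℤ) (p : ℕ × ℕ) : ℂ :=
  q ^ ((p.1 : ℤ) ^ 2 + 2 * (p.2 : ℤ) ^ 2 - 2 * (p.1 : ℤ) * (p.2 : ℤ) + α * p.1 + β * p.2) /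
    (qPoch (q ^ 4) (q ^ 4) p.1 * qPoch (q ^ 4) (q ^ 4) p.2)

theorem summable_doubleTerm {q : ℂ} (hq0 : q ≠ 0) (hq : ‖q‖ < 1) {α β : ℤ} (hα : 0 ≤ α)
    (hβ : -2 ≤ β) : Summable (doubleTerm q α β) := by
  have hq4 : ‖q ^ 4‖ < 1 := by rw [norm_pow]; exact pow_lt_one₀ (norm_nonneg _) hq (by norm_num)
  obtain ⟨C, hC0, hC⟩ := exists_norm_recipPoch_le hq4
  have hq' : 0 < ‖q‖ := norm_pos_iff.mpr hq0
  have hg := summable_geometric_of_lt_one (norm_nonneg q) hq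
  refine Summable.of_norm_bounded (((hg.mul_of_nonneg hg (fun _ => by positivity)
    fun _ => by positivity).mul_left (‖q‖ ^ (-5 : ℤ))).mul_right (C * C)) fun p => ?_
  obtain ⟨i, j⟩ := p
  rw [doubleTerm, div_eq_mul_inv, mul_inv, ← recipPoch_natCast, ← recipPoch_natCast]
  refine (norm_mul_mul_le hC0 (hC _) (hC _)).trans (mul_le_mul_of_nonneg_right ?_ (by positivity))
  rw [norm_zpow, ← zpow_natCast, ← zpow_natCast, ← zpow_add₀ hq'.ne', ← zpow_add₀ hq'.ne']
  refine zpow_le_zpow_right_of_le_one₀ hq' hq.le ?_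
  simp only
  have hi : (0 : ℤ) ≤ i := by positivity
  have hj : (0 : ℤ) ≤ j := by positivity
  -- For `α = 0`, `β = -2` and `d = i - j`, the exponent minus `i + j - 5` is `d(d - 1) + (j - 2)² +
  -- 1`. Larger `α` and `β` only increase it.
  nlinarith [sq_nonneg ((i : ℤ) - j - 1), sq_nonneg ((i : ℤ) - j), sq_nonneg ((j : ℤ) - 2),
    sq_nonneg (2 * ((i : ℤ) - j) - 1), mul_nonneg hα hi,
    mul_nonneg (by linarith : 0 ≤ β + 2) hj]

/-- The sum over `j` is Euler's with `p = q²` and `z = q^{β-2i}`. The outer sum is split into `i =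
2k`, giving `s`, and `i = 2k + 1`, giving `t`. -/
theorem hasSum_doubleTerm {q : ℂ} (hq0 : q ≠ 0) (hq : ‖q‖ < 1) {α β : ℤ} (hα : 0 ≤ α)
    (hβ : -2 ≤ β) {s t : ℂ}
    (hs : HasSum (fun k : ℕ => q ^ (4 * (k : ℤ) ^ 2 + 2 * α * k) * recipPoch (q ^ 4) (2 * k)
      * qPochInf (-q ^ (β + 2 - 4 * k)) (q ^ 4)) s)
    (ht : HasSum (fun k : ℕ => q ^ (4 * (k : ℤ) ^ 2 + 4 * k + 1 + α * (2 * k + 1))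
      * recipPoch (q ^ 4) (2 * k + 1) * qPochInf (-q ^ (β - 4 * k)) (q ^ 4)) t) :
    HasSum (doubleTerm q α β) (s + t) := by
  have hsum := summable_doubleTerm hq0 hq hα hβ
  have hinner : ∀ i : ℕ, HasSum (fun j : ℕ => doubleTerm q α β (i, j))
      (q ^ ((i : ℤ) ^ 2 + α * i) * recipPoch (q ^ 4) i
        * qPochInf (-q ^ (β + 2 - 2 * i)) (q ^ 4)) := fun i => by
    have h := (hasSum_euler (pow_ne_zero 2 hq0) (norm_sq_lt_one hq)
      (zpow_ne_zero (β - 2 * i) hq0)).mul_left (q ^ ((i : ℤ) ^ 2 + α * i) * recipPoch (q ^ 4) i)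
    rw [← pow_mul, ← zpow_natCast q 2, ← zpow_add₀ hq0] at h
    norm_num at h
    rw [show β - 2 * (i : ℤ) + 2 = β + 2 - 2 * i by ring] at h
    refine h.congr_fun fun j => ?_
    have e1 : (q ^ 2) ^ ((j : ℤ) ^ 2) = q ^ (2 * (j : ℤ) ^ 2) := by rw [zpow_mul]; norm_cast
    have e2 : (q ^ (β - 2 * (i : ℤ))) ^ j = q ^ ((β - 2 * (i : ℤ)) * j) := by
      rw [zpow_mul, zpow_natCast]
    rw [doubleTerm, div_eq_mul_inv, mul_inv, ← recipPoch_natCast, ← recipPoch_natCast]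
    simp only
    rw [e1, e2, show (i : ℤ) ^ 2 + 2 * (j : ℤ) ^ 2 - 2 * (i : ℤ) * j + α * i + β * j
      = (i ^ 2 + α * i) + 2 * (j : ℤ) ^ 2 + (β - 2 * i) * j by ring, zpow_add₀ hq0, zpow_add₀ hq0]
    ring
  have h1 := hsum.hasSum.prod_fiberwise hinner
  have h2 := HasSum.even_add_odd (f := fun i : ℕ => q ^ ((i : ℤ) ^ 2 + α * i) * recipPoch (q ^ 4) i
        * qPochInf (-q ^ (β + 2 - 2 * i)) (q ^ 4)) (m := s) (m' := t)
    (hs.congr_fun fun k => by push_cast; ring_nf) (ht.congr_fun fun k => by push_cast; ring_nf)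
  rw [← h1.unique h2]
  exact hsum.hasSum

/-- The contribution of the even first indices. -/
noncomputable def evenPart (x : ℂ) (m : ℕ) : ℂ :=
  qPochInf (-x) (x ^ 2) * (baileyConst x 0 * quintupleProd x m)

/-- The contribution of the odd first indices. -/
noncomputable def oddPart (x : ℂ) (m : ℕ) : ℂ :=
  qPochInf (-x ^ 2) (x ^ 2) * (baileyConst x 1 * quintupleProd x m)

/-- Turning the factors around costs `q^{-2k²}`, so half of `q^{4k²}` remains, namely `x^{k²}` with
`x = q²`. -/
theorem zpow_mul_qPochInf_even {q : ℂ} (hq0 : q ≠ 0) (hq : ‖q‖ < 1) (k : ℕ) :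
    q ^ (4 * (k : ℤ) ^ 2) * qPochInf (-q ^ (2 - 4 * k : ℤ)) (q ^ 4)
      = baileyWeight (q ^ 2) 0 k * qPochInf (-q ^ 2) ((q ^ 2) ^ 2) := by
  have e1 : q ^ (4 * (k : ℤ) ^ 2) = q ^ (2 * (k : ℤ) ^ 2) * q ^ (2 * (k : ℤ) ^ 2) := by
    rw [← zpow_add₀ hq0]; ring_nf
  have e2 : q ^ ((2 : ℤ) * k - 2 * k ^ 2 - 2 * k) = (q ^ (2 * (k : ℤ) ^ 2))⁻¹ := by
    rw [← zpow_neg]; ring_nf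
  have e3 : (q ^ 2) ^ (k ^ 2 + 0 * k) = q ^ (2 * (k : ℤ) ^ 2) := by
    rw [zero_mul, add_zero, ← pow_mul, ← zpow_natCast]; push_cast; rfl
  have e4 : q ^ (4 - 2 : ℤ) = q ^ 2 := rfl
  have e5 : q ^ (2 : ℤ) = q ^ 2 := rfl
  rw [qPochInf_neg_zpow hq0 hq, baileyWeight, e1, e2, e3, e4, e5, show (q ^ 2) ^ 2 = q ^ 4 by ring,
    show (q ^ 2) ^ (1 + 0) = q ^ 2 by ring]
  have := zpow_ne_zero (2 * (k : ℤ) ^ 2) hq0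
  field_simp

/-- The factors 2 in the theorem originate here, from `(-1;q⁴)_∞ = 2(-q⁴;q⁴)_∞`. -/
theorem zpow_mul_qPochInf_odd {q : ℂ} (hq0 : q ≠ 0) (hq : ‖q‖ < 1) (k : ℕ) :
    q ^ (4 * (k : ℤ) ^ 2 + 4 * k) * qPochInf (-q ^ (0 - 4 * k : ℤ)) (q ^ 4)
      = 2 * (baileyWeight (q ^ 2) 1 k * qPochInf (-(q ^ 2) ^ 2) ((q ^ 2) ^ 2)) := by
  have hq4 : ‖q ^ 4‖ < 1 := by rw [norm_pow]; exact pow_lt_one₀ (norm_nonneg _) hq (by norm_num)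
  have e1 : q ^ (4 * (k : ℤ) ^ 2 + 4 * k)
      = q ^ (2 * (k : ℤ) ^ 2 + 2 * k) * q ^ (2 * (k : ℤ) ^ 2 + 2 * k) := by
    rw [← zpow_add₀ hq0]; ring_nf
  have e2 : q ^ ((0 : ℤ) * k - 2 * k ^ 2 - 2 * k) = (q ^ (2 * (k : ℤ) ^ 2 + 2 * k))⁻¹ := by
    rw [← zpow_neg]; ring_nf
  have e3 : (q ^ 2) ^ (k ^ 2 + 1 * k) = q ^ (2 * (k : ℤ) ^ 2 + 2 * k) := by
    rw [← pow_mul, ← zpow_natCast]; push_cast; ring_nf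
  have e4 : q ^ (4 - 0 : ℤ) = q ^ 4 := rfl
  rw [qPochInf_neg_zpow hq0 hq, baileyWeight, e1, e2, e3, e4, show (q ^ 2) ^ (1 + 1) = q ^ 4 by ring,
    zpow_zero, qPochInf_step (-1) hq4,
    show -1 * q ^ 4 = -q ^ 4 by ring]
  have := zpow_ne_zero (2 * (k : ℤ) ^ 2 + 2 * k) hq0
  field_simp
  ring

theorem zpow_mul_natCast {q : ℂ} (hq0 : q ≠ 0)
    (a : ℤ) (k : ℕ) : q ^ (a + 4 * (k : ℤ)) = q ^ a * ((q ^ 2) ^ 2) ^ k := by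
  rw [zpow_add₀ hq0, ← pow_mul, ← pow_mul, ← zpow_natCast q (2 * (2 * k))]
  push_cast
  ring_nf

theorem hasSum_doubleTerm_one {q : ℂ} (hq0 : q ≠ 0) (hq : ‖q‖ < 1) :
    HasSum (doubleTerm q 0 0) (evenPart (q ^ 2) 3 + 2 * q * oddPart (q ^ 2) 4) := by
  have hx0 := pow_ne_zero 2 hq0
  have hx := norm_sq_lt_one hq
  refine hasSum_doubleTerm hq0 hq le_rfl (by norm_num) ?_ ?_
  · refine ((hasSum_slater_even_one hx0 hx).mul_left (qPochInf (-q ^ 2) ((q ^ 2) ^ 2))).congr_fun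
      fun k => ?_
    have h := zpow_mul_qPochInf_even hq0 hq k
    rw [zero_add, mul_zero, zero_mul, add_zero]
    rw [show (q ^ 2) ^ 2 = q ^ 4 by ring] at *
    linear_combination recipPoch (q ^ 4) (2 * k) * h
  · rw [oddPart, ← mul_assoc]
    refine ((hasSum_slater_odd_one hx0 hx).mul_left
      (2 * q * qPochInf (-(q ^ 2) ^ 2) ((q ^ 2) ^ 2))).congr_fun fun k => ?_
    have h := zpow_mul_qPochInf_odd hq0 hq k
    rw [zero_mul, add_zero, zpow_add_one₀ hq0]
    rw [show (q ^ 2) ^ 2 = q ^ 4 by ring] at *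
    linear_combination q * recipPoch (q ^ 4) (2 * k + 1) * h

/-- For `β = -2` the parities exchange roles. Even `i` lead to the weights with `e = 1`; odd `i`
lead to those with `e = 0` at `k + 1`, because `-2 - 4k = 2 - 4(k + 1)`. -/
theorem hasSum_doubleTerm_two {q : ℂ} (hq0 : q ≠ 0) (hq : ‖q‖ < 1) :
    HasSum (doubleTerm q 2 (-2)) (2 * oddPart (q ^ 2) 2 + q * evenPart (q ^ 2) 5) := by
  have hx0 := pow_ne_zero 2 hq0
  have hx := norm_sq_lt_one hq
  refine hasSum_doubleTerm hq0 hq (by norm_num) le_rfl ?_ ?_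
  · rw [oddPart, ← mul_assoc]
    refine ((hasSum_slater_odd_three hx0 hx).mul_left
      (2 * qPochInf (-(q ^ 2) ^ 2) ((q ^ 2) ^ 2))).congr_fun fun k => ?_
    have h := zpow_mul_qPochInf_odd hq0 hq k
    rw [show (-2 : ℤ) + 2 - 4 * k = 0 - 4 * k by ring,
      show 4 * (k : ℤ) ^ 2 + 2 * 2 * k = 4 * k ^ 2 + 4 * k by ring]
    rw [show (q ^ 2) ^ 2 = q ^ 4 by ring] at *
    linear_combination recipPoch (q ^ 4) (2 * k) * h
  · rw [evenPart, ← mul_assoc]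
    -- The factor `q⁻¹` compensates `4(k+1)² = (4k² + 4k + 1 + 2(2k+1)) + 1`. Against the factor `x
    -- = q²` of the Slater sum it leaves `q`.
    have h0 := (hasSum_slater_even_three hx0 hx).mul_left
      (q⁻¹ * qPochInf (-q ^ 2) ((q ^ 2) ^ 2))
    rw [show q⁻¹ * qPochInf (-q ^ 2) ((q ^ 2) ^ 2)
      * (baileyConst (q ^ 2) 0 * (q ^ 2 * quintupleProd (q ^ 2) 5))
      = q * qPochInf (-q ^ 2) ((q ^ 2) ^ 2) * (baileyConst (q ^ 2) 0 * quintupleProd (q ^ 2) 5) by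
        field_simp] at h0
    refine h0.congr_fun fun k => ?_
    have h := zpow_mul_qPochInf_even hq0 hq (k + 1)
    rw [show 4 * ((k + 1 : ℕ) : ℤ) ^ 2 = (4 * k ^ 2 + 4 * k + 1 + 2 * (2 * k + 1)) + 1 by
      push_cast; ring, zpow_add_one₀ hq0, show 2 - 4 * ((k + 1 : ℕ) : ℤ) = -2 - 4 * k by
      push_cast; ring] at h
    rw [show (q ^ 2) ^ 2 = q ^ 4 by ring] at *
    field_simp
    linear_combination recipPoch (q ^ 4) (2 * k + 1) * h

theorem hasSum_doubleTerm_three {q : ℂ} (hq0 : q ≠ 0) (hq : ‖q‖ < 1) :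
    HasSum (doubleTerm q 2 0) (evenPart (q ^ 2) 1 + 2 * q ^ 3 * oddPart (q ^ 2) 6) := by
  have hx0 := pow_ne_zero 2 hq0
  have hx := norm_sq_lt_one hq
  refine hasSum_doubleTerm hq0 hq (by norm_num) (by norm_num) ?_ ?_
  · refine ((hasSum_slater_even_two hx0 hx).mul_left (qPochInf (-q ^ 2) ((q ^ 2) ^ 2))).congr_fun
      fun k => ?_
    have h := zpow_mul_qPochInf_even hq0 hq k
    rw [zero_add, show 4 * (k : ℤ) ^ 2 + 2 * 2 * k = 4 * k ^ 2 + 4 * k by ring,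
      zpow_mul_natCast hq0]
    rw [show (q ^ 2) ^ 2 = q ^ 4 by ring] at *
    linear_combination (q ^ 4) ^ k * recipPoch (q ^ 4) (2 * k) * h
  · rw [oddPart, ← mul_assoc]
    refine ((hasSum_slater_odd_two hx0 hx).mul_left
      (2 * q ^ 3 * qPochInf (-(q ^ 2) ^ 2) ((q ^ 2) ^ 2))).congr_fun fun k => ?_
    have h := zpow_mul_qPochInf_odd hq0 hq k
    rw [show 4 * (k : ℤ) ^ 2 + 4 * k + 1 + 2 * (2 * k + 1) = (4 * k ^ 2 + 4 * k) + 3 + 4 * k by ring,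
      zpow_mul_natCast hq0, zpow_add₀ hq0, show q ^ (3 : ℤ) = q ^ 3 from rfl]
    rw [show (q ^ 2) ^ 2 = q ^ 4 by ring] at *
    linear_combination q ^ 3 * (q ^ 4) ^ k * recipPoch (q ^ 4) (2 * k + 1) * h

/-! ### Infinite products to the base `x^28` -/

/-- All moduli that occur divide 28. Refining every product to the base `x^28` turns product
identities into cancellation of factors `(x^g; x^28)_∞`. -/
theorem qPochInf_pow_eq {x : ℂ} (hx : ‖x‖ < 1) {d k : ℕ} (h : d * k = 28) (a : ℕ) :
    qPochInf (x ^ a) (x ^ d) = ∏ j ∈ Finset.range k, qPochInf (x ^ (a + d * j)) (x ^ 28) := by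
  have hd : d ≠ 0 := by rintro rfl; simp at h
  have hk : 0 < k := Nat.pos_of_ne_zero (by rintro rfl; simp at h)
  have hxd : ‖x ^ d‖ < 1 := by rw [norm_pow]; exact pow_lt_one₀ (norm_nonneg _) hx hd
  rw [qPochInf_eq_prod _ hxd hk]
  refine Finset.prod_congr rfl fun j _ => ?_
  rw [← pow_mul, ← pow_mul, ← pow_add, h]

theorem qPochInf_neg_eq_div (a : ℂ) {q : ℂ} (hq : ‖q‖ < 1) (ha : qPochInf a q ≠ 0) :
    qPochInf (-a) q = qPochInf (a ^ 2) (q ^ 2) / qPochInf a q := by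
  rw [eq_div_iff ha, mul_comm, qPochInf_mul_neg a hq]

/-- The factor `(x^g; x^28)_∞`. -/
noncomputable def factor28 (x : ℂ) (g : ℕ) : ℂ := qPochInf (x ^ g) (x ^ 28)

/-- The product of the factors of index `2` modulo `4`. -/
noncomputable def prodTwo (x : ℂ) : ℂ :=
  factor28 x 2 * factor28 x 6 * factor28 x 10 * factor28 x 14 * factor28 x 18 * factor28 x 22
    * factor28 x 26

/-- The product of the factors of index `0` modulo `4`. -/
noncomputable def prodFour (x : ℂ) : ℂ :=
  factor28 x 4 * factor28 x 8 * factor28 x 12 * factor28 x 16 * factor28 x 20 * factor28 x 24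
    * factor28 x 28

/-- The product of the factors of odd index. -/
noncomputable def prodOdd (x : ℂ) : ℂ := qPochInf x (x ^ 2)

theorem factor28_ne_zero {x : ℂ} (hx : ‖x‖ < 1) {g : ℕ} (hg : g ≠ 0) : factor28 x g ≠ 0 := by
  refine qPochInf_ne_zero_of_norm_lt ?_ ?_ <;> rw [norm_pow] <;>
    exact pow_lt_one₀ (norm_nonneg _) hx (by omega)

theorem prodOdd_ne_zero {x : ℂ} (hx : ‖x‖ < 1)
    : prodOdd x ≠ 0 := qPochInf_ne_zero_of_norm_lt (norm_sq_lt_one hx) hx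

theorem prodTwo_eq {x : ℂ} (hx : ‖x‖ < 1) : qPochInf (x ^ 2) (x ^ 4) = prodTwo x := by
  rw [qPochInf_pow_eq hx (k := 7) (by norm_num)]
  simp [Finset.prod_range_succ, prodTwo, factor28]

theorem prodFour_eq {x : ℂ} (hx : ‖x‖ < 1) : qPochInf (x ^ 4) (x ^ 4) = prodFour x := by
  rw [qPochInf_pow_eq hx (k := 7) (by norm_num)]
  simp [Finset.prod_range_succ, prodFour, factor28]

theorem prodTwo_ne_zero {x : ℂ} (hx : ‖x‖ < 1) : prodTwo x ≠ 0 := by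
  simp [prodTwo, factor28_ne_zero hx]

theorem prodFour_ne_zero {x : ℂ} (hx : ‖x‖ < 1) : prodFour x ≠ 0 := by
  simp [prodFour, factor28_ne_zero hx]

theorem prod_even_eq {x : ℂ} (hx : ‖x‖ < 1)
    : qPochInf (x ^ 2) (x ^ 2) = prodTwo x * prodFour x := by
  rw [qPochInf_eq_prod _ (norm_sq_lt_one hx) (k := 2) (by norm_num), ← prodTwo_eq hx,
    ← prodFour_eq hx]
  simp only [Finset.prod_range_succ, Finset.prod_range_zero]
  ring_nf

theorem prod_all_eq {x : ℂ} (hx : ‖x‖ < 1)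
    : qPochInf x x = prodOdd x * (prodTwo x * prodFour x) := by
  rw [qPochInf_eq_prod _ hx (k := 2) (by norm_num), ← prod_even_eq hx, prodOdd]
  simp only [Finset.prod_range_succ, Finset.prod_range_zero]
  ring_nf

theorem quintupleProd_eq {x : ℂ} (hx : ‖x‖ < 1)
    (m : ℕ) : quintupleProd x m = factor28 x 14 * factor28 x 28
    * factor28 x m * factor28 x (m + 14) * factor28 x (14 - m) * factor28 x (14 - m + 14)
    * factor28 x (14 + 2 * m) * factor28 x (14 - 2 * m) := by
  rw [quintupleProd, qPochInf_pow_eq hx (d := 14) (k := 2) (by norm_num),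
    qPochInf_pow_eq hx (d := 14) (k := 2) (by norm_num),
    qPochInf_pow_eq hx (d := 14) (k := 2) (by norm_num)]
  simp only [Finset.prod_range_succ, Finset.prod_range_zero, factor28, one_mul, mul_zero, mul_one,
    add_zero, Nat.reduceAdd]
  ring

/-- Signs are removed by `(-x;x²)_∞ = (x²;x⁴)_∞/(x;x²)_∞`, and in the odd part by the analogous
`(-x²;x²)_∞ = (x⁴;x⁴)_∞/(x²;x²)_∞`. -/
theorem evenPart_eq {x : ℂ} (hx : ‖x‖ < 1) (m : ℕ) : evenPart x m
    = prodTwo x / (prodOdd x ^ 2 * prodFour x) * quintupleProd x m := by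
  have h := qPochInf_neg_eq_div x (norm_sq_lt_one hx) (prodOdd_ne_zero hx)
  rw [show (x ^ 2) ^ 2 = x ^ 4 by ring, prodTwo_eq hx] at h
  rw [evenPart, baileyConst, add_zero, pow_one, h, prod_even_eq hx, ← prodOdd]
  have := prodTwo_ne_zero hx
  have := prodFour_ne_zero hx
  have := prodOdd_ne_zero hx
  field_simp

theorem oddPart_eq {x : ℂ} (hx : ‖x‖ < 1) (m : ℕ) : oddPart x m
    = 1 / (prodTwo x ^ 3 * prodFour x) * quintupleProd x m := by
  have h2 := prodTwo_ne_zero hx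
  have h4 := prodFour_ne_zero hx
  have h := qPochInf_neg_eq_div (x ^ 2) (norm_sq_lt_one hx)
    (by rw [prod_even_eq hx]; exact mul_ne_zero h2 h4)
  rw [show (x ^ 2) ^ 2 = x ^ 4 by ring, prodFour_eq hx, prod_even_eq hx] at h
  rw [oddPart, baileyConst, h, prod_even_eq hx]
  field_simp

/-- `J_{2a, 2d}` at `q` is `J_{a, d}` at `q²`. -/
theorem J_two_mul (d : ℕ) (q : ℂ) : J (2 * d) q = qPochInf ((q ^ 2) ^ d) ((q ^ 2) ^ d) := by
  rw [J, pow_mul]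

theorem JJ_two_mul (a d : ℕ) (q : ℂ) : JJ (2 * a) (2 * d) q
    = qPochInf ((q ^ 2) ^ a) ((q ^ 2) ^ d) * qPochInf ((q ^ 2) ^ (d - a)) ((q ^ 2) ^ d)
      * qPochInf ((q ^ 2) ^ d) ((q ^ 2) ^ d) := by
  rw [JJ, pow_mul, pow_mul, ← Nat.mul_sub, pow_mul]

/-! ### Dictionary between `J_m`, `J_{a,m}` and factors to the base `x^28`, where `x = q²`. -/

theorem J_four {q : ℂ} (hq : ‖q‖ < 1) : J 4 q = prodTwo (q ^ 2) * prodFour (q ^ 2) := by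
  rw [← prod_even_eq (norm_sq_lt_one hq)]; exact J_two_mul 2 q

theorem J_eight {q : ℂ} (hq : ‖q‖ < 1) : J 8 q = prodFour (q ^ 2) := by
  rw [← prodFour_eq (norm_sq_lt_one hq)]; exact J_two_mul 4 q

theorem J_two {q : ℂ} (hq : ‖q‖ < 1)
    : J 2 q = prodOdd (q ^ 2) * (prodTwo (q ^ 2) * prodFour (q ^ 2)) := by
  rw [← prod_all_eq (norm_sq_lt_one hq), J]

theorem J_twentyeight {q : ℂ} (hq : ‖q‖ < 1)
    : J 28 q = factor28 (q ^ 2) 14 * factor28 (q ^ 2) 28 := by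
  have := J_two_mul 14 q
  rw [qPochInf_pow_eq (norm_sq_lt_one hq) (k := 2) (by norm_num)] at this
  simpa [Finset.prod_range_succ, factor28] using this

theorem J_fiftysix {q : ℂ} : J 56 q = factor28 (q ^ 2) 28 := J_two_mul 28 q

theorem JJ_fiftysix {q : ℂ} (a : ℕ) : JJ (2 * a) 56 q
    = factor28 (q ^ 2) a * factor28 (q ^ 2) (28 - a) * factor28 (q ^ 2) 28 := JJ_two_mul a 28 q

theorem JJ_twentyeight {q : ℂ} (hq : ‖q‖ < 1) (a : ℕ) : JJ (2 * a) 28 q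
    = factor28 (q ^ 2) a * factor28 (q ^ 2) (a + 14) * (factor28 (q ^ 2) (14 - a)
      * factor28 (q ^ 2) (14 - a + 14)) * (factor28 (q ^ 2) 14 * factor28 (q ^ 2) 28) := by
  have := JJ_two_mul a 14 q
  simp only [qPochInf_pow_eq (norm_sq_lt_one hq) (d := 14) (k := 2) (by norm_num),
    Finset.prod_range_succ, Finset.prod_range_zero, one_mul] at this
  exact this

theorem product_one {q : ℂ} (hq : ‖q‖ < 1) :
    evenPart (q ^ 2) 3 + 2 * q * oddPart (q ^ 2) 4 =
      (J 4 q ^ 3 * J 56 q * JJ 6 28 q) / (J 2 q ^ 2 * J 8 q * JJ 8 56 q * JJ 24 56 q) +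
        2 * q * ((J 8 q * J 56 q * JJ 8 56 q) / (J 4 q ^ 2 * JJ 4 56 q)) := by
  have hx := norm_sq_lt_one hq
  have h0 := JJ_twentyeight hq 3
  have h1 := JJ_fiftysix (q := q) 4
  have h2 := JJ_fiftysix (q := q) 12
  have h3 := JJ_fiftysix (q := q) 2
  norm_num at h0 h1 h2 h3
  have n2 := prodTwo_ne_zero hx
  have n4 := prodFour_ne_zero hx
  have n1 := prodOdd_ne_zero hx
  have nf : ∀ g : ℕ, g ≠ 0 → factor28 (q ^ 2) g ≠ 0 := fun g hg => factor28_ne_zero hx hg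
  have f4 := nf 4 (by norm_num)
  have f24 := nf 24 (by norm_num)
  have f28 := nf 28 (by norm_num)
  have f12 := nf 12 (by norm_num)
  have f16 := nf 16 (by norm_num)
  have f2 := nf 2 (by norm_num)
  have f26 := nf 26 (by norm_num)
  rw [evenPart_eq hx, oddPart_eq hx, quintupleProd_eq hx, quintupleProd_eq hx, J_four hq,
    J_eight hq, J_two hq, J_fiftysix, h0, h1, h2, h3]
  norm_num only
  congr 1
  · field_simp
    rw [prodFour]
    ring
  · field_simp
    rw [prodTwo]
    ring

theorem product_two {q : ℂ} (hq : ‖q‖ < 1) :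
    2 * oddPart (q ^ 2) 2 + q * evenPart (q ^ 2) 5 =
      2 * ((J 8 q * J 56 q * JJ 24 56 q) / (J 4 q ^ 2 * JJ 12 56 q)) +
        q * ((J 4 q ^ 3 * J 28 q * JJ 10 56 q * JJ 18 56 q) /
          (J 2 q ^ 2 * J 8 q * J 56 q * JJ 16 56 q * JJ 24 56 q)) := by
  have hx := norm_sq_lt_one hq
  have h0 := JJ_fiftysix (q := q) 5
  have h1 := JJ_fiftysix (q := q) 9
  have h2 := JJ_fiftysix (q := q) 8
  have h3 := JJ_fiftysix (q := q) 12
  have h4 := JJ_fiftysix (q := q) 6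
  norm_num at h0 h1 h2 h3 h4
  have n2 := prodTwo_ne_zero hx
  have n4 := prodFour_ne_zero hx
  have n1 := prodOdd_ne_zero hx
  have nf : ∀ g : ℕ, g ≠ 0 → factor28 (q ^ 2) g ≠ 0 := fun g hg => factor28_ne_zero hx hg
  have f8 := nf 8 (by norm_num)
  have f12 := nf 12 (by norm_num)
  have f14 := nf 14 (by norm_num)
  have f16 := nf 16 (by norm_num)
  have f20 := nf 20 (by norm_num)
  have f28 := nf 28 (by norm_num)
  have f6 := nf 6 (by norm_num)
  have f22 := nf 22 (by norm_num)
  rw [evenPart_eq hx, oddPart_eq hx, quintupleProd_eq hx, quintupleProd_eq hx, J_four hq,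
    J_eight hq, J_two hq, J_fiftysix, J_twentyeight hq, h0, h1, h2, h3, h4]
  norm_num only
  congr 1
  · field_simp
    rw [prodTwo]
    ring
  · field_simp
    rw [prodFour]
    ring

theorem product_three {q : ℂ} (hq : ‖q‖ < 1) :
    evenPart (q ^ 2) 1 + 2 * q ^ 3 * oddPart (q ^ 2) 6 =
      (J 4 q ^ 3 * J 28 q * JJ 2 56 q * JJ 26 56 q) /
          (J 2 q ^ 2 * J 8 q * J 56 q * JJ 8 56 q * JJ 16 56 q) +
        2 * q ^ 3 * ((J 8 q * J 56 q * JJ 16 56 q) / (J 4 q ^ 2 * JJ 20 56 q)) := by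
  have hx := norm_sq_lt_one hq
  have h0 := JJ_fiftysix (q := q) 1
  have h1 := JJ_fiftysix (q := q) 13
  have h2 := JJ_fiftysix (q := q) 4
  have h3 := JJ_fiftysix (q := q) 8
  have h4 := JJ_fiftysix (q := q) 10
  norm_num at h0 h1 h2 h3 h4
  have n2 := prodTwo_ne_zero hx
  have n4 := prodFour_ne_zero hx
  have n1 := prodOdd_ne_zero hx
  have nf : ∀ g : ℕ, g ≠ 0 → factor28 (q ^ 2) g ≠ 0 := fun g hg => factor28_ne_zero hx hg
  have f4 := nf 4 (by norm_num)
  have f24 := nf 24 (by norm_num)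
  have f8 := nf 8 (by norm_num)
  have f20 := nf 20 (by norm_num)
  have f28 := nf 28 (by norm_num)
  have f10 := nf 10 (by norm_num)
  have f18 := nf 18 (by norm_num)
  rw [evenPart_eq hx, oddPart_eq hx, quintupleProd_eq hx, quintupleProd_eq hx, J_four hq,
    J_eight hq, J_two hq, J_fiftysix, J_twentyeight hq, h0, h1, h2, h3, h4]
  norm_num only
  congr 1
  · field_simp
    rw [prodFour]
    ring
  · field_simp
    rw [prodTwo]
    ring

/-! ### The three identities -/

theorem qPoch_zero_zero (n : ℕ) : qPoch 0 0 n = 1 := by simp [qPoch]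

theorem qPochInf_zero_zero : qPochInf 0 0 = 1 := by simp [qPochInf]

theorem J_zero {m : ℕ} (hm : m ≠ 0) : J m 0 = 1 := by simp [J, hm, qPochInf_zero_zero]

theorem JJ_zero {a m : ℕ} (ha : a ≠ 0) (h : a < m) : JJ a m 0 = 1 := by
  rw [JJ, zero_pow ha, zero_pow (by omega : m ≠ 0), zero_pow (by omega : m - a ≠ 0),
    qPochInf_zero_zero]
  norm_num

theorem identity_one (q : ℂ) (hq : ‖q‖ < 1) :
    HasSum (fun p : ℕ × ℕ =>
        q ^ ((p.1 : ℤ) ^ 2 + 2 * (p.2 : ℤ) ^ 2 - 2 * (p.1 : ℤ) * (p.2 : ℤ)) /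
          (qPoch (q ^ 4) (q ^ 4) p.1 * qPoch (q ^ 4) (q ^ 4) p.2))
      ((J 4 q ^ 3 * J 56 q * JJ 6 28 q) / (J 2 q ^ 2 * J 8 q * JJ 8 56 q * JJ 24 56 q) +
        2 * q * ((J 8 q * J 56 q * JJ 8 56 q) / (J 4 q ^ 2 * JJ 4 56 q))) := by
  -- The main argument divides by powers of `q`. At `q = 0` every product is 1, and the only
  -- exponent that vanishes is the one at the origin.
  rcases eq_or_ne q 0 with rfl | hq0
  · simp only [J_zero, JJ_zero, ne_eq, OfNat.ofNat_ne_zero, not_false_eq_true, Nat.reduceLT]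
    convert hasSum_single ((0, 0) : ℕ × ℕ) fun p hp => ?_ using 1
    · simp [qPoch_zero_zero]
    · rw [zero_zpow, zero_div]
      intro h
      apply hp
      have h1 : ((p.1 : ℤ) - p.2) ^ 2 + (p.2 : ℤ) ^ 2 = 0 := by linarith
      have h2 : (p.2 : ℤ) = 0 := by nlinarith [sq_nonneg ((p.1 : ℤ) - p.2)]
      have h3 : (p.1 : ℤ) = 0 := by rw [h2] at h1; nlinarith
      ext <;> simp <;> omega
  · rw [← product_one hq]
    refine (hasSum_doubleTerm_one hq0 hq).congr_fun fun p => ?_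
    rw [doubleTerm]
    ring_nf

theorem identity_two (q : ℂ) (hq : ‖q‖ < 1) :
    HasSum (fun p : ℕ × ℕ =>
        q ^ ((p.1 : ℤ) ^ 2 + 2 * (p.2 : ℤ) ^ 2 - 2 * (p.1 : ℤ) * (p.2 : ℤ)
            + 2 * (p.1 : ℤ) - 2 * (p.2 : ℤ)) /
          (qPoch (q ^ 4) (q ^ 4) p.1 * qPoch (q ^ 4) (q ^ 4) p.2))
      (2 * ((J 8 q * J 56 q * JJ 24 56 q) / (J 4 q ^ 2 * JJ 12 56 q)) +
        q * ((J 4 q ^ 3 * J 28 q * JJ 10 56 q * JJ 18 56 q) /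
          (J 2 q ^ 2 * J 8 q * J 56 q * JJ 16 56 q * JJ 24 56 q))) := by
  rcases eq_or_ne q 0 with rfl | hq0
  · simp only [J_zero, JJ_zero, ne_eq, OfNat.ofNat_ne_zero, not_false_eq_true, Nat.reduceLT]
    -- The exponent is `(i - j + 1)² + j² - 1`, which vanishes at `(0, 0)` and also at `(0, 1)`;
    -- hence the value 2 at `q = 0`.
    convert hasSum_sum_of_ne_finset_zero (s := ({(0, 0), (0, 1)} : Finset (ℕ × ℕ))) fun p hp => ?_
      using 1
    · rw [Finset.sum_pair (by simp)]
      simp [qPoch_zero_zero]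
      norm_num
    · rw [zero_zpow, zero_div]
      intro h
      apply hp
      have h1 : ((p.1 : ℤ) - p.2 + 1) ^ 2 + (p.2 : ℤ) ^ 2 = 1 := by linarith
      have h4 : (0 : ℤ) ≤ p.2 := by positivity
      have h5 : (0 : ℤ) ≤ p.1 := by positivity
      have h2 : (p.2 : ℤ) ≤ 1 := by nlinarith [sq_nonneg ((p.1 : ℤ) - p.2 + 1)]
      have h3 : (p.1 : ℤ) = 0 := by
        rcases (by omega : (p.2 : ℤ) = 0 ∨ (p.2 : ℤ) = 1) with h6 | h6 <;> rw [h6] at h1 <;> nlinarith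
      simp only [Finset.mem_insert, Finset.mem_singleton, Prod.ext_iff]
      omega
    · infer_instance
  · rw [← product_two hq]
    refine (hasSum_doubleTerm_two hq0 hq).congr_fun fun p => ?_
    rw [doubleTerm]
    ring_nf

theorem identity_three (q : ℂ) (hq : ‖q‖ < 1) :
    HasSum (fun p : ℕ × ℕ =>
        q ^ ((p.1 : ℤ) ^ 2 + 2 * (p.2 : ℤ) ^ 2 - 2 * (p.1 : ℤ) * (p.2 : ℤ) + 2 * (p.1 : ℤ)) /
          (qPoch (q ^ 4) (q ^ 4) p.1 * qPoch (q ^ 4) (q ^ 4) p.2))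
      ((J 4 q ^ 3 * J 28 q * JJ 2 56 q * JJ 26 56 q) /
          (J 2 q ^ 2 * J 8 q * J 56 q * JJ 8 56 q * JJ 16 56 q) +
        2 * q ^ 3 * ((J 8 q * J 56 q * JJ 16 56 q) / (J 4 q ^ 2 * JJ 20 56 q))) := by
  rcases eq_or_ne q 0 with rfl | hq0
  · simp only [J_zero, JJ_zero, ne_eq, OfNat.ofNat_ne_zero, not_false_eq_true, Nat.reduceLT]
    convert hasSum_single ((0, 0) : ℕ × ℕ) fun p hp => ?_ using 1
    · simp [qPoch_zero_zero]
    · rw [zero_zpow, zero_div]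
      intro h
      apply hp
      have h5 : (0 : ℤ) ≤ p.1 := by positivity
      have h1 : ((p.1 : ℤ) - p.2) ^ 2 + (p.2 : ℤ) ^ 2 + 2 * p.1 = 0 := by linarith
      have h2 : (p.2 : ℤ) = 0 := by nlinarith [sq_nonneg ((p.1 : ℤ) - p.2)]
      have h3 : (p.1 : ℤ) = 0 := by nlinarith [sq_nonneg ((p.1 : ℤ) - p.2)]
      ext <;> simp <;> omega
  · rw [← product_three hq]
    refine (hasSum_doubleTerm_three hq0 hq).congr_fun fun p => ?_
    rw [doubleTerm]
    ring_nf

/-! ### Theta functions with rational characteristics -/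

/-- The theta function `∑ (-1)^n exp(πi((n + a - 1/2)² τ + 2 (n - 1/2) b + ab))`. -/
noncomputable def charTheta (a b : ℚ) (τ : ℂ) : ℂ :=
  Complex.exp (Real.pi * Complex.I * (((a : ℂ) - 1 / 2) ^ 2 * τ - b + a * b))
    * jacobiTheta₂ (((a : ℂ) - 1 / 2) * τ + b + 1 / 2) τ

theorem hasSum_charTheta (a b : ℚ) {τ : ℂ} (hτ : 0 < τ.im) :
    HasSum (fun n : ℤ => Complex.exp (Real.pi * Complex.I * (((n : ℂ) + a - 1 / 2) ^ 2 * τ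
      + 2 * (n - 1 / 2) * b + a * b + n))) (charTheta a b τ) := by
  refine ((hasSum_jacobiTheta₂_term _ hτ).mul_left _).congr_fun fun n => ?_
  rw [jacobiTheta₂_term, ← Complex.exp_add]
  congr 1
  ring

theorem exp_pi_mul_int_even (n : ℤ) : Complex.exp (Real.pi * Complex.I * (2 * n)) = 1 := by
  rw [Complex.exp_eq_one_iff]
  exact ⟨n, by ring⟩

theorem exp_add_even (z : ℂ) (n : ℤ) :
    Complex.exp (z + Real.pi * Complex.I * (2 * n)) = Complex.exp z := by
  rw [Complex.exp_add, exp_pi_mul_int_even, mul_one]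

/-- The summand `ab` in the defining exponent is there to make the factor for `τ ↦ -1/τ` independent
of `(a, b)`. -/
theorem charTheta_S (a b : ℚ) {τ : ℂ} (hτ : 0 < τ.im) :
    charTheta b (-a) τ
      = Complex.I * (1 / (-Complex.I * τ) ^ (1 / 2 : ℂ)) * charTheta a b (-1 / τ) := by
  have h0 : τ ≠ 0 := by rintro rfl; simp at hτ
  have hz : (((b : ℂ) - 1 / 2) * τ + ((-a : ℚ) : ℂ) + 1 / 2) / τ + 1
      = ((a : ℂ) - 1 / 2) * (-1 / τ) + b + 1 / 2 := by
    push_cast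
    field_simp
    ring
  rw [charTheta, jacobiTheta₂_functional_equation, ← jacobiTheta₂_add_left, hz, charTheta]
  have hI : Complex.exp (Real.pi * Complex.I * (1 / 2)) = Complex.I := by
    rw [show (Real.pi * Complex.I * (1 / 2) : ℂ) = Real.pi / 2 * Complex.I by ring,
      Complex.exp_pi_div_two_mul_I]
  have key : Complex.exp (Real.pi * Complex.I * (((b : ℂ) - 1 / 2) ^ 2 * τ - ((-a : ℚ) : ℂ)
      + b * ((-a : ℚ) : ℂ))) * Complex.exp (-Real.pi * Complex.I
        * (((b : ℂ) - 1 / 2) * τ + ((-a : ℚ) : ℂ) + 1 / 2) ^ 2 / τ)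
      = Complex.I * Complex.exp (Real.pi * Complex.I * (((a : ℂ) - 1 / 2) ^ 2 * (-1 / τ)
        - b + a * b)) := by
    refine Eq.trans ?_ (congrArg (· * _) hI)
    rw [← Complex.exp_add]
    refine Eq.trans ?_ (Complex.exp_add _ _)
    congr 1
    push_cast
    field_simp
    ring
  linear_combination (1 / (-Complex.I * τ) ^ (1 / 2 : ℂ)
    * jacobiTheta₂ (((a : ℂ) - 1 / 2) * (-1 / τ) + b + 1 / 2) (-1 / τ)) * key

/-- Expand `(n + a - 1/2)² = (n² - n) + 1/4 + 2a(n - 1/2) + a²`. The even integer `n² - n` drops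
out, `1/4` gives the constant, and the rest replaces `b` by `a + b`. -/
theorem charTheta_T (a b : ℚ) {τ : ℂ} (hτ : 0 < τ.im) :
    charTheta a b (1 + τ)
      = Complex.exp (Real.pi * Complex.I * (1 / 4)) * charTheta a (a + b) τ := by
  have hτ' : 0 < (1 + τ).im := by simpa
  refine (hasSum_charTheta a b hτ').unique (((hasSum_charTheta a (a + b) hτ).mul_left _).congr_fun
    fun n => ?_)
  obtain ⟨k, hk⟩ : ∃ k : ℤ, n ^ 2 - n = 2 * k := by
    have := Int.even_mul_pred_self n
    obtain ⟨k, hk⟩ := this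
    exact ⟨k, by linarith [hk, show n ^ 2 - n = n * (n - 1) by ring]⟩
  have hk' : (n : ℂ) ^ 2 - n = 2 * k := by exact_mod_cast hk
  rw [← Complex.exp_add, ← exp_add_even _ (-k),
    show 2 * ((-k : ℤ) : ℂ) = n - n ^ 2 by push_cast; linear_combination hk']
  congr 1
  push_cast
  ring

theorem charTheta_add_int_left (a b : ℚ) (m : ℤ) {τ : ℂ} (hτ : 0 < τ.im) :
    charTheta (a + m) b τ
      = Complex.exp (Real.pi * Complex.I * (-m * b - m)) * charTheta a b τ := by
  have h := (Equiv.addRight m).hasSum_iff.mpr (hasSum_charTheta a b hτ)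
  refine (hasSum_charTheta (a + m) b hτ).unique ((h.mul_left _).congr_fun fun n => ?_)
  simp only [Function.comp_apply, Equiv.coe_addRight]
  rw [← Complex.exp_add]
  congr 1
  push_cast
  ring

theorem charTheta_add_int_right (a b : ℚ) (m : ℤ) {τ : ℂ} (hτ : 0 < τ.im) :
    charTheta a (b + m) τ
      = Complex.exp (Real.pi * Complex.I * (-m + a * m)) * charTheta a b τ := by
  refine (hasSum_charTheta a (b + m) hτ).unique
    (((hasSum_charTheta a b hτ).mul_left _).congr_fun fun n => ?_)
  rw [← Complex.exp_add, ← exp_add_even _ (-(n * m))]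
  congr 1
  push_cast
  ring

theorem charTheta_add_int (a b : ℚ) (m n : ℤ) {τ : ℂ} (hτ : 0 < τ.im) :
    charTheta (a + m) (b + n) τ = Complex.exp (Real.pi * Complex.I
      * (-m * (b + n) - m - n + a * n)) * charTheta a b τ := by
  rw [charTheta_add_int_left a _ m hτ, charTheta_add_int_right a b n hτ, ← mul_assoc,
    ← Complex.exp_add]
  congr 2
  push_cast
  ring

open Matrix.SpecialLinearGroup in
/-- The family of all theta functions with characteristics is permuted by `SL(2, ℤ)` up to an
automorphy factor that does not depend on the characteristic. -/
theorem charTheta_smul (γ : Matrix.SpecialLinearGroup (Fin 2) ℤ) (τ : UpperHalfPlane) :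
    ∃ κ : ℂ, κ ≠ 0 ∧ ∀ a b : ℚ, charTheta a b (γ • τ : UpperHalfPlane)
      = κ * charTheta (a * γ 0 0 + b * γ 1 0) (a * γ 0 1 + b * γ 1 1) τ := by
  have hmem : γ ∈ Subgroup.closure {ModularGroup.S, ModularGroup.T} := by
    simp [_root_.SpecialLinearGroup.SL2Z_generators]
  induction hmem using Subgroup.closure_induction generalizing τ with
  | mem γ hγ =>
    rcases hγ with rfl | rfl
    · have him : 0 < (τ : ℂ).im := τ.im_pos
      have hτ0 : (τ : ℂ) ≠ 0 := UpperHalfPlane.ne_zero τ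
      have hne : Complex.I * (1 / (-Complex.I * (τ : ℂ)) ^ (1 / 2 : ℂ)) ≠ 0 := by
        refine mul_ne_zero Complex.I_ne_zero (one_div_ne_zero ?_)
        rw [Complex.cpow_ne_zero_iff]
        left
        simp [hτ0]
      refine ⟨_, inv_ne_zero hne, fun a b => ?_⟩
      have h := charTheta_S a b him
      rw [UpperHalfPlane.modular_S_smul]
      have h2 : (((-(τ : ℂ))⁻¹ : ℂ)) = -1 / τ := by field_simp
      have e1 : a * ((ModularGroup.S 0 0 : ℤ) : ℚ) + b * ((ModularGroup.S 1 0 : ℤ) : ℚ) = b := by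
        simp [ModularGroup.S]
      have e2 : a * ((ModularGroup.S 0 1 : ℤ) : ℚ) + b * ((ModularGroup.S 1 1 : ℤ) : ℚ) = -a := by
        simp [ModularGroup.S]
      rw [UpperHalfPlane.coe_mk, h2, e1, e2, h, inv_mul_cancel_left₀ hne]
    · refine ⟨_, Complex.exp_ne_zero (Real.pi * Complex.I * (1 / 4)), fun a b => ?_⟩
      have h := charTheta_T a b τ.im_pos
      rw [UpperHalfPlane.modular_T_smul, UpperHalfPlane.coe_vadd]
      simp only [ModularGroup.T]
      simpa using h
  | one => exact ⟨1, one_ne_zero, fun a b => by simp⟩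
  | mul γ₁ γ₂ _ _ h₁ h₂ =>
    obtain ⟨κ₁, hκ₁, h₁⟩ := h₁ (γ₂ • τ)
    obtain ⟨κ₂, hκ₂, h₂⟩ := h₂ τ
    refine ⟨κ₁ * κ₂, mul_ne_zero hκ₁ hκ₂, fun a b => ?_⟩
    rw [mul_smul, h₁, h₂, mul_assoc]
    congr 3
    · simp [Matrix.mul_apply, Fin.sum_univ_two]; ring
    · simp [Matrix.mul_apply, Fin.sum_univ_two]; ring
  | inv γ _ h =>
    obtain ⟨κ, hκ, h⟩ := h (γ⁻¹ • τ)
    refine ⟨κ⁻¹, inv_ne_zero hκ, fun a b => ?_⟩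
    have h1 := h (a * γ⁻¹ 0 0 + b * γ⁻¹ 1 0) (a * γ⁻¹ 0 1 + b * γ⁻¹ 1 1)
    rw [smul_inv_smul] at h1
    rw [h1, inv_mul_cancel_left₀ hκ]
    have hdet : (γ 0 0 : ℚ) * γ 1 1 - γ 0 1 * γ 1 0 = 1 := by
      have := γ.det_coe
      rw [Matrix.det_fin_two] at this
      exact_mod_cast this
    congr 1
    · simp [Matrix.SpecialLinearGroup.SL2_inv_expl]; linear_combination -a * hdet
    · simp [Matrix.SpecialLinearGroup.SL2_inv_expl]; linear_combination -b * hdet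

/-! ### Product formulas for the theta functions -/

/-- The exponential `z ↦ e^{πiz}`. -/
noncomputable def expPi (z : ℂ) : ℂ := Complex.exp (Real.pi * Complex.I * z)

theorem expPi_add (z w : ℂ) : expPi (z + w) = expPi z * expPi w := by
  rw [expPi, expPi, expPi, mul_add, Complex.exp_add]

theorem expPi_nsmul (n : ℕ) (z : ℂ) : expPi (n * z) = expPi z ^ n := by
  rw [expPi, expPi, ← Complex.exp_nat_mul]
  ring_nf

theorem expPi_zsmul (n : ℤ) (z : ℂ) : expPi (n * z) = expPi z ^ n := by
  rw [expPi, expPi, ← Complex.exp_int_mul]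
  ring_nf

theorem expPi_sub (z w : ℂ) : expPi (z - w) = expPi z / expPi w := by
  rw [expPi, expPi, expPi, mul_sub, Complex.exp_sub]

theorem expPi_ne_zero (z : ℂ) : expPi z ≠ 0 := Complex.exp_ne_zero _

theorem expPi_one : expPi 1 = -1 := by rw [expPi, mul_one, Complex.exp_pi_mul_I]

theorem expPi_two_mul_int (n : ℤ) : expPi (2 * n) = 1 := exp_pi_mul_int_even n

theorem norm_expPi (z : ℂ) : ‖expPi z‖ = Real.exp (-(Real.pi * z.im)) := by
  rw [expPi, Complex.norm_exp]
  simp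

theorem norm_expPi_lt_one {z : ℂ} (hz : 0 < z.im) : ‖expPi z‖ < 1 := by
  rw [norm_expPi, Real.exp_lt_one_iff, neg_lt_zero]
  positivity

/-- Jacobi's triple product. The half-integral shifts in the definition are what absorb its minus
signs. -/
theorem charTheta_eq (a b : ℚ) {τ : ℂ} (hτ : 0 < τ.im) :
    charTheta a b τ = expPi (((a : ℂ) - 1 / 2) ^ 2 * τ - b + a * b)
      * (qPochInf (expPi (2 * τ)) (expPi (2 * τ)) * (qPochInf (expPi (2 * (a * τ + b)))
        (expPi (2 * τ)) * qPochInf (expPi (2 * τ) / expPi (2 * (a * τ + b))) (expPi (2 * τ)))) := by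
  rw [charTheta, ← expPi]
  congr 1
  have h := hasSum_jacobiTripleProduct (expPi_ne_zero τ) (norm_expPi_lt_one hτ)
    (expPi_ne_zero (2 * (((a : ℂ) - 1 / 2) * τ + b + 1 / 2)))
  have e1 : expPi τ ^ 2 = expPi (2 * τ) := by
    simpa using (expPi_nsmul 2 τ).symm
  have e2 : -(expPi (2 * (((a : ℂ) - 1 / 2) * τ + b + 1 / 2)) * expPi τ)
      = expPi (2 * (a * τ + b)) := by
    rw [← expPi_add, show 2 * (((a : ℂ) - 1 / 2) * τ + b + 1 / 2) + τ = 2 * (a * τ + b) + 1 by ring,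
      expPi_add, expPi_one]
    ring
  have e3 : -(expPi τ / expPi (2 * (((a : ℂ) - 1 / 2) * τ + b + 1 / 2)))
      = expPi (2 * τ) / expPi (2 * (a * τ + b)) := by
    rw [← expPi_sub, ← expPi_sub,
      show τ - 2 * (((a : ℂ) - 1 / 2) * τ + b + 1 / 2) = 2 * τ - 2 * (a * τ + b) - 1 by ring,
      expPi_sub _ 1, expPi_one]
    ring
  rw [e1, e2, e3, mul_assoc] at h
  refine (hasSum_jacobiTheta₂_term _ hτ).unique (h.congr_fun fun n => ?_)
  rw [← expPi_zsmul, ← expPi_zsmul, ← expPi_add, jacobiTheta₂_term, expPi]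
  congr 1
  push_cast
  ring

/-! ### Division values of order two and three. -/

theorem qPochInf_mul_omega (a : ℂ) {q w : ℂ} (hq : ‖q‖ < 1) (hw : w ^ 2 + w + 1 = 0) :
    qPochInf a q * qPochInf (w * a) q * qPochInf (w ^ 2 * a) q = qPochInf (a ^ 3) (q ^ 3) := by
  have hq3 : ‖q ^ 3‖ < 1 := by
    rw [norm_pow]; exact pow_lt_one₀ (norm_nonneg _) hq three_ne_zero
  refine tendsto_nhds_unique (((tendsto_qPoch a hq).mul (tendsto_qPoch _ hq)).mul
    (tendsto_qPoch _ hq)) ?_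
  refine (tendsto_qPoch (a ^ 3) hq3).congr fun m => ?_
  rw [qPoch, qPoch, qPoch, qPoch, ← Finset.prod_mul_distrib, ← Finset.prod_mul_distrib]
  refine Finset.prod_congr rfl fun k _ => ?_
  have h3 : w ^ 3 = 1 := by linear_combination (w - 1) * hw
  rw [← pow_mul, mul_comm 3 k, pow_mul]
  linear_combination (a * q ^ k - (a * q ^ k) ^ 2 * w) * hw + (a * q ^ k) ^ 3 * h3

/-- Multiplied by `(y⁴;y⁴)_∞`, the first two factors recombine to `(y²;y²)_∞`, which the third turns
back into `(y⁴;y⁴)_∞`. -/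
theorem level_two_product {y : ℂ} (hy : ‖y‖ < 1) :
    qPochInf y (y ^ 2) * qPochInf (-y) (y ^ 2) * qPochInf (-y ^ 2) (y ^ 2) = 1 := by
  have hy2 : ‖y ^ 2‖ < 1 := norm_sq_lt_one hy
  have hy4 : ‖(y ^ 2) ^ 2‖ < 1 := norm_sq_lt_one hy2
  have h1 := qPochInf_mul_neg y hy2
  have h2 := qPochInf_mul_neg (y ^ 2) hy2
  have h3 := qPochInf_eq_prod (y ^ 2) hy2 (k := 2) (by norm_num)
  simp only [Finset.prod_range_succ, Finset.prod_range_zero, pow_zero, pow_one, mul_one,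
    one_mul, ← sq] at h3
  refine mul_left_cancel₀ (qPochInf_ne_zero_of_norm_lt hy4 hy4) ?_
  rw [h1, mul_one]
  conv_rhs => rw [← h2, h3]
  ring

theorem level_three_product {z w : ℂ} (hz : ‖z‖ < 1) (hw : w ^ 2 + w + 1 = 0) :
    (qPochInf (w * z ^ 3) (z ^ 3) * qPochInf (w ^ 2 * z ^ 3) (z ^ 3))
      * (qPochInf z (z ^ 3) * qPochInf (w * z) (z ^ 3) * qPochInf (w ^ 2 * z) (z ^ 3))
      * (qPochInf (z ^ 2) (z ^ 3) * qPochInf (w * z ^ 2) (z ^ 3) * qPochInf (w ^ 2 * z ^ 2) (z ^ 3))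
      = 1 := by
  have hz3 : ‖z ^ 3‖ < 1 := by
    rw [norm_pow]; exact pow_lt_one₀ (norm_nonneg _) hz three_ne_zero
  have h1 := qPochInf_mul_omega z hz3 hw
  have h2 := qPochInf_mul_omega (z ^ 2) hz3 hw
  have h3 := qPochInf_mul_omega (z ^ 3) hz3 hw
  have h4 := qPochInf_eq_prod (z ^ 3) hz3 (k := 3) (by norm_num)
  simp only [Finset.prod_range_succ, Finset.prod_range_zero, pow_zero, pow_one, mul_one,
    one_mul] at h4
  rw [h1, h2, show (z ^ 2) ^ 3 = z ^ 3 * z ^ 3 by ring]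
  refine mul_left_cancel₀ (qPochInf_ne_zero_of_norm_lt hz3 hz3) ?_
  conv_rhs => rw [mul_one, h4]
  rw [show z ^ 3 * (z ^ 3) ^ 2 = (z ^ 3) ^ 3 by ring, ← h3]
  ring

/-- A product of ten division values of order two and three. -/
noncomputable def thetaD (k : ℚ → ℚ → ℂ) : ℂ :=
  (k (1 / 2) 0 * k 0 (1 / 2) * k (1 / 2) (1 / 2)) ^ 2
    * (k 0 (1 / 3) * k (1 / 3) 0 * k (1 / 3) (1 / 3) * k (1 / 3) (-(1 / 3)))

/-- The right-hand side is a constant times `η(τ)^10`. The theorem expresses a power of eta through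
the same family of thetas, so that one automorphy factor serves for everything and no eta multiplier
is needed. -/
theorem thetaD_charTheta : ∃ C : ℂ, C ≠ 0 ∧ ∀ τ : ℂ, 0 < τ.im →
    thetaD (fun a b => charTheta a b τ)
      = C * expPi (5 / 6 * τ) * qPochInf (expPi (2 * τ)) (expPi (2 * τ)) ^ 10 := by
  set w := expPi (2 / 3) with hw
  have hw3 : w ^ 3 = 1 := by
    rw [hw, ← expPi_nsmul, ← expPi_two_mul_int 1]; congr 1; norm_num
  have hw1 : 1 - w ≠ 0 := by
    intro h
    have h1 : Complex.exp (Real.pi * Complex.I * (2 / 3)) = 1 := by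
      have := sub_eq_zero.mp h
      rw [hw, expPi] at this
      exact this.symm
    obtain ⟨n, hn⟩ := Complex.exp_eq_one_iff.mp h1
    have h2 : (Real.pi : ℂ) * Complex.I ≠ 0 := by simp [Real.pi_ne_zero]
    have h3 : ((2 : ℤ) : ℂ) = ((6 * n : ℤ) : ℂ) := by
      push_cast
      apply mul_left_cancel₀ h2
      linear_combination 3 * hn
    have h4 : (2 : ℤ) = 6 * n := by exact_mod_cast h3
    omega
  have hww : w ^ 2 + w + 1 = 0 := by
    apply mul_left_cancel₀ hw1
    linear_combination -hw3
  -- The 4 is the square of the 2 in `(-1;X)_∞ = 2(-X;X)_∞`, the factor `1 - w` is the first one of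
  -- `(w;X)_∞`, and the exponential collects the phases independent of `τ`.
  refine ⟨4 * (1 - w) * expPi (-(11 / 6)), mul_ne_zero (mul_ne_zero (by norm_num) hw1)
    (expPi_ne_zero _), fun τ hτ => ?_⟩
  set Y := expPi τ with hY
  set Z := expPi (2 / 3 * τ) with hZ
  set X := expPi (2 * τ) with hX
  have hXY : Y ^ 2 = X := by rw [hY, hX, ← expPi_nsmul]; norm_num
  have hXZ : Z ^ 3 = X := by rw [hZ, hX, ← expPi_nsmul]; congr 1; push_cast; ring
  have hY1 : ‖Y‖ < 1 := norm_expPi_lt_one hτ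
  have hZ1 : ‖Z‖ < 1 := norm_expPi_lt_one (by
    rw [show (2 / 3 : ℂ) = ((2 / 3 : ℝ) : ℂ) by norm_num, Complex.im_ofReal_mul]; positivity)
  have hX1 : ‖X‖ < 1 := norm_expPi_lt_one (by simpa using hτ)
  have hY0 : Y ≠ 0 := expPi_ne_zero _
  have hZ0 : Z ≠ 0 := expPi_ne_zero _
  have hw0 : w ≠ 0 := expPi_ne_zero _
  have L2 := level_two_product hY1
  have L3 := level_three_product hZ1 hww
  have k1 := charTheta_eq (1 / 2) 0 hτ
  have k2 := charTheta_eq 0 (1 / 2) hτ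
  have k3 := charTheta_eq (1 / 2) (1 / 2) hτ
  have k4 := charTheta_eq 0 (1 / 3) hτ
  have k5 := charTheta_eq (1 / 3) 0 hτ
  have k6 := charTheta_eq (1 / 3) (1 / 3) hτ
  have k7 := charTheta_eq (1 / 3) (-(1 / 3)) hτ
  push_cast at k1 k2 k3 k4 k5 k6 k7
  rw [show (2 * (1 / 2 * τ + 0) : ℂ) = τ by ring, ← hX, ← hY, ← hXY, sq Y,
    mul_div_cancel_right₀ _ hY0, ← sq] at k1
  rw [show (2 * (0 * τ + 1 / 2) : ℂ) = 1 by ring, ← hX, expPi_one, qPochInf_step (-1) hX1, ← hXY,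
    show Y ^ 2 / -1 = - Y ^ 2 by ring, show -1 * Y ^ 2 = - Y ^ 2 by ring] at k2
  rw [show (2 * (1 / 2 * τ + 1 / 2) : ℂ) = τ + 1 by ring, expPi_add τ 1, expPi_one, ← hX, ← hY, ← hXY,
    show Y ^ 2 / (Y * -1) = - Y by field_simp, show Y * -1 = - Y by ring] at k3
  rw [show (2 * (0 * τ + 1 / 3) : ℂ) = 2 / 3 by ring, ← hw, ← hX, qPochInf_step w hX1,
    show X / w = w ^ 2 * X by rw [div_eq_iff hw0]; linear_combination (-X) * hw3] at k4
  rw [show (2 * (1 / 3 * τ + 0) : ℂ) = 2 / 3 * τ by ring, ← hZ, ← hX, ← hXZ,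
    show Z ^ 3 / Z = Z ^ 2 by field_simp] at k5
  rw [show (2 * (1 / 3 * τ + 1 / 3) : ℂ) = 2 / 3 + 2 / 3 * τ by ring,
    expPi_add (2 / 3), ← hZ, ← hw, ← hX,
    ← hXZ, show Z ^ 3 / (w * Z) = w ^ 2 * Z ^ 2 by
      rw [div_eq_iff (mul_ne_zero hw0 hZ0)]; linear_combination (-Z ^ 3) * hw3] at k6
  rw [show (2 * (1 / 3 * τ + -(1 / 3)) : ℂ) = 2 / 3 * τ - 2 / 3 by ring,
    expPi_sub (2 / 3 * τ), ← hZ, ← hw,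
    ← hX, show Z / w = w ^ 2 * Z by rw [div_eq_iff hw0]; linear_combination (-Z) * hw3,
    ← hXZ, show Z ^ 3 / (w ^ 2 * Z) = w * Z ^ 2 by
      rw [div_eq_iff (mul_ne_zero (pow_ne_zero 2 hw0) hZ0)]
      linear_combination (-Z ^ 3) * hw3] at k7
  have hE : (expPi ((1 / 2 - 1 / 2) ^ 2 * τ - 0 + 1 / 2 * 0)
      * expPi ((0 - 1 / 2) ^ 2 * τ - 1 / 2 + 0 * (1 / 2))
      * expPi ((1 / 2 - 1 / 2) ^ 2 * τ - 1 / 2 + 1 / 2 * (1 / 2))) ^ 2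
      * (expPi ((0 - 1 / 2) ^ 2 * τ - 1 / 3 + 0 * (1 / 3))
      * expPi ((1 / 3 - 1 / 2) ^ 2 * τ - 0 + 1 / 3 * 0)
      * expPi ((1 / 3 - 1 / 2) ^ 2 * τ - 1 / 3 + 1 / 3 * (1 / 3))
      * expPi ((1 / 3 - 1 / 2) ^ 2 * τ - -(1 / 3) + 1 / 3 * -(1 / 3)))
      = expPi (-(11 / 6)) * expPi (5 / 6 * τ) := by
    rw [← expPi_add, ← expPi_add, ← expPi_add, ← expPi_add, ← expPi_add, ← expPi_nsmul,
      ← expPi_add, ← expPi_add]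
    congr 1
    push_cast
    ring
  rw [thetaD, k1, k2, k3, k4, k5, k6, k7]
  rw [hXZ] at L3 ⊢
  rw [hXY] at L2 ⊢
  generalize expPi ((1 / 2 - 1 / 2) ^ 2 * τ - 0 + 1 / 2 * 0) = E1 at hE ⊢
  generalize expPi ((0 - 1 / 2) ^ 2 * τ - 1 / 2 + 0 * (1 / 2)) = E2 at hE ⊢
  generalize expPi ((1 / 2 - 1 / 2) ^ 2 * τ - 1 / 2 + 1 / 2 * (1 / 2)) = E3 at hE ⊢
  generalize expPi ((0 - 1 / 2) ^ 2 * τ - 1 / 3 + 0 * (1 / 3)) = E4 at hE ⊢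
  generalize expPi ((1 / 3 - 1 / 2) ^ 2 * τ - 0 + 1 / 3 * 0) = E5 at hE ⊢
  generalize expPi ((1 / 3 - 1 / 2) ^ 2 * τ - 1 / 3 + 1 / 3 * (1 / 3)) = E6 at hE ⊢
  generalize expPi ((1 / 3 - 1 / 2) ^ 2 * τ - -(1 / 3) + 1 / 3 * -(1 / 3)) = E7 at hE ⊢
  generalize expPi (-(11 / 6)) = E8 at hE ⊢
  generalize expPi (5 / 6 * τ) = E9 at hE ⊢
  generalize qPochInf X X = p at L2 L3 ⊢
  generalize qPochInf Y X = a1 at *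
  generalize qPochInf (-Y) X = a2 at *
  generalize qPochInf (-X) X = a3 at *
  generalize qPochInf (w * X) X = b1 at *
  generalize qPochInf (w ^ 2 * X) X = b2 at *
  generalize qPochInf Z X = c1 at *
  generalize qPochInf (w * Z) X = c2 at *
  generalize qPochInf (w ^ 2 * Z) X = c3 at *
  generalize qPochInf (Z ^ 2) X = d1 at *
  generalize qPochInf (w * Z ^ 2) X = d2 at *
  generalize qPochInf (w ^ 2 * Z ^ 2) X = d3 at *
  trans ((E1 * E2 * E3) ^ 2 * (E4 * E5 * E6 * E7)) * (4 * (1 - w) * (a1 * a2 * a3) ^ 4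
    * ((b1 * b2) * (c1 * c2 * c3) * (d1 * d2 * d3))) * p ^ 10
  · ring
  · rw [hE, L2, L3]
    ring

/-! ### The two parts of the double sums as quotients of theta functions -/

theorem prodOdd_eq {x : ℂ} (hx : ‖x‖ < 1) : prodOdd x = factor28 x 1 * factor28 x 3 * factor28 x 5
    * factor28 x 7 * factor28 x 9 * factor28 x 11 * factor28 x 13 * factor28 x 15 * factor28 x 17
    * factor28 x 19 * factor28 x 21 * factor28 x 23 * factor28 x 25 * factor28 x 27 := by
  have := qPochInf_pow_eq hx (d := 2) (k := 14) (by norm_num) 1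
  rw [pow_one] at this
  rw [prodOdd, this]
  simp [Finset.prod_range_succ, factor28]

/-- The numerator of the theta quotient attached to `evenPart`. -/
noncomputable def evenNum (m : ℕ) (k : ℚ → ℚ → ℂ) : ℂ :=
  thetaD k * (k (2 / 28) 0 * k (6 / 28) 0 * k (10 / 28) 0 * k (14 / 28) 0)
    * (k (m / 28) 0 * k ((14 - m) / 28) 0 * k ((14 - 2 * m) / 28) 0)

/-- The denominator of the theta quotient attached to `evenPart`. -/
noncomputable def evenDen (k : ℚ → ℚ → ℂ) : ℂ :=
  (k (1 / 28) 0 * k (3 / 28) 0 * k (5 / 28) 0 * k (7 / 28) 0 * k (9 / 28) 0 * k (11 / 28) 0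
    * k (13 / 28) 0) ^ 2 * (k (4 / 28) 0 * k (8 / 28) 0 * k (12 / 28) 0)

/-- The numerator of the theta quotient attached to `oddPart`. -/
noncomputable def oddNum (m : ℕ) (k : ℚ → ℚ → ℂ) : ℂ :=
  thetaD k * (k (m / 28) 0 * k ((14 - m) / 28) 0 * k ((14 - 2 * m) / 28) 0)

/-- The denominator of the theta quotient attached to `oddPart`. -/
noncomputable def oddDen (k : ℚ → ℚ → ℂ) : ℂ :=
  (k (2 / 28) 0 * k (6 / 28) 0 * k (10 / 28) 0) ^ 3 * k (14 / 28) 0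
    * (k (4 / 28) 0 * k (8 / 28) 0 * k (12 / 28) 0)

/-- The theta functions of level `1176` that enter the two quotients. -/
noncomputable def levelTheta (τ : ℂ) (a b : ℚ) : ℂ := charTheta a b (1176 * τ)

theorem im_natCast_mul_pos {n : ℕ} (hn : n ≠ 0) {τ : ℂ} (hτ : 0 < τ.im) :
    0 < ((n : ℂ) * τ).im := by
  have : 0 < (n : ℝ) := by positivity
  rw [← Complex.ofReal_natCast, Complex.im_ofReal_mul]
  positivity

/-- With `x = e^{84πiτ}` one has `x^28 = e^{2πi·1176τ}`, which explains the argument `1176τ`. -/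
theorem levelTheta_eq {g : ℕ} (hg : g ≤ 28) {a : ℚ} (ha : a = g / 28) {τ : ℂ} (hτ : 0 < τ.im) :
    levelTheta τ a 0 = expPi (3 / 2 * (14 - g) ^ 2 * τ) * (factor28 (expPi (84 * τ)) 28
      * (factor28 (expPi (84 * τ)) g * factor28 (expPi (84 * τ)) (28 - g))) := by
  have e1 : expPi (2 * (1176 * τ)) = expPi (84 * τ) ^ 28 := by
    rw [← expPi_nsmul]; push_cast; ring_nf
  have e2 : expPi (2 * (((g / 28 : ℚ) : ℂ) * (1176 * τ) + (0 : ℚ))) = expPi (84 * τ) ^ g := by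
    rw [← expPi_nsmul]; push_cast; ring_nf
  have h0 := im_natCast_mul_pos (n := 1176) (by norm_num) hτ
  push_cast at h0
  rw [levelTheta, ha, charTheta_eq _ _ h0, e1, e2,
    factor28, factor28, factor28, pow_sub₀ _ (expPi_ne_zero _) hg, ← div_eq_mul_inv]
  congr 2
  push_cast
  ring

theorem expPi_three_half_mul (n : ℕ) (t τ : ℂ) (ht : t = n) :
    expPi (3 / 2 * t * τ) = expPi (3 / 2 * τ) ^ n := by
  rw [← expPi_nsmul, ht]
  ring_nf

theorem thetaD_levelTheta (C : ℂ) (hD : ∀ τ : ℂ, 0 < τ.im → thetaD (fun a b => charTheta a b τ)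
      = C * expPi (5 / 6 * τ) * qPochInf (expPi (2 * τ)) (expPi (2 * τ)) ^ 10)
    {τ : ℂ} (hτ : 0 < τ.im) :
    thetaD (levelTheta τ) = C * expPi (980 * τ) * factor28 (expPi (84 * τ)) 28 ^ 10 := by
  have e1 : expPi (2 * (1176 * τ)) = expPi (84 * τ) ^ 28 := by
    rw [← expPi_nsmul]; push_cast; ring_nf
  have := hD _ (im_natCast_mul_pos (n := 1176) (by norm_num) hτ)
  push_cast at this
  rw [e1, show 5 / 6 * (1176 * τ) = 980 * τ by ring] at this
  exact this

theorem evenDen_levelTheta {τ : ℂ} (hτ : 0 < τ.im) :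
    evenDen (levelTheta τ) = expPi (1575 * τ) * (factor28 (expPi (84 * τ)) 28 ^ 16
      * (prodOdd (expPi (84 * τ)) ^ 2 * prodFour (expPi (84 * τ)))) := by
  have hx := norm_expPi_lt_one (im_natCast_mul_pos (n := 84) (by norm_num) hτ)
  push_cast at hx
  rw [prodOdd_eq hx, prodFour, evenDen,
    levelTheta_eq (g := 1) (by norm_num) (by norm_num) hτ,
    levelTheta_eq (g := 3) (by norm_num) (by norm_num) hτ,
    levelTheta_eq (g := 5) (by norm_num) (by norm_num) hτ,
    levelTheta_eq (g := 7) (by norm_num) (by norm_num) hτ,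
    levelTheta_eq (g := 9) (by norm_num) (by norm_num) hτ,
    levelTheta_eq (g := 11) (by norm_num) (by norm_num) hτ,
    levelTheta_eq (g := 13) (by norm_num) (by norm_num) hτ,
    levelTheta_eq (g := 4) (by norm_num) (by norm_num) hτ,
    levelTheta_eq (g := 8) (by norm_num) (by norm_num) hτ,
    levelTheta_eq (g := 12) (by norm_num) (by norm_num) hτ,
    expPi_three_half_mul 169 _ _ (by norm_num), expPi_three_half_mul 121 _ _ (by norm_num),
    expPi_three_half_mul 81 _ _ (by norm_num), expPi_three_half_mul 49 _ _ (by norm_num),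
    expPi_three_half_mul 25 _ _ (by norm_num), expPi_three_half_mul 9 _ _ (by norm_num),
    expPi_three_half_mul 1 _ _ (by norm_num), expPi_three_half_mul 100 _ _ (by norm_num),
    expPi_three_half_mul 36 _ _ (by norm_num), expPi_three_half_mul 4 _ _ (by norm_num),
    show (1575 : ℂ) * τ = 3 / 2 * 1050 * τ by ring, expPi_three_half_mul 1050 _ _ (by norm_num)]
  norm_num only
  ring

/-- The theta with characteristic `14/28` contains the factor of index 14 twice. The additional one
on the left completes the cube of `prodTwo`; it cancels later against the same factor in
`quintuple_levelTheta`. -/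
theorem oddDen_levelTheta {τ : ℂ} (hτ : 0 < τ.im) :
    factor28 (expPi (84 * τ)) 14 * oddDen (levelTheta τ)
      = expPi (1218 * τ) * (factor28 (expPi (84 * τ)) 28 ^ 12
        * (prodTwo (expPi (84 * τ)) ^ 3 * prodFour (expPi (84 * τ)))) := by
  rw [prodTwo, prodFour, oddDen,
    levelTheta_eq (g := 2) (by norm_num) (by norm_num) hτ,
    levelTheta_eq (g := 6) (by norm_num) (by norm_num) hτ,
    levelTheta_eq (g := 10) (by norm_num) (by norm_num) hτ,
    levelTheta_eq (g := 14) (by norm_num) (by norm_num) hτ,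
    levelTheta_eq (g := 4) (by norm_num) (by norm_num) hτ,
    levelTheta_eq (g := 8) (by norm_num) (by norm_num) hτ,
    levelTheta_eq (g := 12) (by norm_num) (by norm_num) hτ,
    expPi_three_half_mul 144 _ _ (by norm_num), expPi_three_half_mul 64 _ _ (by norm_num),
    expPi_three_half_mul 16 _ _ (by norm_num), expPi_three_half_mul 0 _ _ (by norm_num),
    expPi_three_half_mul 100 _ _ (by norm_num),
    expPi_three_half_mul 36 _ _ (by norm_num), expPi_three_half_mul 4 _ _ (by norm_num),
    show (1218 : ℂ) * τ = 3 / 2 * 812 * τ by ring, expPi_three_half_mul 812 _ _ (by norm_num)]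
  norm_num only
  ring

theorem quintuple_levelTheta {m : ℕ} (hm : m ≤ 6) {τ : ℂ} (hτ : 0 < τ.im) :
    factor28 (expPi (84 * τ)) 14 * (levelTheta τ (m / 28) 0 * levelTheta τ ((14 - m) / 28) 0
      * levelTheta τ ((14 - 2 * m) / 28) 0) = expPi ((9 * m ^ 2 - 42 * m + 294) * τ)
        * (factor28 (expPi (84 * τ)) 28 ^ 2 * quintupleProd (expPi (84 * τ)) m) := by
  have hx := norm_expPi_lt_one (im_natCast_mul_pos (n := 84) (by norm_num) hτ)
  push_cast at hx
  have c1 : ((14 - m : ℕ) : ℂ) = 14 - m := by rw [Nat.cast_sub (by omega)]; norm_num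
  have c2 : ((14 - 2 * m : ℕ) : ℂ) = 14 - 2 * m := by rw [Nat.cast_sub (by omega)]; norm_num
  rw [quintupleProd_eq hx,
    levelTheta_eq (g := m) (by omega) rfl hτ,
    levelTheta_eq (g := 14 - m) (by omega) (by rw [Nat.cast_sub (by omega)]; norm_num) hτ,
    levelTheta_eq (g := 14 - 2 * m) (by omega) (by rw [Nat.cast_sub (by omega)]; norm_num) hτ,
    show 28 - m = 14 - m + 14 by omega, show 28 - (14 - m) = m + 14 by omega,
    show 28 - (14 - 2 * m) = 14 + 2 * m by omega, c1, c2,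
    show (9 * (m : ℂ) ^ 2 - 42 * m + 294) * τ = 3 / 2 * (14 - m) ^ 2 * τ
      + 3 / 2 * (14 - (14 - m)) ^ 2 * τ + 3 / 2 * (14 - (14 - 2 * m)) ^ 2 * τ by ring,
    expPi_add, expPi_add]
  ring

/-- At `m = 3, 5, 1` the exponent `9m² - 42m + 35` is `-10, 50, 2`. This is `168C`, with `C` the
shift of the Nahm sum, plus 42 times the power `0, 1, 0` of `q` in front of the even part: the
shifts are exactly those that produce pure theta quotients. -/
theorem evenQuot_levelTheta {C : ℂ}
    (hD : ∀ τ : ℂ, 0 < τ.im → thetaD (fun a b => charTheta a b τ)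
      = C * expPi (5 / 6 * τ) * qPochInf (expPi (2 * τ)) (expPi (2 * τ)) ^ 10)
    {m : ℕ} (hm : m ≤ 6) {τ : ℂ} (hτ : 0 < τ.im) :
    evenNum m (levelTheta τ) / evenDen (levelTheta τ)
      = C * (expPi ((9 * m ^ 2 - 42 * m + 35) * τ) * evenPart (expPi (84 * τ)) m) := by
  have hx := norm_expPi_lt_one (im_natCast_mul_pos (n := 84) (by norm_num) hτ)
  push_cast at hx
  have h := quintuple_levelTheta hm hτ
  have h14 := factor28_ne_zero hx (g := 14) (by norm_num)
  have h28 := factor28_ne_zero hx (g := 28) (by norm_num)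
  have ho := prodOdd_ne_zero hx
  have hf := prodFour_ne_zero hx
  have hE := expPi_ne_zero (1575 * τ)
  have h2 : levelTheta τ (2 / 28) 0 * levelTheta τ (6 / 28) 0 * levelTheta τ (10 / 28) 0
      * levelTheta τ (14 / 28) 0 = expPi (336 * τ) * (factor28 (expPi (84 * τ)) 28 ^ 4
        * (prodTwo (expPi (84 * τ)) * factor28 (expPi (84 * τ)) 14)) := by
    rw [prodTwo,
      levelTheta_eq (g := 2) (by norm_num) (by norm_num) hτ,
      levelTheta_eq (g := 6) (by norm_num) (by norm_num) hτ,
      levelTheta_eq (g := 10) (by norm_num) (by norm_num) hτ,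
      levelTheta_eq (g := 14) (by norm_num) (by norm_num) hτ,
      expPi_three_half_mul 144 _ _ (by norm_num), expPi_three_half_mul 64 _ _ (by norm_num),
      expPi_three_half_mul 16 _ _ (by norm_num), expPi_three_half_mul 0 _ _ (by norm_num),
      show (336 : ℂ) * τ = 3 / 2 * 224 * τ by ring, expPi_three_half_mul 224 _ _ (by norm_num)]
    norm_num only
    ring
  have hexp : expPi (980 * τ) * expPi (336 * τ) * expPi ((9 * m ^ 2 - 42 * m + 294) * τ)
      = expPi ((9 * m ^ 2 - 42 * m + 35) * τ) * expPi (1575 * τ) := by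
    rw [← expPi_add, ← expPi_add, ← expPi_add]
    ring_nf
  rw [evenNum, evenDen_levelTheta hτ, evenPart_eq hx, h2, thetaD_levelTheta C hD hτ,
    div_eq_iff (by simp [*])]
  generalize levelTheta τ (m / 28) 0 * levelTheta τ ((14 - m) / 28) 0
    * levelTheta τ ((14 - 2 * m) / 28) 0 = K at h ⊢
  generalize expPi ((9 * m ^ 2 - 42 * m + 294) * τ) = E1 at *
  generalize expPi ((9 * m ^ 2 - 42 * m + 35) * τ) = E2 at *
  generalize expPi (1575 * τ) = E3 at *
  generalize expPi (980 * τ) = E4 at *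
  generalize expPi (336 * τ) = E5 at *
  generalize expPi (84 * τ) = x at *
  generalize factor28 x 28 = p at *
  generalize factor28 x 14 = r at *
  generalize prodOdd x = a at *
  generalize prodTwo x = b at *
  generalize prodFour x = c at *
  field_simp
  linear_combination C * E4 * E5 * b * h + C * p ^ 2 * b * quintupleProd x m * hexp

theorem oddQuot_levelTheta {C : ℂ}
    (hD : ∀ τ : ℂ, 0 < τ.im → thetaD (fun a b => charTheta a b τ)
      = C * expPi (5 / 6 * τ) * qPochInf (expPi (2 * τ)) (expPi (2 * τ)) ^ 10)
    {m : ℕ} (hm : m ≤ 6) {τ : ℂ} (hτ : 0 < τ.im) :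
    oddNum m (levelTheta τ) / oddDen (levelTheta τ)
      = C * (expPi ((9 * m ^ 2 - 42 * m + 56) * τ) * oddPart (expPi (84 * τ)) m) := by
  have hx := norm_expPi_lt_one (im_natCast_mul_pos (n := 84) (by norm_num) hτ)
  push_cast at hx
  have h := quintuple_levelTheta hm hτ
  have h14 := factor28_ne_zero hx (g := 14) (by norm_num)
  have h28 := factor28_ne_zero hx (g := 28) (by norm_num)
  have ht := prodTwo_ne_zero hx
  have hf := prodFour_ne_zero hx
  have hE := expPi_ne_zero (1218 * τ)
  have hexp : expPi (980 * τ) * expPi ((9 * m ^ 2 - 42 * m + 294) * τ)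
      = expPi ((9 * m ^ 2 - 42 * m + 56) * τ) * expPi (1218 * τ) := by
    rw [← expPi_add, ← expPi_add]
    ring_nf
  rw [← mul_div_mul_left _ _ h14, oddNum, oddDen_levelTheta hτ, oddPart_eq hx,
    thetaD_levelTheta C hD hτ, div_eq_iff (by simp [*])]
  generalize levelTheta τ (m / 28) 0 * levelTheta τ ((14 - m) / 28) 0
    * levelTheta τ ((14 - 2 * m) / 28) 0 = K at h ⊢
  generalize expPi ((9 * m ^ 2 - 42 * m + 294) * τ) = E1 at *
  generalize expPi ((9 * m ^ 2 - 42 * m + 56) * τ) = E2 at *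
  generalize expPi (1218 * τ) = E3 at *
  generalize expPi (980 * τ) = E4 at *
  generalize expPi (84 * τ) = x at *
  generalize factor28 x 28 = p at *
  generalize factor28 x 14 = r at *
  generalize prodTwo x = b at *
  generalize prodFour x = c at *
  trans C * E2 * quintupleProd x m * E3 * p ^ 12
  · linear_combination C * p ^ 10 * E4 * h + C * p ^ 12 * quintupleProd x m * hexp
  · field_simp

theorem evenDen_levelTheta_ne_zero {τ : ℂ} (hτ : 0 < τ.im) : evenDen (levelTheta τ) ≠ 0 := by
  have hx := norm_expPi_lt_one (im_natCast_mul_pos (n := 84) (by norm_num) hτ)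
  push_cast at hx
  simp [evenDen_levelTheta hτ, expPi_ne_zero, factor28_ne_zero hx, prodOdd_ne_zero hx,
    prodFour_ne_zero hx]

theorem oddDen_levelTheta_ne_zero {τ : ℂ} (hτ : 0 < τ.im) : oddDen (levelTheta τ) ≠ 0 := by
  have hx := norm_expPi_lt_one (im_natCast_mul_pos (n := 84) (by norm_num) hτ)
  push_cast at hx
  refine right_ne_zero_of_mul (a := factor28 (expPi (84 * τ)) 14) ?_
  simp [oddDen_levelTheta hτ, expPi_ne_zero, factor28_ne_zero hx, prodTwo_ne_zero hx,
    prodFour_ne_zero hx]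

/-! ### The Nahm sums as double sums -/

/-- The quadratic form and linear term here are a quarter of those in the double sums, so the
variable there is `e^{πiτ/2}`. -/
theorem nahmTerm_zagierMatrix (α β : ℤ) (C : ℝ) (τ : ℂ) (n : Fin 2 → ℕ) :
    nahmTerm zagierMatrix ![α / 4, β / 4] C τ n
      = expPi (2 * C * τ) * doubleTerm (expPi (τ / 2)) α β (n 0, n 1) := by
  have e4 : Complex.exp (2 * Real.pi * Complex.I * τ) = expPi (τ / 2) ^ 4 := by
    rw [← expPi_nsmul, expPi]
    push_cast
    ring_nf
  rw [nahmTerm, doubleTerm, e4, ← expPi_zsmul, ← mul_div_assoc, ← expPi_add, expPi]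
  simp only [Fin.prod_univ_two, Fin.sum_univ_two, zagierMatrix, Matrix.of_apply,
    Matrix.cons_val_zero, Matrix.cons_val_one, Matrix.cons_val', Matrix.cons_val_fin_one]
  congr 2
  push_cast
  ring

theorem hasSum_nahmTerm {α β : ℤ} {C : ℝ} {τ s : ℂ}
    (h : HasSum (doubleTerm (expPi (τ / 2)) α β) s) :
    HasSum (nahmTerm zagierMatrix ![α / 4, β / 4] C τ) (expPi (2 * C * τ) * s) := by
  refine (((finTwoArrowEquiv ℕ).hasSum_iff.mpr h).mul_left _).congr_fun fun n => ?_
  rw [nahmTerm_zagierMatrix]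
  rfl

theorem summable_nahmTerm {α β : ℤ} (hα : 0 ≤ α) (hβ : -2 ≤ β) (C : ℝ) {τ : ℂ} (hτ : 0 < τ.im) :
    Summable (nahmTerm zagierMatrix ![α / 4, β / 4] C τ) := by
  have h2 : 0 < (τ / 2).im := by simpa using hτ
  exact (hasSum_nahmTerm
    (summable_doubleTerm (expPi_ne_zero _) (norm_expPi_lt_one h2) hα hβ).hasSum).summable

theorem nahmSum_eq {α β : ℤ} {C : ℝ} {τ s : ℂ}
    (h : HasSum (doubleTerm (expPi (τ / 2)) α β) s) :
    nahmSum zagierMatrix ![α / 4, β / 4] C τ = expPi (2 * C * τ) * s :=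
  (hasSum_nahmTerm h).tsum_eq

theorem nahmSum_one (τ : ℂ) (hτ : 0 < τ.im) : nahmSum zagierMatrix ![0, 0] (-5 / 84) (84 * τ)
    = expPi (-10 * τ) * evenPart (expPi (84 * τ)) 3
      + 2 * (expPi (32 * τ) * oddPart (expPi (84 * τ)) 4) := by
  have h1 := norm_expPi_lt_one (im_natCast_mul_pos (n := 42) (by norm_num) hτ)
  have h := hasSum_doubleTerm_one (expPi_ne_zero _) h1
  push_cast at h
  rw [← expPi_nsmul, show ((2 : ℕ) : ℂ) * (42 * τ) = 84 * τ by push_cast; ring,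
    show 42 * τ = 84 * τ / 2 by ring] at h
  have e : expPi (32 * τ) = expPi (-10 * τ) * expPi (84 * τ / 2) := by rw [← expPi_add]; ring_nf
  have := nahmSum_eq (C := -5 / 84) h
  simp only [Int.cast_zero, zero_div] at this
  rw [this, e]
  push_cast
  ring_nf

theorem nahmSum_two (τ : ℂ) (hτ : 0 < τ.im) :
    nahmSum zagierMatrix ![1 / 2, -1 / 2] (1 / 21) (84 * τ)
      = expPi (50 * τ) * evenPart (expPi (84 * τ)) 5
        + 2 * (expPi (8 * τ) * oddPart (expPi (84 * τ)) 2) := by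
  have h1 := norm_expPi_lt_one (im_natCast_mul_pos (n := 42) (by norm_num) hτ)
  have h := hasSum_doubleTerm_two (expPi_ne_zero _) h1
  push_cast at h
  rw [← expPi_nsmul, show ((2 : ℕ) : ℂ) * (42 * τ) = 84 * τ by push_cast; ring,
    show 42 * τ = 84 * τ / 2 by ring] at h
  have e : expPi (50 * τ) = expPi (8 * τ) * expPi (84 * τ / 2) := by rw [← expPi_add]; ring_nf
  have := nahmSum_eq (C := 1 / 21) h
  rw [show (((2 : ℤ) : ℝ) / 4) = 1 / 2 by norm_num,
    show (((-2 : ℤ) : ℝ) / 4) = -1 / 2 by norm_num] at this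
  rw [this, e]
  push_cast
  ring_nf

theorem nahmSum_three (τ : ℂ) (hτ : 0 < τ.im) :
    nahmSum zagierMatrix ![1 / 2, 0] (1 / 84) (84 * τ)
      = expPi (2 * τ) * evenPart (expPi (84 * τ)) 1
        + 2 * (expPi (128 * τ) * oddPart (expPi (84 * τ)) 6) := by
  have h1 := norm_expPi_lt_one (im_natCast_mul_pos (n := 42) (by norm_num) hτ)
  have h := hasSum_doubleTerm_three (expPi_ne_zero _) h1
  push_cast at h
  rw [← expPi_nsmul, ← expPi_nsmul, show ((2 : ℕ) : ℂ) * (42 * τ) = 84 * τ by push_cast; ring,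
    show ((3 : ℕ) : ℂ) * (42 * τ) = 126 * τ by push_cast; ring,
    show 42 * τ = 84 * τ / 2 by ring] at h
  have e : expPi (128 * τ) = expPi (2 * τ) * expPi (126 * τ) := by rw [← expPi_add]; ring_nf
  have := nahmSum_eq (C := 1 / 84) h
  rw [show (((2 : ℤ) : ℝ) / 4) = 1 / 2 by norm_num, Int.cast_zero, zero_div] at this
  rw [this, e]
  push_cast
  ring_nf

/-! ### Transformation under `Γ₁(7056)` -/

open Matrix.SpecialLinearGroup in
theorem coe_smul_eq (γ : Matrix.SpecialLinearGroup (Fin 2) ℤ) (τ : UpperHalfPlane) :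
    ((γ • τ : UpperHalfPlane) : ℂ) = (γ 0 0 * τ + γ 0 1) / (γ 1 0 * τ + γ 1 1) := by
  rw [UpperHalfPlane.coe_specialLinearGroup_apply]
  simp

theorem smul_denom_ne_zero (γ : Matrix.SpecialLinearGroup (Fin 2) ℤ) (τ : UpperHalfPlane) :
    (γ 1 0 * τ + γ 1 1 : ℂ) ≠ 0 := by
  have := UpperHalfPlane.denom_ne_zero γ τ
  simpa [ModularGroup.denom_apply] using this

theorem im_affine_pos {α δ : ℤ} (hα : 0 < α) (hδ : 0 < δ) (β : ℤ) {τ : ℂ} (hτ : 0 < τ.im) :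
    0 < (((α : ℂ) * τ + β) / δ).im := by
  have h1 : (0 : ℝ) < α := by exact_mod_cast hα
  have h2 : (0 : ℝ) < δ := by exact_mod_cast hδ
  have : (((α : ℂ) * τ + β) / δ).im = α * τ.im / δ := by
    rw [← Complex.ofReal_intCast δ, Complex.div_ofReal_im]
    simp
  rw [this]
  positivity

/-- The transformation law for `τ ↦ Mτ`, given a decomposition
`diag(M, 1) γ = γ' (α β; 0 δ)`. -/
theorem charTheta_mul_smul (γ γ' : Matrix.SpecialLinearGroup (Fin 2) ℤ) {M : ℕ} {α β δ : ℤ}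
    (hα : 0 < α) (hδ : 0 < δ) (h00 : (M : ℤ) * γ 0 0 = γ' 0 0 * α)
    (h01 : (M : ℤ) * γ 0 1 = γ' 0 0 * β + γ' 0 1 * δ) (h10 : γ 1 0 = γ' 1 0 * α)
    (h11 : γ 1 1 = γ' 1 0 * β + γ' 1 1 * δ) (τ : UpperHalfPlane) :
    ∃ κ : ℂ, κ ≠ 0 ∧ ∀ a b : ℚ, charTheta a b (M * (γ • τ : UpperHalfPlane))
      = κ * charTheta (a * γ' 0 0 + b * γ' 1 0) (a * γ' 0 1 + b * γ' 1 1) ((α * τ + β) / δ) := by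
  obtain ⟨σ, hσ⟩ : ∃ σ : UpperHalfPlane, (σ : ℂ) = (α * τ + β) / δ :=
    ⟨⟨_, im_affine_pos hα hδ β τ.im_pos⟩, rfl⟩
  obtain ⟨κ, hκ, h⟩ := charTheta_smul γ' σ
  refine ⟨κ, hκ, fun a b => ?_⟩
  rw [← hσ, ← h]
  congr 1
  have hd := smul_denom_ne_zero γ τ
  have hδ0 : (δ : ℂ) ≠ 0 := by exact_mod_cast hδ.ne'
  have hd' := smul_denom_ne_zero γ' σ
  have k00 : (M : ℂ) * γ 0 0 = γ' 0 0 * α := by exact_mod_cast h00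
  have k01 : (M : ℂ) * γ 0 1 = γ' 0 0 * β + γ' 0 1 * δ := by exact_mod_cast h01
  have k10 : (γ 1 0 : ℂ) = γ' 1 0 * α := by exact_mod_cast h10
  have k11 : (γ 1 1 : ℂ) = γ' 1 0 * β + γ' 1 1 * δ := by exact_mod_cast h11
  have hσ' : (σ : ℂ) * δ = α * τ + β := by rw [hσ]; field_simp
  rw [coe_smul_eq, coe_smul_eq, ← mul_div_assoc, div_eq_div_iff hd hd']
  linear_combination (γ' 1 0 * σ + γ' 1 1 : ℂ) * (τ * k00 + k01 - γ' 0 0 * hσ')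
    - (γ' 0 0 * σ + γ' 0 1 : ℂ) * (τ * k10 + k11 - γ' 1 0 * hσ')

theorem charTheta_eq_of_eq_add {a b a' b' : ℚ} (m n : ℤ) (ha : a' = a + m) (hb : b' = b + n)
    {τ : ℂ} (hτ : 0 < τ.im) :
    charTheta a' b' τ = expPi (-m * (b + n) - m - n + a * n) * charTheta a b τ := by
  rw [ha, hb, charTheta_add_int a b m n hτ, expPi]

theorem expPi_eq_one {z : ℂ} (n : ℤ) (h : z = 2 * n) : expPi z = 1 := by
  rw [h, expPi_two_mul_int]

theorem expPi_eq_expPi {z w : ℂ} (n : ℤ) (h : z = w + 2 * n) : expPi z = expPi w := by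
  rw [h, expPi_add, expPi_two_mul_int, mul_one]

/-- The behaviour of the theta functions of level `1176` under `Γ₁(7056)`. -/
theorem levelTheta_smul {γ : Matrix.SpecialLinearGroup (Fin 2) ℤ}
    (hγ : γ ∈ CongruenceSubgroup.Gamma1 7056) (τ : UpperHalfPlane) :
    ∃ κ u : ℂ, κ ≠ 0 ∧ u ^ 4 = 1 ∧
      (∀ (x : ℚ) (g : ℤ), x = 2 * g / 28 →
        levelTheta (γ • τ : UpperHalfPlane) x 0 = κ * levelTheta τ x 0) ∧
      (∀ (x : ℚ) (g : ℤ), x = (2 * g + 1) / 28 →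
        levelTheta (γ • τ : UpperHalfPlane) x 0 = κ * u * levelTheta τ x 0) ∧
      thetaD (levelTheta (γ • τ : UpperHalfPlane)) = κ ^ 10 * thetaD (levelTheta τ) := by
  rw [CongruenceSubgroup.Gamma1_mem] at hγ
  obtain ⟨hA, hD, hc⟩ := hγ
  obtain ⟨c, hc⟩ := (ZMod.intCast_zmod_eq_zero_iff_dvd _ _).mp hc
  obtain ⟨a, ha⟩ := (ZMod.intCast_eq_intCast_iff_dvd_sub 1 (γ 0 0) 7056).mp (by simpa using hA.symm)
  obtain ⟨d, hd⟩ := (ZMod.intCast_eq_intCast_iff_dvd_sub 1 (γ 1 1) 7056).mp (by simpa using hD.symm)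
  replace ha : γ 0 0 = 1 + 7056 * a := by push_cast at ha; linarith
  replace hd : γ 1 1 = 1 + 7056 * d := by push_cast at hd; linarith
  push_cast at hc
  set B := γ 0 1 with hB
  have hdet : (1 + 7056 * a) * (1 + 7056 * d) - 1176 * B * (6 * c) = 1 := by
    have := γ.det_coe
    rw [Matrix.det_fin_two, ha, hd, hc, ← hB] at this
    linarith
  -- `γ'` satisfies `diag(1176, 1) γ = γ' diag(1176, 1)`. Since `7056 = 6·1176`, its lower left
  -- entry is divisible by 6, so it fixes the division points of order two and three modulo
  -- integers; `1176 = 28·42` does the same for `(g/28, 0)`.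
  let γ' : Matrix.SpecialLinearGroup (Fin 2) ℤ :=
    ⟨!![1 + 7056 * a, 1176 * B; 6 * c, 1 + 7056 * d], by rw [Matrix.det_fin_two_of]; exact hdet⟩
  have e00 : γ' 0 0 = 1 + 7056 * a := rfl
  have e01 : γ' 0 1 = 1176 * B := rfl
  have e10 : γ' 1 0 = 6 * c := rfl
  have e11 : γ' 1 1 = 1 + 7056 * d := rfl
  obtain ⟨κ, hκ, h⟩ := charTheta_mul_smul γ γ' (M := 1176) (α := 1176) (β := 0) (δ := 1)
    (by norm_num) one_pos (by rw [ha, e00]; push_cast; ring) (by rw [e00, e01, ← hB]; push_cast; ring)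
    (by rw [hc, e10]; ring) (by rw [hd, e10, e11]; ring) τ
  rw [e00, e01, e10, e11] at h
  push_cast at h
  simp only [add_zero, div_one] at h
  have hτ : 0 < (1176 * (τ : ℂ)).im := by
    have := im_natCast_mul_pos (n := 1176) (by norm_num) τ.im_pos
    exact_mod_cast this
  have key' : ∀ (x y : ℚ) (m n : ℤ), x * (1 + 7056 * a) + y * (6 * c) = x + m →
      x * (1176 * B) + y * (1 + 7056 * d) = y + n →
      levelTheta (γ • τ : UpperHalfPlane) x y
        = κ * (expPi (-m * (y + n) - m - n + x * n) * levelTheta τ x y) := by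
    intro x y m n hx hy
    rw [levelTheta, h, levelTheta, charTheta_eq_of_eq_add m n hx hy hτ]
  have key : ∀ (x y : ℚ) (m n : ℤ), x * (1 + 7056 * a) + y * (6 * c) = x + m →
      x * (1176 * B) + y * (1 + 7056 * d) = y + n →
      ∃ E : ℂ, E = -m * (y + n) - m - n + x * n ∧ levelTheta (γ • τ : UpperHalfPlane) x y
        = κ * (expPi E * levelTheta τ x y) :=
    fun x y m n hx hy => ⟨_, rfl, key' x y m n hx hy⟩
  -- For the characteristic `g/28` the phase is `(g/28)(42gB) = 3g²B/2` modulo 2. It is trivial for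
  -- even `g` and equals `3B/2` for odd `g`.
  refine ⟨κ, expPi (3 / 2 * B), hκ, ?_, ?_, ?_, ?_⟩
  · rw [← expPi_nsmul]
    exact expPi_eq_one (3 * B) (by push_cast; ring)
  · rintro _ g rfl
    rw [key' _ _ (504 * g * a) (84 * g * B) (by push_cast; ring) (by push_cast; ring),
      expPi_eq_one (-(504 * g * a) * (42 * g * B) - 252 * g * a - 42 * g * B + 3 * g ^ 2 * B)
        (by push_cast; ring), one_mul]
  · rintro _ g rfl
    rw [key' _ _ (252 * (2 * g + 1) * a) (42 * (2 * g + 1) * B) (by push_cast; ring)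
      (by push_cast; ring), expPi_eq_expPi (w := 3 / 2 * B)
        (-(252 * (2 * g + 1) * a) * (21 * (2 * g + 1) * B) - 126 * (2 * g + 1) * a
          - 21 * (2 * g + 1) * B + 3 * (g ^ 2 + g) * B) (by push_cast; ring)]
    ring
  · obtain ⟨E1, h1, k1⟩ := key (1 / 2) 0 (3528 * a) (588 * B) (by push_cast; ring)
      (by push_cast; ring)
    obtain ⟨E2, h2, k2⟩ := key 0 (1 / 2) (3 * c) (3528 * d) (by push_cast; ring)
      (by push_cast; ring)
    obtain ⟨E3, h3, k3⟩ := key (1 / 2) (1 / 2) (3528 * a + 3 * c) (588 * B + 3528 * d)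
      (by push_cast; ring) (by push_cast; ring)
    obtain ⟨E4, h4, k4⟩ := key 0 (1 / 3) (2 * c) (2352 * d) (by push_cast; ring)
      (by push_cast; ring)
    obtain ⟨E5, h5, k5⟩ := key (1 / 3) 0 (2352 * a) (392 * B) (by push_cast; ring)
      (by push_cast; ring)
    obtain ⟨E6, h6, k6⟩ := key (1 / 3) (1 / 3) (2352 * a + 2 * c) (392 * B + 2352 * d)
      (by push_cast; ring) (by push_cast; ring)
    obtain ⟨E7, h7, k7⟩ := key (1 / 3) (-(1 / 3)) (2352 * a - 2 * c) (392 * B - 2352 * d)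
      (by push_cast; ring) (by push_cast; ring)
    -- Only the total phase matters. With those of order two counted twice, the phases add up to an
    -- even integer, and the witness below is half of it.
    have hE : (expPi E1 * expPi E2 * expPi E3) ^ 2
        * (expPi E4 * expPi E5 * expPi E6 * expPi E7) = 1 := by
      rw [← expPi_add, ← expPi_add, ← expPi_add, ← expPi_add, ← expPi_add, ← expPi_nsmul,
        ← expPi_add]
      refine expPi_eq_one (-3528 * a * (588 * B) - 3528 * a - 588 * B - 3 * c * (3528 * d)
        - 3 * c - 3528 * d - (3528 * a + 3 * c) * (588 * B + 3528 * d) - (3528 * a + 3 * c)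
        - (588 * B + 3528 * d) - 3 * c - 1764 * a + 588 * B + 1764 * d - 2352 * c * d - c - 1176 * d
        - 1176 * a * (392 * B) - 1176 * a - 196 * B - (1176 * a + c) * (392 * B + 2352 * d)
        - (1176 * a + c) - (196 * B + 1176 * d) - (1176 * a - c) * (392 * B - 2352 * d)
        - (1176 * a - c) - (196 * B - 1176 * d) - c + 196 * B) ?_
      rw [h1, h2, h3, h4, h5, h6, h7]
      push_cast
      ring
    rw [thetaD, thetaD, k1, k2, k3, k4, k5, k6, k7]
    linear_combination κ ^ 10 * (levelTheta τ (1 / 2) 0 * levelTheta τ 0 (1 / 2)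
      * levelTheta τ (1 / 2) (1 / 2)) ^ 2 * (levelTheta τ 0 (1 / 3) * levelTheta τ (1 / 3) 0
      * levelTheta τ (1 / 3) (1 / 3) * levelTheta τ (1 / 3) (-(1 / 3))) * hE

/-- Both parts have degree 17 in the thetas. For odd `m` the numerator has two odd characteristics
and the denominator fourteen, and `u^14 = u^2` because `u^4 = 1`. -/
theorem evenQuot_smul {γ : Matrix.SpecialLinearGroup (Fin 2) ℤ}
    (hγ : γ ∈ CongruenceSubgroup.Gamma1 7056) (τ : UpperHalfPlane) {m : ℕ} (hm : Odd m) :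
    evenNum m (levelTheta (γ • τ : UpperHalfPlane)) / evenDen (levelTheta (γ • τ : UpperHalfPlane))
      = evenNum m (levelTheta τ) / evenDen (levelTheta τ) := by
  obtain ⟨κ, u, hκ, hu, he, ho, hD⟩ := levelTheta_smul hγ τ
  obtain ⟨r, rfl⟩ := hm
  have hu0 : u ≠ 0 := by rintro rfl; norm_num at hu
  have hnum : evenNum (2 * r + 1) (levelTheta (γ • τ : UpperHalfPlane))
      = κ ^ 17 * u ^ 2 * evenNum (2 * r + 1) (levelTheta τ) := by
    rw [evenNum, evenNum, hD, he (2 / 28) 1 (by norm_num), he (6 / 28) 3 (by norm_num),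
      he (10 / 28) 5 (by norm_num), he (14 / 28) 7 (by norm_num),
      ho ((2 * r + 1 : ℕ) / 28) r (by push_cast; ring),
      ho ((14 - (2 * r + 1 : ℕ)) / 28) (6 - r) (by push_cast; ring),
      he ((14 - 2 * (2 * r + 1 : ℕ)) / 28) (6 - 2 * r) (by push_cast; ring)]
    ring
  have hden : evenDen (levelTheta (γ • τ : UpperHalfPlane))
      = κ ^ 17 * u ^ 2 * evenDen (levelTheta τ) := by
    trans κ ^ 17 * (u ^ 2 * (u ^ 4) ^ 3) * evenDen (levelTheta τ)
    · rw [evenDen, evenDen, ho (1 / 28) 0 (by norm_num), ho (3 / 28) 1 (by norm_num),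
        ho (5 / 28) 2 (by norm_num), ho (7 / 28) 3 (by norm_num), ho (9 / 28) 4 (by norm_num),
        ho (11 / 28) 5 (by norm_num), ho (13 / 28) 6 (by norm_num), he (4 / 28) 2 (by norm_num),
        he (8 / 28) 4 (by norm_num), he (12 / 28) 6 (by norm_num)]
      ring
    · rw [hu]
      ring
  rw [hnum, hden, mul_div_mul_left _ _ (mul_ne_zero (pow_ne_zero _ hκ) (pow_ne_zero _ hu0))]

/-- For even `m` the thetas outside `thetaD` all have even characteristics, so numerator and
denominator both scale by `κ^13`. -/
theorem oddQuot_smul {γ : Matrix.SpecialLinearGroup (Fin 2) ℤ}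
    (hγ : γ ∈ CongruenceSubgroup.Gamma1 7056) (τ : UpperHalfPlane) {m : ℕ} (hm : Even m) :
    oddNum m (levelTheta (γ • τ : UpperHalfPlane)) / oddDen (levelTheta (γ • τ : UpperHalfPlane))
      = oddNum m (levelTheta τ) / oddDen (levelTheta τ) := by
  obtain ⟨κ, u, hκ, -, he, -, hD⟩ := levelTheta_smul hγ τ
  obtain ⟨r, rfl⟩ := hm
  have hnum : oddNum (r + r) (levelTheta (γ • τ : UpperHalfPlane))
      = κ ^ 13 * oddNum (r + r) (levelTheta τ) := by
    rw [oddNum, oddNum, hD, he ((r + r : ℕ) / 28) r (by push_cast; ring),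
      he ((14 - (r + r : ℕ)) / 28) (7 - r) (by push_cast; ring),
      he ((14 - 2 * (r + r : ℕ)) / 28) (7 - 2 * r) (by push_cast; ring)]
    ring
  have hden : oddDen (levelTheta (γ • τ : UpperHalfPlane)) = κ ^ 13 * oddDen (levelTheta τ) := by
    rw [oddDen, oddDen, he (2 / 28) 1 (by norm_num), he (6 / 28) 3 (by norm_num),
      he (10 / 28) 5 (by norm_num), he (14 / 28) 7 (by norm_num), he (4 / 28) 2 (by norm_num),
      he (8 / 28) 4 (by norm_num), he (12 / 28) 6 (by norm_num)]
    ring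
  rw [hnum, hden, mul_div_mul_left _ _ (pow_ne_zero _ hκ)]

/-! ### Behaviour at the cusps -/

/-- `α` is the gcd of the first column of `diag(M, 1)γ`. The column divided by `α` is primitive and
extends to a matrix in `SL(2, ℤ)`; comparing determinants gives `αδ = M`, hence `δ > 0`. -/
theorem exists_hermite_decomposition (γ : Matrix.SpecialLinearGroup (Fin 2) ℤ) {M : ℕ}
    (hM : 0 < M) : ∃ (γ' : Matrix.SpecialLinearGroup (Fin 2) ℤ) (α β δ : ℤ), 0 < α ∧ 0 < δ ∧
      (M : ℤ) * γ 0 0 = γ' 0 0 * α ∧ (M : ℤ) * γ 0 1 = γ' 0 0 * β + γ' 0 1 * δ ∧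
      γ 1 0 = γ' 1 0 * α ∧ γ 1 1 = γ' 1 0 * β + γ' 1 1 * δ := by
  have hdet : γ 0 0 * γ 1 1 - γ 0 1 * γ 1 0 = 1 := by
    have := γ.det_coe
    rwa [Matrix.det_fin_two] at this
  have hM' : (0 : ℤ) < M := by exact_mod_cast hM
  obtain ⟨α, hα⟩ : ∃ α : ℤ, α = Int.gcd (M * γ 0 0) (γ 1 0) := ⟨_, rfl⟩
  obtain ⟨p, hp⟩ : α ∣ M * γ 0 0 := hα ▸ Int.gcd_dvd_left ..
  obtain ⟨s, hs⟩ : α ∣ γ 1 0 := hα ▸ Int.gcd_dvd_right ..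
  have hα0 : 0 < α := by
    refine lt_of_le_of_ne (hα ▸ Int.natCast_nonneg _) fun h => ?_
    rw [← h, zero_mul] at hp hs
    have h0 : γ 0 0 = 0 := by
      rcases mul_eq_zero.mp hp with h | h
      · exact absurd h hM'.ne'
      · exact h
    rw [h0, hs] at hdet
    norm_num at hdet
  obtain ⟨u, v, huv⟩ : ∃ u v : ℤ, u * p + v * s = 1 := by
    have h := Int.gcd_eq_gcd_ab (M * γ 0 0) (γ 1 0)
    rw [← hα] at h
    refine ⟨Int.gcdA (M * γ 0 0) (γ 1 0), Int.gcdB (M * γ 0 0) (γ 1 0),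
      mul_left_cancel₀ hα0.ne' ?_⟩
    linear_combination -h - Int.gcdA (M * γ 0 0) (γ 1 0) * hp - Int.gcdB (M * γ 0 0) (γ 1 0) * hs
  let γ' : Matrix.SpecialLinearGroup (Fin 2) ℤ :=
    ⟨!![p, -v; s, u], by rw [Matrix.det_fin_two_of]; linear_combination huv⟩
  have e00 : γ' 0 0 = p := rfl
  have e01 : γ' 0 1 = -v := rfl
  have e10 : γ' 1 0 = s := rfl
  have e11 : γ' 1 1 = u := rfl
  refine ⟨γ', α, u * (M * γ 0 1) + v * γ 1 1, p * γ 1 1 - s * (M * γ 0 1), hα0, ?_, ?_, ?_, ?_, ?_⟩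
  · refine pos_of_mul_pos_right (a := α) ?_ hα0.le
    have : α * (p * γ 1 1 - s * (M * γ 0 1)) = M := by
      linear_combination M * hdet - γ 1 1 * hp + M * γ 0 1 * hs
    rwa [this]
  · rw [e00, hp, mul_comm]
  · rw [e00, e01]
    linear_combination -(M * γ 0 1) * huv
  · rw [e10, hs, mul_comm]
  · rw [e10, e11]
    linear_combination -γ 1 1 * huv

/-- `f` is a function of `e^{2πiτ/h}`, meromorphic at `0`, for some `h ≥ 1`. -/
def MeromorphicAtInfty (f : ℂ → ℂ) : Prop :=
  ∃ h : ℕ, 0 < h ∧ ∃ g : ℂ → ℂ, MeromorphicAt g 0 ∧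
    ∀ τ : ℂ, 0 < τ.im → f τ = g (Complex.exp (2 * Real.pi * Complex.I * τ / h))

theorem MeromorphicAtInfty.const (c : ℂ) : MeromorphicAtInfty fun _ => c :=
  ⟨1, one_pos, fun _ => c, .const c 0, fun _ _ => rfl⟩

theorem MeromorphicAtInfty.of_dvd {f : ℂ → ℂ} {h : ℕ} (hh : 0 < h) {g : ℂ → ℂ}
    (hg : MeromorphicAt g 0)
    (hf : ∀ τ : ℂ, 0 < τ.im → f τ = g (Complex.exp (2 * Real.pi * Complex.I * τ / h)))
    {k : ℕ} (hk : 0 < k) : ∃ g' : ℂ → ℂ, MeromorphicAt g' 0 ∧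
      ∀ τ : ℂ, 0 < τ.im → f τ = g' (Complex.exp (2 * Real.pi * Complex.I * τ / (h * k : ℕ))) := by
  refine ⟨g ∘ fun w => w ^ k, ?_, fun τ hτ => ?_⟩
  · refine MeromorphicAt.comp_analyticAt ?_ (by fun_prop)
    rwa [zero_pow hk.ne']
  · rw [hf τ hτ, Function.comp_apply, ← Complex.exp_nat_mul]
    have h1 : (h : ℂ) ≠ 0 := by exact_mod_cast hh.ne'
    have h2 : (k : ℂ) ≠ 0 := by exact_mod_cast hk.ne'
    congr 2
    push_cast
    field_simp

theorem MeromorphicAtInfty.common {f₁ f₂ : ℂ → ℂ} (h₁ : MeromorphicAtInfty f₁)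
    (h₂ : MeromorphicAtInfty f₂) : ∃ h : ℕ, 0 < h ∧ ∃ g₁ g₂ : ℂ → ℂ,
      MeromorphicAt g₁ 0 ∧ MeromorphicAt g₂ 0 ∧ ∀ τ : ℂ, 0 < τ.im →
        f₁ τ = g₁ (Complex.exp (2 * Real.pi * Complex.I * τ / h)) ∧
        f₂ τ = g₂ (Complex.exp (2 * Real.pi * Complex.I * τ / h)) := by
  obtain ⟨k₁, hk₁, g₁, hg₁, e₁⟩ := h₁
  obtain ⟨k₂, hk₂, g₂, hg₂, e₂⟩ := h₂
  obtain ⟨G₁, hG₁, E₁⟩ := MeromorphicAtInfty.of_dvd hk₁ hg₁ e₁ hk₂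
  obtain ⟨G₂, hG₂, E₂⟩ := MeromorphicAtInfty.of_dvd hk₂ hg₂ e₂ hk₁
  rw [mul_comm k₂ k₁] at E₂
  exact ⟨k₁ * k₂, mul_pos hk₁ hk₂, G₁, G₂, hG₁, hG₂, fun τ hτ => ⟨E₁ τ hτ, E₂ τ hτ⟩⟩

theorem MeromorphicAtInfty.mul {f₁ f₂ : ℂ → ℂ} (h₁ : MeromorphicAtInfty f₁)
    (h₂ : MeromorphicAtInfty f₂) : MeromorphicAtInfty fun τ => f₁ τ * f₂ τ := by
  obtain ⟨h, hh, g₁, g₂, hg₁, hg₂, e⟩ := h₁.common h₂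
  exact ⟨h, hh, g₁ * g₂, hg₁.mul hg₂, fun τ hτ => by
    simp only [(e τ hτ).1, (e τ hτ).2, Pi.mul_apply]⟩

theorem MeromorphicAtInfty.div {f₁ f₂ : ℂ → ℂ} (h₁ : MeromorphicAtInfty f₁)
    (h₂ : MeromorphicAtInfty f₂) : MeromorphicAtInfty fun τ => f₁ τ / f₂ τ := by
  obtain ⟨h, hh, g₁, g₂, hg₁, hg₂, e⟩ := h₁.common h₂
  exact ⟨h, hh, g₁ / g₂, hg₁.div hg₂, fun τ hτ => by
    simp only [(e τ hτ).1, (e τ hτ).2, Pi.div_apply]⟩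

theorem MeromorphicAtInfty.add {f₁ f₂ : ℂ → ℂ} (h₁ : MeromorphicAtInfty f₁)
    (h₂ : MeromorphicAtInfty f₂) : MeromorphicAtInfty fun τ => f₁ τ + f₂ τ := by
  obtain ⟨h, hh, g₁, g₂, hg₁, hg₂, e⟩ := h₁.common h₂
  exact ⟨h, hh, g₁ + g₂, hg₁.add hg₂, fun τ hτ => by
    simp only [(e τ hτ).1, (e τ hτ).2, Pi.add_apply]⟩

theorem MeromorphicAtInfty.pow {f : ℂ → ℂ} (hf : MeromorphicAtInfty f) (n : ℕ) :
    MeromorphicAtInfty fun τ => f τ ^ n := by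
  obtain ⟨h, hh, g, hg, e⟩ := hf
  exact ⟨h, hh, g ^ n, hg.pow n, fun τ hτ => by simp only [e τ hτ, Pi.pow_apply]⟩

/-- A power series with bounded coefficients and quadratic exponents is analytic at `0`. -/
theorem analyticAt_tsum_quadratic {c : ℤ → ℂ} (hc : ∀ n, ‖c n‖ ≤ 1) {a : ℤ} (ha : 0 < a) (b d : ℤ)
    {N : ℤ → ℕ} (hN : ∀ n, (N n : ℤ) = a * n ^ 2 + b * n + d) :
    AnalyticAt ℂ (fun w => ∑' n, c n * w ^ N n) 0 := by
  have hs : Summable fun n : ℤ => (1 / 2 : ℝ) ^ N n := by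
    have := summable_norm_zpow_quadratic' (q := (1 / 2 : ℂ)) (by norm_num) (by norm_num) ha b d
    refine this.congr fun n => ?_
    rw [← hN, zpow_natCast, norm_pow]
    norm_num
  have hd : DifferentiableOn ℂ (fun w => ∑' n, c n * w ^ N n) (Metric.ball 0 (1 / 2)) := by
    refine Complex.differentiableOn_tsum_of_summable_norm hs (fun n => by fun_prop)
      Metric.isOpen_ball fun n w hw => ?_
    rw [mem_ball_zero_iff] at hw
    rw [norm_mul, norm_pow]
    calc ‖c n‖ * ‖w‖ ^ N n ≤ 1 * (1 / 2) ^ N n := by gcongr; exact hc n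
      _ = _ := one_mul _
  exact hd.analyticAt (Metric.ball_mem_nhds _ (by norm_num))

/-- For `a = u/v` one has `(n + a - 1/2)² = (2vn + 2u - v)²/(4v²)`. With `h = 8v²δ` the terms become
phases times natural powers of `e^{2πiτ/h}`. -/
theorem meromorphicAtInfty_charTheta (a b : ℚ) {α δ : ℤ} (hα : 0 < α) (hδ : 0 < δ) (β : ℤ) :
    MeromorphicAtInfty fun τ => charTheta a b ((α * τ + β) / δ) := by
  obtain ⟨v, hv⟩ : ∃ v : ℤ, v = a.den := ⟨_, rfl⟩
  obtain ⟨u, hu⟩ : ∃ u : ℤ, u = a.num := ⟨_, rfl⟩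
  have hv0 : 0 < v := by have := a.den_pos; omega
  have ha : (a : ℂ) = u / v := by
    conv_lhs => rw [← Rat.num_div_den a]
    rw [hu, hv]
    push_cast
    rfl
  have hvC : (v : ℂ) ≠ 0 := by exact_mod_cast hv0.ne'
  have hδC : (δ : ℂ) ≠ 0 := by exact_mod_cast hδ.ne'
  obtain ⟨h, hh⟩ : ∃ h : ℕ, (h : ℤ) = 8 * v ^ 2 * δ := ⟨(8 * v ^ 2 * δ).toNat, by
    rw [Int.toNat_of_nonneg (by positivity)]⟩
  have hhC : (h : ℂ) = 8 * v ^ 2 * δ := by exact_mod_cast hh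
  have hh0 : 0 < h := by
    have : 0 < (h : ℤ) := by rw [hh]; positivity
    exact_mod_cast this
  have hN : ∀ n : ℤ, ((α * (2 * v * n + (2 * u - v)) ^ 2).toNat : ℤ)
      = 4 * v ^ 2 * α * n ^ 2 + 4 * v * α * (2 * u - v) * n + α * (2 * u - v) ^ 2 := by
    intro n
    rw [Int.toNat_of_nonneg (by positivity)]
    ring
  refine ⟨h, hh0, _, (analyticAt_tsum_quadratic (c := fun n =>
    expPi (((((n : ℝ) + a - 1 / 2) ^ 2 * β / δ + 2 * (n - 1 / 2) * b + a * b + n : ℝ)) : ℂ))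
    (fun n => ?_) (by positivity) _ _ hN).meromorphicAt, fun τ hτ => ?_⟩
  · rw [norm_expPi, Complex.ofReal_im]
    simp
  · refine (hasSum_charTheta a b (im_affine_pos hα hδ β hτ)).tsum_eq.symm.trans ?_
    refine tsum_congr fun n => ?_
    have hNC : (((α * (2 * v * n + (2 * u - v)) ^ 2).toNat : ℕ) : ℂ)
        = α * (2 * v * n + (2 * u - v)) ^ 2 := by
      have : (((α * (2 * v * n + (2 * u - v)) ^ 2).toNat : ℕ) : ℤ)
        = α * (2 * v * n + (2 * u - v)) ^ 2 := Int.toNat_of_nonneg (by positivity)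
      exact_mod_cast this
    rw [← Complex.exp_nat_mul, hNC, expPi, ← Complex.exp_add, hhC]
    congr 1
    push_cast
    rw [ha]
    field_simp
    ring

theorem meromorphicAtInfty_evenQuot (m : ℕ) {k : ℂ → ℚ → ℚ → ℂ}
    (hk : ∀ a b, MeromorphicAtInfty fun τ => k τ a b) :
    MeromorphicAtInfty fun τ => evenNum m (k τ) / evenDen (k τ) := by
  simp only [evenNum, evenDen, thetaD]
  repeat' first
    | exact hk _ _
    | apply MeromorphicAtInfty.pow
    | apply MeromorphicAtInfty.div
    | apply MeromorphicAtInfty.mul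

theorem meromorphicAtInfty_oddQuot (m : ℕ) {k : ℂ → ℚ → ℚ → ℂ}
    (hk : ∀ a b, MeromorphicAtInfty fun τ => k τ a b) :
    MeromorphicAtInfty fun τ => oddNum m (k τ) / oddDen (k τ) := by
  simp only [oddNum, oddDen, thetaD]
  repeat' first
    | exact hk _ _
    | apply MeromorphicAtInfty.pow
    | apply MeromorphicAtInfty.div
    | apply MeromorphicAtInfty.mul

/-- By homogeneity of degree 17 the automorphy factor drops out for each `τ` separately, so its
dependence on `τ` never has to be known. -/
theorem evenQuot_const_mul (m : ℕ) {κ : ℂ} (hκ : κ ≠ 0) (k : ℚ → ℚ → ℂ) :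
    evenNum m (fun a b => κ * k a b) / evenDen (fun a b => κ * k a b)
      = evenNum m k / evenDen k := by
  rw [← mul_div_mul_left (evenNum m k) _ (pow_ne_zero 17 hκ)]
  simp only [evenNum, evenDen, thetaD]
  congr 1 <;> ring

theorem oddQuot_const_mul (m : ℕ) {κ : ℂ} (hκ : κ ≠ 0) (k : ℚ → ℚ → ℂ) :
    oddNum m (fun a b => κ * k a b) / oddDen (fun a b => κ * k a b)
      = oddNum m k / oddDen k := by
  rw [← mul_div_mul_left (oddNum m k) _ (pow_ne_zero 13 hκ)]
  simp only [oddNum, oddDen, thetaD]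
  congr 1 <;> ring

/-! ### Holomorphy on the upper half-plane -/

theorem differentiableAt_levelTheta (a b : ℚ) {τ : ℂ} (hτ : 0 < τ.im) :
    DifferentiableAt ℂ (fun τ => levelTheta τ a b) τ := by
  have h0 := im_natCast_mul_pos (n := 1176) (by norm_num) hτ
  push_cast at h0
  have h1 := (hasFDerivAt_jacobiTheta₂ (((a : ℂ) - 1 / 2) * (1176 * τ) + b + 1 / 2)
    h0).differentiableAt
  have h2 : DifferentiableAt ℂ (fun τ : ℂ => ((((a : ℂ) - 1 / 2) * (1176 * τ) + b + 1 / 2 : ℂ),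
    (1176 * τ : ℂ))) τ := by fun_prop
  simp only [levelTheta, charTheta]
  exact DifferentiableAt.mul (by fun_prop) (DifferentiableAt.comp (g := fun p : ℂ × ℂ => jacobiTheta₂ p.1 p.2)
    τ h1 h2)

theorem differentiableAt_evenQuot (m : ℕ) {τ : ℂ} (hτ : 0 < τ.im) :
    DifferentiableAt ℂ (fun τ => evenNum m (levelTheta τ) / evenDen (levelTheta τ)) τ := by
  refine DifferentiableAt.fun_div ?_ ?_ (evenDen_levelTheta_ne_zero hτ) <;>
  · simp only [evenNum, evenDen, thetaD]
    repeat' first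
      | exact differentiableAt_levelTheta _ _ hτ
      | apply DifferentiableAt.fun_pow
      | apply DifferentiableAt.fun_mul

theorem differentiableAt_oddQuot (m : ℕ) {τ : ℂ} (hτ : 0 < τ.im) :
    DifferentiableAt ℂ (fun τ => oddNum m (levelTheta τ) / oddDen (levelTheta τ)) τ := by
  refine DifferentiableAt.fun_div ?_ ?_ (oddDen_levelTheta_ne_zero hτ) <;>
  · simp only [oddNum, oddDen, thetaD]
    repeat' first
      | exact differentiableAt_levelTheta _ _ hτ
      | apply DifferentiableAt.fun_pow
      | apply DifferentiableAt.fun_mul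

/-! ### Modularity -/

/-- Non-vanishing denominators give holomorphy, the multiplier computation gives invariance, and at
a cusp the thetas reduce to those at `(ατ + β)/δ`. -/
theorem isModularFunction_thetaQuot {m n : ℕ} (hm : Odd m) (hn : Even n) (c d : ℂ) :
    IsModularFunction (CongruenceSubgroup.Gamma1 7056) fun τ : UpperHalfPlane =>
      c * (evenNum m (levelTheta τ) / evenDen (levelTheta τ))
        + d * (oddNum n (levelTheta τ) / oddDen (levelTheta τ)) where
  meromorphic z hz := by
    have hopen : IsOpen {z : ℂ | 0 < z.im} := isOpen_lt continuous_const Complex.continuous_im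
    have hF : DifferentiableOn ℂ (fun z => c * (evenNum m (levelTheta z) / evenDen (levelTheta z))
        + d * (oddNum n (levelTheta z) / oddDen (levelTheta z))) {z : ℂ | 0 < z.im} := fun w hw =>
      (((differentiableAt_evenQuot m hw).const_mul c).add
        ((differentiableAt_oddQuot n hw).const_mul d)).differentiableWithinAt
    refine ((hF.analyticAt (hopen.mem_nhds hz)).congr ?_).meromorphicNFAt
    filter_upwards [hopen.mem_nhds hz] with w hw
    rw [UpperHalfPlane.ofComplex_apply_of_im_pos hw]
  invariant γ hγ τ := by
    rw [evenQuot_smul hγ τ hm, oddQuot_smul hγ τ hn]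
  meromorphic_at_cusps γ := by
    obtain ⟨γ', α, β, δ, hα, hδ, h00, h01, h10, h11⟩ :=
      exists_hermite_decomposition γ (M := 1176) (by norm_num)
    have hk := fun a b : ℚ => meromorphicAtInfty_charTheta (a * γ' 0 0 + b * γ' 1 0)
      (a * γ' 0 1 + b * γ' 1 1) hα hδ β
    obtain ⟨h, hh, g, hg, e⟩ := ((MeromorphicAtInfty.const c).mul
      (meromorphicAtInfty_evenQuot m hk)).add
        ((MeromorphicAtInfty.const d).mul (meromorphicAtInfty_oddQuot n hk))
    refine ⟨h, hh, g, hg, Eventually.of_forall fun τ => ?_⟩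
    obtain ⟨κ, hκ, hs⟩ := charTheta_mul_smul γ γ' hα hδ h00 h01 h10 h11 τ
    have : levelTheta (γ • τ : UpperHalfPlane) = fun a b => κ * charTheta
        (a * γ' 0 0 + b * γ' 1 0) (a * γ' 0 1 + b * γ' 1 1) ((α * τ + β) / δ) := by
      funext a b
      rw [← hs, levelTheta]
      norm_num
    rw [← e τ τ.im_pos, this, evenQuot_const_mul m hκ, oddQuot_const_mul n hκ]

theorem isModularFunction_of_eq {m n : ℕ} (hm : Odd m) (hn : Even n) (hm6 : m ≤ 6) (hn6 : n ≤ 6)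
    {f : UpperHalfPlane → ℂ} (hf : ∀ τ : UpperHalfPlane,
      f τ = expPi ((9 * m ^ 2 - 42 * m + 35) * τ) * evenPart (expPi (84 * τ)) m
        + 2 * (expPi ((9 * n ^ 2 - 42 * n + 56) * τ) * oddPart (expPi (84 * τ)) n)) :
    IsModularFunction (CongruenceSubgroup.Gamma1 7056) f := by
  obtain ⟨C, hC, hD⟩ := thetaD_charTheta
  convert isModularFunction_thetaQuot hm hn C⁻¹ (2 * C⁻¹) using 1
  funext τ
  rw [hf, evenQuot_levelTheta hD hm6 τ.im_pos, oddQuot_levelTheta hD hn6 τ.im_pos]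
  field_simp

theorem summable_and_isModularFunction (B : Fin 2 → ℝ) (C : ℝ)
    (hBC : (B = ![0, 0] ∧ C = -5 / 84) ∨ (B = ![1 / 2, -1 / 2] ∧ C = 1 / 21) ∨
      (B = ![1 / 2, 0] ∧ C = 1 / 84)) :
    (∀ τ : UpperHalfPlane, Summable (nahmTerm zagierMatrix B C (τ : ℂ))) ∧
      IsModularFunction (CongruenceSubgroup.Gamma1 7056)
        (fun τ : UpperHalfPlane => nahmSum zagierMatrix B C (84 * (τ : ℂ))) := by
  rcases hBC with ⟨rfl, rfl⟩ | ⟨rfl, rfl⟩ | ⟨rfl, rfl⟩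
  · refine ⟨fun τ => ?_, isModularFunction_of_eq (m := 3) (n := 4) (by decide) (by decide)
      (by norm_num) (by norm_num) fun τ => ?_⟩
    · simpa using summable_nahmTerm (α := 0) (β := 0) le_rfl (by norm_num) _ τ.im_pos
    · rw [nahmSum_one _ τ.im_pos]
      norm_num
  · refine ⟨fun τ => ?_, isModularFunction_of_eq (m := 5) (n := 2) (by decide) (by decide)
      (by norm_num) (by norm_num) fun τ => ?_⟩
    · have := summable_nahmTerm (α := 2) (β := -2) (by norm_num) le_rfl (1 / 21) τ.im_pos
      rwa [show (((2 : ℤ) : ℝ) / 4) = 1 / 2 by norm_num,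
        show (((-2 : ℤ) : ℝ) / 4) = -1 / 2 by norm_num] at this
    · rw [nahmSum_two _ τ.im_pos]
      norm_num
  · refine ⟨fun τ => ?_, isModularFunction_of_eq (m := 1) (n := 6) (by decide) (by decide)
      (by norm_num) (by norm_num) fun τ => ?_⟩
    · have := summable_nahmTerm (α := 2) (β := 0) (by norm_num) (by norm_num) (1 / 84) τ.im_pos
      rwa [show (((2 : ℤ) : ℝ) / 4) = 1 / 2 by norm_num, Int.cast_zero, zero_div] at this
    · rw [nahmSum_three _ τ.im_pos]
      norm_num

end Nahm

theorem theorem7 :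
    -- the three identities, for every complex `q` with `|q| < 1`
    (∀ q : ℂ, ‖q‖ < 1 →
      HasSum (fun p : ℕ × ℕ =>
          q ^ ((p.1 : ℤ) ^ 2 + 2 * (p.2 : ℤ) ^ 2 - 2 * (p.1 : ℤ) * (p.2 : ℤ)) /
            (Nahm.qPoch (q ^ 4) (q ^ 4) p.1 * Nahm.qPoch (q ^ 4) (q ^ 4) p.2))
        ((Nahm.J 4 q ^ 3 * Nahm.J 56 q * Nahm.JJ 6 28 q) /
            (Nahm.J 2 q ^ 2 * Nahm.J 8 q * Nahm.JJ 8 56 q * Nahm.JJ 24 56 q) +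
          2 * q * ((Nahm.J 8 q * Nahm.J 56 q * Nahm.JJ 8 56 q) /
            (Nahm.J 4 q ^ 2 * Nahm.JJ 4 56 q)))) ∧
    (∀ q : ℂ, ‖q‖ < 1 →
      HasSum (fun p : ℕ × ℕ =>
          q ^ ((p.1 : ℤ) ^ 2 + 2 * (p.2 : ℤ) ^ 2 - 2 * (p.1 : ℤ) * (p.2 : ℤ)
              + 2 * (p.1 : ℤ) - 2 * (p.2 : ℤ)) /
            (Nahm.qPoch (q ^ 4) (q ^ 4) p.1 * Nahm.qPoch (q ^ 4) (q ^ 4) p.2))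
        (2 * ((Nahm.J 8 q * Nahm.J 56 q * Nahm.JJ 24 56 q) /
            (Nahm.J 4 q ^ 2 * Nahm.JJ 12 56 q)) +
          q * ((Nahm.J 4 q ^ 3 * Nahm.J 28 q * Nahm.JJ 10 56 q * Nahm.JJ 18 56 q) /
            (Nahm.J 2 q ^ 2 * Nahm.J 8 q * Nahm.J 56 q * Nahm.JJ 16 56 q * Nahm.JJ 24 56 q)))) ∧
    (∀ q : ℂ, ‖q‖ < 1 →
      HasSum (fun p : ℕ × ℕ =>
          q ^ ((p.1 : ℤ) ^ 2 + 2 * (p.2 : ℤ) ^ 2 - 2 * (p.1 : ℤ) * (p.2 : ℤ) + 2 * (p.1 : ℤ)) /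
            (Nahm.qPoch (q ^ 4) (q ^ 4) p.1 * Nahm.qPoch (q ^ 4) (q ^ 4) p.2))
        ((Nahm.J 4 q ^ 3 * Nahm.J 28 q * Nahm.JJ 2 56 q * Nahm.JJ 26 56 q) /
            (Nahm.J 2 q ^ 2 * Nahm.J 8 q * Nahm.J 56 q * Nahm.JJ 8 56 q * Nahm.JJ 16 56 q) +
          2 * q ^ 3 * ((Nahm.J 8 q * Nahm.J 56 q * Nahm.JJ 16 56 q) /
            (Nahm.J 4 q ^ 2 * Nahm.JJ 20 56 q)))) ∧
    -- the Nahm sums `f_{A,B,C}(q)`, `q = e^{2πiτ}`, converge, and `f_{A,B,C}(q^84)` is modular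
    (∀ (B : Fin 2 → ℝ) (C : ℝ),
      ((B = ![0, 0] ∧ C = -5 / 84) ∨ (B = ![1 / 2, -1 / 2] ∧ C = 1 / 21) ∨
        (B = ![1 / 2, 0] ∧ C = 1 / 84)) →
      (∀ τ : UpperHalfPlane, Summable (Nahm.nahmTerm Nahm.zagierMatrix B C (τ : ℂ))) ∧
      Nahm.IsModularFunction (CongruenceSubgroup.Gamma1 7056)
        (fun τ : UpperHalfPlane => Nahm.nahmSum Nahm.zagierMatrix B C (84 * (τ : ℂ)))) := by
  exact ⟨Nahm.identity_one, Nahm.identity_two, Nahm.identity_three,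
    Nahm.summable_and_isModularFunction⟩
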